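/- **Setting.** Let $\mathcal S,\mathcal A$ be finite, $p(s'\mid s,a)$ a transition law and $r:\mathcal S\times\mathcal A\to[0,r_{\max}]$ a reward. Let $\{\pi_\theta\}_{\theta\in\mathbb R^d}$ be policies with $\pi_\theta(a\mid s)>0$, $\log\pi_\theta(a\mid s)$ differentiable in $\theta$, and, for constants $B,K,L$ and all $\theta,\theta',s,a$: $\|\nabla\log\pi_\theta(a\mid s)\|\le B$, $\|\nabla\log\pi_\theta(a\mid s)-\nabla\log\pi_{\theta'}(a\mid s)\|\le K\|\theta-\theta'\|$, $|\pi_\theta(a\mid s)-\pi_{\theta'}(a\mid s)|\le L\|\theta-\theta'\|$. Put $P_\theta(s'\mid s)=\sum_a\pi_\theta(a\mid s)p(s'\mid s,a)$ and assume that for every $\theta$ there is $k$ with $\sup_{s,s'}\|P_\theta^k(\cdot\mid s)-P_\theta^k(\cdot\mid s')\|_{TV}<1$. Let $d_\theta$ be the stationary distribution of $P_\theta$, $J(\theta)=\mathbb E_{s\sim d_\theta,a\sim\pi_\theta}[r(s,a)]$, and let $\tau_{mix}^\theta$ be the least $t\ge1$ with $\sup_s\|P_\theta^t(\cdot\mid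 s)-d_\theta\|_{TV}\le\frac14$. Let $\phi:\mathcal S\to\mathbb R^m$ with $\|\phi(s)\|\le1$, and $$A_\theta=\mathbb E[\phi(s)(\phi(s)-\phi(s'))^\top],\qquad b_\theta=\mathbb E[(r(s,a)-J(\theta))\phi(s)],\qquad s\sim d_\theta,\ a\sim\pi_\theta(\cdot\mid s),\ s'\sim p(\cdot\mid s,a).$$ Assume that for some $\lambda>0$ and all $\theta$ the (possibly non-symmetric) matrix $A_\theta$ is positive definite with all eigenvalues of modulus at least $\lambda$. Put $\omega^*(\theta)=A_\theta^{-1}b_\theta$, and let $R_\omega$ be such that $\|\omega^*(\theta)\|\le R_\omega$ for all $\theta$; $\Pi$ denotes projection onto the closed ball of radius $R_\omega$ about $0$. **Algorithm.** Fix an integer $T_{\max}\ge2$ and $0<\nu<\sigma<1$. Start from deterministic $\theta_1$, $\eta_1$ and $\omega_1$ with $\|\omega_1\|\le R_\omega$. In round $t=1,2,\dots$, given the past and an initial state $s_t^1$ (which may depend on the past in any way, e.g. the last state of the previous trajectory or a fresh draw from a fixed law), draw $J_t\sim\mathrm{Geom}(1/2)$ on $\{1,2,\dots\}$ independently of these,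 and a trajectory $a_t^i\sim\pi_{\theta_t}(\cdot\mid s_t^i)$, $s_t^{i+1}\sim p(\cdot\mid s_t^i,a_t^i)$, $1\le i\le 2^{J_t}$. With $\delta_t^i=r(s_t^i,a_t^i)-\eta_t+\langle\phi(s_t^{i+1})-\phi(s_t^i),\omega_t\rangle$, form from the samples $$f_t^i=\eta_t-r(s_t^i,a_t^i),\qquad g_t^i=\delta_t^i\,\phi(s_t^i),\qquad h_t^i=\delta_t^i\,\nabla\log\pi_{\theta_t}(a_t^i\mid s_t^i)$$ the estimates $f_t^{MLMC},g_t^{MLMC},h_t^{MLMC}$, where for samples $l^1,l^2,\dots$ and $\bar l^{\,j}=2^{-j}\sum_{i=1}^{2^j}l^i$ we let $l^{MLMC}=\bar l^{\,0}+2^{J_t}(\bar l^{\,J_t}-\bar l^{\,J_t-1})$ if $2^{J_t}\le T_{\max}$ and $l^{MLMC}=\bar l^{\,0}$ otherwise. Update $$\eta_{t+1}=\eta_t-\gamma_tf_t^{MLMC},\qquad \omega_{t+1}=\Pi\big(\omega_t+\beta_tg_t^{MLMC}\big),\qquad \theta_{t+1}=\theta_t+\alpha_th_t^{MLMC},$$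 with $\gamma_t=\beta_t=(1+t)^{-\nu}$, $\alpha_t=\alpha_t'\big/\sqrt{\sum_{k=1}^t\|h_k^{MLMC}\|^2}$ and $\alpha_t'=(1+t)^{-\sigma}$ (no actor step is made while the sum is $0$). **Theorem.** Let $\mathcal E(t)=\mathbb E[(\eta_t-J(\theta_t))^2]+\mathbb E[\|\omega_t-\omega^*(\theta_t)\|^2]$ and $\bar\tau_T=\mathbb E\big[\max_{1\le t\le T}\tau_{mix}^{\theta_t}\big]$. There is a constant $C$, depending only on $|\mathcal S|$, $m$, $r_{\max}$, $\lambda$, $B$, $K$, $L$, $R_\omega$, $\eta_1$, $\nu$, $\sigma$, such that for all $T\ge1$ these expectations are finite and $$\frac1T\sum_{t=1}^T\mathcal E(t)\le C\left(T^{\nu-1}+T^{-2(\sigma-\nu)}+\bar\tau_T\,\log T_{\max}\;T^{-\nu}+\bar\tau_T\,\frac{\log T_{\max}}{T_{\max}}\right).$$ In particular $C$ does not depend on $T$, $T_{\max}$ or the mixing times. -/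

import Mathlib

open MeasureTheory ProbabilityTheory
open scoped Matrix

namespace MAC

noncomputable section

/-- A finite Markov decision process with transition probabilities `p s a s'` (the probability of
moving to `s'` after action `a` in state `s`) and rewards in `[0, rmax]`. -/
structure MDP (S A : Type*) [Fintype S] (rmax : ℝ) where
  p : S → A → S → ℝ
  r : S → A → ℝ
  p_nonneg : ∀ s a s', 0 ≤ p s a s'
  p_sum : ∀ s a, ∑ s', p s a s' = 1
  r_nonneg : ∀ s a, 0 ≤ r s a
  r_le : ∀ s a, r s a ≤ rmax

/-- A class of policies `π θ s a = π_θ(a | s)` with parameter `θ ∈ ℝ^d`. The probabilities are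
positive, so that `log π_θ(a | s)` makes sense. -/
structure PolicyClass (S A : Type*) [Fintype A] (d : ℕ) where
  π : EuclideanSpace ℝ (Fin d) → S → A → ℝ
  π_pos : ∀ θ s a, 0 < π θ s a
  π_sum : ∀ θ s, ∑ a, π θ s a = 1

/-- The score function `∇_θ log π_θ(a | s)`. -/
def PolicyClass.score {S A : Type*} [Fintype A] {d : ℕ} (pol : PolicyClass S A d)
    (θ : EuclideanSpace ℝ (Fin d)) (s : S) (a : A) : EuclideanSpace ℝ (Fin d) :=
  gradient (fun θ' => Real.log (pol.π θ' s a)) θ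

/-- Regularity of the policy class: bounded and Lipschitz score, Lipschitz probabilities. -/
structure PolicyClass.Regular {S A : Type*} [Fintype A] {d : ℕ} (pol : PolicyClass S A d)
    (B K L : ℝ) : Prop where
  differentiable : ∀ s a, Differentiable ℝ (fun θ => Real.log (pol.π θ s a))
  score_bound : ∀ θ s a, ‖pol.score θ s a‖ ≤ B
  score_lipschitz : ∀ θ θ' s a, ‖pol.score θ s a - pol.score θ' s a‖ ≤ K * ‖θ - θ'‖
  prob_lipschitz : ∀ θ θ' s a, |pol.π θ s a - pol.π θ' s a| ≤ L * ‖θ - θ'‖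

/-! ### Finite Markov chains; a transition kernel is a matrix `P s s' = P(s' | s)` -/

section Chains

variable {S : Type*} [Fintype S]

/-- Total variation distance between two probability vectors. -/
def tv (μ ν : S → ℝ) : ℝ := (1 / 2) * ∑ s, |μ s - ν s|

/-- `d` is a stationary probability distribution of `P`. -/
structure IsStationary (P : Matrix S S ℝ) (d : S → ℝ) : Prop where
  nonneg : ∀ s, 0 ≤ d s
  sum_one : ∑ s, d s = 1
  invariant : ∀ s', ∑ s, d s * P s s' = d s'

open Classical in
/-- The stationary distribution of `P` (it is unique for the ergodic chains considered below). -/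
def stationary (P : Matrix S S ℝ) : S → ℝ :=
  if h : ∃ d, IsStationary P d then h.choose else 0

/-- Ergodicity coefficient `κ(P) = sup_{s, s'} ‖P(· | s) - P(· | s')‖_TV`. -/
def ergodicityCoeff (P : Matrix S S ℝ) : ℝ := ⨆ s, ⨆ s', tv (P s) (P s')

/-- The `ε`-mixing time: the least number `t ≥ 1` of steps after which the chain is `ε`-close to
its stationary distribution, whatever the initial state. -/
def mixingTimeEps [DecidableEq S] (P : Matrix S S ℝ) (ε : ℝ) : ℕ :=
  sInf {t : ℕ | 1 ≤ t ∧ ∀ s, tv ((P ^ t) s) (stationary P) ≤ ε}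

/-- The conventional mixing time. -/
def mixingTime [DecidableEq S] (P : Matrix S S ℝ) : ℕ := mixingTimeEps P (1 / 4)

end Chains

section Targets

variable {S A : Type*} [Fintype S] [Fintype A] {rmax : ℝ} {d m : ℕ}

/-- The state transition kernel `P_θ(s' | s) = ∑_a π_θ(a | s) p(s' | s, a)`. -/
def kernel (M : MDP S A rmax) (pol : PolicyClass S A d) (θ : EuclideanSpace ℝ (Fin d)) :
    Matrix S S ℝ :=
  Matrix.of fun s s' => ∑ a, pol.π θ s a * M.p s a s'

/-- The average reward `J(θ) = E_{s ∼ d_θ, a ∼ π_θ(· | s)} [r(s, a)]`. -/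
def avgReward (M : MDP S A rmax) (pol : PolicyClass S A d) (θ : EuclideanSpace ℝ (Fin d)) : ℝ :=
  ∑ s, ∑ a, stationary (kernel M pol θ) s * pol.π θ s a * M.r s a

/-- `A_θ = E_{s ∼ d_θ, a ∼ π_θ, s' ∼ p(· | s, a)} [φ(s) (φ(s) - φ(s'))ᵀ]`. -/
def tdMatrix (M : MDP S A rmax) (pol : PolicyClass S A d) (φ : S → EuclideanSpace ℝ (Fin m))
    (θ : EuclideanSpace ℝ (Fin d)) : Matrix (Fin m) (Fin m) ℝ :=
  Matrix.of fun i j => ∑ s, ∑ a, ∑ s',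
    stationary (kernel M pol θ) s * pol.π θ s a * M.p s a s' * (φ s i * (φ s j - φ s' j))

/-- `b_θ = E_{s ∼ d_θ, a ∼ π_θ} [(r(s, a) - J(θ)) φ(s)]`. -/
def tdVector (M : MDP S A rmax) (pol : PolicyClass S A d) (φ : S → EuclideanSpace ℝ (Fin m))
    (θ : EuclideanSpace ℝ (Fin d)) : EuclideanSpace ℝ (Fin m) :=
  ∑ s, ∑ a, (stationary (kernel M pol θ) s * pol.π θ s a * (M.r s a - avgReward M pol θ)) • φ s

/-- The TD(0) fixed point `ω*(θ) = A_θ⁻¹ b_θ`. -/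
def criticTarget (M : MDP S A rmax) (pol : PolicyClass S A d)
    (φ : S → EuclideanSpace ℝ (Fin m)) (θ : EuclideanSpace ℝ (Fin d)) :
    EuclideanSpace ℝ (Fin m) :=
  WithLp.toLp 2 ((tdMatrix M pol φ θ)⁻¹ *ᵥ (fun i => tdVector M pol φ θ i))

/-- Every `A_θ` is positive definite (it need not be symmetric) and all its complex eigenvalues
have modulus at least `lam`. -/
def CriticPosDef (M : MDP S A rmax) (pol : PolicyClass S A d)
    (φ : S → EuclideanSpace ℝ (Fin m)) (lam : ℝ) : Prop :=
  ∀ θ, (∀ x : Fin m → ℝ, x ≠ 0 → 0 < x ⬝ᵥ (tdMatrix M pol φ θ *ᵥ x)) ∧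
    ∀ z ∈ spectrum ℂ ((tdMatrix M pol φ θ).map (fun x : ℝ => (x : ℂ))), lam ≤ ‖z‖

/-- For every `θ` some power of `P_θ` has ergodicity coefficient less than one. -/
def Ergodic [DecidableEq S] (M : MDP S A rmax) (pol : PolicyClass S A d) : Prop :=
  ∀ θ, ∃ k : ℕ, ergodicityCoeff (kernel M pol θ ^ k) < 1

end Targets

/-! ### The multi-level Monte Carlo actor-critic algorithm -/

section Algorithm

/-- The average `l^j` of the first `2 ^ j` samples. -/
def levelAvg {E : Type*} [AddCommGroup E] [Module ℝ E] (l : ℕ → E) (j : ℕ) : E :=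
  ((2 : ℝ) ^ j)⁻¹ • ∑ i ∈ Finset.range (2 ^ j), l i

/-- The multi-level Monte Carlo estimate `l^0 + 2^j (l^j - l^{j-1})` (only `l^0` if
`2^j > Tmax`) at level `j ≥ 1`. -/
def mlmc {E : Type*} [AddCommGroup E] [Module ℝ E] (Tmax j : ℕ) (l : ℕ → E) : E :=
  levelAvg l 0 +
    if 2 ^ j ≤ Tmax then ((2 : ℝ) ^ j) • (levelAvg l j - levelAvg l (j - 1)) else 0

/-- Euclidean projection onto the closed ball of radius `R` about the origin. -/
def projBall {m : ℕ} (R : ℝ) (x : EuclideanSpace ℝ (Fin m)) : EuclideanSpace ℝ (Fin m) :=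
  if ‖x‖ ≤ R then x else (R / ‖x‖) • x

/-- The random quantities of the algorithm. Rounds are numbered `t = 1, 2, …`; in round `t` the
level is `lev t`, and the trajectory consists of the states `st t 0, st t 1, …, st t (2 ^ lev t)`
and the actions `act t 0, …, act t (2 ^ lev t - 1)`. Values at round `0`, and samples beyond the
end of the trajectory, are never used. -/
structure Iterates (Ω S A : Type*) (d m : ℕ) where
  lev : ℕ → Ω → ℕ
  st : ℕ → ℕ → Ω → S
  act : ℕ → ℕ → Ω → A
  θ : ℕ → Ω → EuclideanSpace ℝ (Fin d)
  η : ℕ → Ω → ℝ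
  ω : ℕ → Ω → EuclideanSpace ℝ (Fin m)

namespace Iterates

variable {Ω S A : Type*} [Fintype S] [Fintype A] {rmax : ℝ} {d m : ℕ}

/-- The temporal difference of the `i`-th sample of round `t`. -/
def td (X : Iterates Ω S A d m) (M : MDP S A rmax) (φ : S → EuclideanSpace ℝ (Fin m))
    (t i : ℕ) (w : Ω) : ℝ :=
  M.r (X.st t i w) (X.act t i w) - X.η t w +
    inner ℝ (φ (X.st t (i + 1) w) - φ (X.st t i w)) (X.ω t w)

/-- Reward tracking estimate `f_t^MLMC`, from the samples `η_t - r`. -/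
def fMLMC (X : Iterates Ω S A d m) (M : MDP S A rmax) (Tmax t : ℕ) (w : Ω) : ℝ :=
  mlmc Tmax (X.lev t w) fun i => X.η t w - M.r (X.st t i w) (X.act t i w)

/-- Critic estimate `g_t^MLMC`, from the samples `δ φ(s)`. -/
def gMLMC (X : Iterates Ω S A d m) (M : MDP S A rmax) (φ : S → EuclideanSpace ℝ (Fin m))
    (Tmax t : ℕ) (w : Ω) : EuclideanSpace ℝ (Fin m) :=
  mlmc Tmax (X.lev t w) fun i => X.td M φ t i w • φ (X.st t i w)

/-- Actor estimate `h_t^MLMC`, from the samples `δ ∇ log π_θ(a | s)`. -/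
def hMLMC (X : Iterates Ω S A d m) (M : MDP S A rmax) (pol : PolicyClass S A d)
    (φ : S → EuclideanSpace ℝ (Fin m)) (Tmax t : ℕ) (w : Ω) : EuclideanSpace ℝ (Fin d) :=
  mlmc Tmax (X.lev t w) fun i =>
    X.td M φ t i w • pol.score (X.θ t w) (X.st t i w) (X.act t i w)

/-- The step size `c_t / √(∑_{k=1}^t ‖h_k‖²)` of the actor with `c_t = (1 + t)^{-σ}`. (If the sum
vanishes then `h_t = 0`, and the value is irrelevant.) -/
def actorStep (X : Iterates Ω S A d m) (M : MDP S A rmax) (pol : PolicyClass S A d)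
    (φ : S → EuclideanSpace ℝ (Fin m)) (Tmax : ℕ) (σ : ℝ) (t : ℕ) (w : Ω) : ℝ :=
  (1 + (t : ℝ)) ^ (-σ) / √(∑ k ∈ Finset.Icc 1 t, ‖X.hMLMC M pol φ Tmax k w‖ ^ 2)

/-- `X` is a run of the algorithm with rollout length `Tmax`, projection radius `Rω`, step sizes
`γ_t = β_t = (1 + t)^{-ν}` and `α_t = actorStep`, and initial reward estimate `η₁`. The
σ-algebra `ℱ t` is the information available at the start of round `t`, including the initial
state of its trajectory. That initial state may depend on the past in any way: it may be the last
state of the previous trajectory, or a fresh draw from a fixed distribution. Given `ℱ t`, the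
level is geometric with parameter `1 / 2` on `{1, 2, …}`, and the `2 ^ j` steps of the trajectory
at level `j` follow the policy `π_{θ_t}` and the transition law of the MDP. -/
structure IsRun [mΩ : MeasurableSpace Ω] (X : Iterates Ω S A d m) (μ : Measure Ω)
    (ℱ : Filtration ℕ mΩ)
    (M : MDP S A rmax) (pol : PolicyClass S A d) (φ : S → EuclideanSpace ℝ (Fin m))
    (Tmax : ℕ) (Rω ν σ η₁ : ℝ) : Prop where
  θ_init : ∃ θ₁, ∀ w, X.θ 1 w = θ₁
  η_init : ∀ w, X.η 1 w = η₁
  ω_init : ∃ ω₁, ‖ω₁‖ ≤ Rω ∧ ∀ w, X.ω 1 w = ω₁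
  θ_meas : ∀ t, 1 ≤ t → Measurable[ℱ t] (X.θ t)
  η_meas : ∀ t, 1 ≤ t → Measurable[ℱ t] (X.η t)
  ω_meas : ∀ t, 1 ≤ t → Measurable[ℱ t] (X.ω t)
  start_meas : ∀ t, 1 ≤ t → ∀ s, MeasurableSet[ℱ t] {w | X.st t 0 w = s}
  lev_meas : ∀ t, 1 ≤ t → ∀ j, MeasurableSet[ℱ (t + 1)] {w | X.lev t w = j}
  st_meas : ∀ t, 1 ≤ t → ∀ i s, MeasurableSet[ℱ (t + 1)] {w | X.st t i w = s}
  act_meas : ∀ t, 1 ≤ t → ∀ i a, MeasurableSet[ℱ (t + 1)] {w | X.act t i w = a}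
  sample : ∀ t, 1 ≤ t → ∀ j, 1 ≤ j → ∀ (x : ℕ → S) (a : ℕ → A),
    μ⟦{w | X.lev t w = j ∧ (∀ i ≤ 2 ^ j, X.st t i w = x i) ∧
        (∀ i < 2 ^ j, X.act t i w = a i)} | ℱ t⟧
      =ᵐ[μ] {w | X.st t 0 w = x 0}.indicator fun w =>
        (1 / 2 : ℝ) ^ j *
          ∏ i ∈ Finset.range (2 ^ j), (pol.π (X.θ t w) (x i) (a i) * M.p (x i) (a i) (x (i + 1)))
  η_step : ∀ t, 1 ≤ t → ∀ w,
    X.η (t + 1) w = X.η t w - (1 + (t : ℝ)) ^ (-ν) * X.fMLMC M Tmax t w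
  ω_step : ∀ t, 1 ≤ t → ∀ w,
    X.ω (t + 1) w = projBall Rω (X.ω t w + (1 + (t : ℝ)) ^ (-ν) • X.gMLMC M φ Tmax t w)
  θ_step : ∀ t, 1 ≤ t → ∀ w,
    X.θ (t + 1) w = X.θ t w + X.actorStep M pol φ Tmax σ t w • X.hMLMC M pol φ Tmax t w

/-- The squared average-reward error `(η_t - J(θ_t))²`. -/
def rewardErr (X : Iterates Ω S A d m) (M : MDP S A rmax) (pol : PolicyClass S A d)
    (t : ℕ) (w : Ω) : ℝ :=
  (X.η t w - avgReward M pol (X.θ t w)) ^ 2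

/-- The squared critic error `‖ω_t - ω*(θ_t)‖²`. -/
def criticErr (X : Iterates Ω S A d m) (M : MDP S A rmax) (pol : PolicyClass S A d)
    (φ : S → EuclideanSpace ℝ (Fin m)) (t : ℕ) (w : Ω) : ℝ :=
  ‖X.ω t w - criticTarget M pol φ (X.θ t w)‖ ^ 2

/-- The tracking error `ℰ(t) = E[(η_t - J(θ_t))²] + E[‖ω_t - ω*(θ_t)‖²]`. -/
def trackingErr [MeasurableSpace Ω] (X : Iterates Ω S A d m) (μ : Measure Ω) (M : MDP S A rmax)
    (pol : PolicyClass S A d) (φ : S → EuclideanSpace ℝ (Fin m)) (t : ℕ) : ℝ :=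
  (∫ w, X.rewardErr M pol t w ∂μ) + (∫ w, X.criticErr M pol φ t w ∂μ)

/-- The largest mixing time `max_{1 ≤ t ≤ T} τ_mix^{θ_t}` met in the first `T` rounds. -/
def maxMixing [DecidableEq S] (X : Iterates Ω S A d m) (M : MDP S A rmax)
    (pol : PolicyClass S A d) (T : ℕ) (w : Ω) : ℕ :=
  (Finset.Icc 1 T).sup fun t => mixingTime (kernel M pol (X.θ t w))

end Iterates

end Algorithm

end

end MAC

/-! Each squared error contracts at a rate proportional to the step size `β_t = (1+t)^{-ν}`, against
three injections per round: squared bias of the estimates, their second moment times `β_t²`, and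
squared drift of the target divided by `β_t`. Multiplying by `a_t = β_t⁻¹` and summing by parts
gives the bound. The difficulty is to keep every constant free of the mixing times, which are random
and unbounded, and to separate them from errors with which they are correlated.

Drift. The normalised actor step moves `θ` by at most `(1+t)^{-σ}`, whatever the size of the actor
estimate (`norm_θ_sub_le`). Perturbation bounds for stationary laws usually involve the mixing time;
here a multiplicative comparison is used instead. A bounded score makes nearby policies, hence
nearby kernels, comparable entrywise up to a factor `c = exp (B * ‖θ' - θ‖)`. Stationary
probabilities are proportional to principal minors of `1 - P`, which are monotone in the transition
weights, so stationary laws are comparable up to `c^(2n)` with `n` states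
(`IsStationary.le_mul_of_le_mul`). The average reward and the critic target inherit Lipschitz
constants independent of mixing.

Contraction of the critic. For a non-symmetric matrix a lower bound on eigenvalues alone gives no
coercivity. By stationarity `⟨A x, x⟩` is half a Dirichlet form, which dominates `‖A x‖² / 2`
(`norm_tdMap_sq_le`); the eigenvalues bound the determinant from below, and Cramer's rule then
bounds `‖x‖` by a multiple of `‖A x‖`. Together they give `coercConst_mul_le_inner`.

Estimates. The probability `2^{-j}` of level `j` cancels the factor `2^j`, so the mean of a
multi-level estimate telescopes to the mean of an average over about `Tmax` samples
(`roundMean_mlmc`), while the second moment is only of order mixing time times `log Tmax`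
(`roundMean_norm_mlmc_sq_le`). Both rest on the fact that the total deviation of a chain from
stationarity is at most twice its mixing time (`sum_norm_transOp_pow_le`).

Summation. The noise of the reward tracker does not depend on its own error, so that recursion
closes in expectation. The noise of the critic does grow with the reward error and yields a term
(mixing time) × (reward error), whose expectation does not split. The critic recursion is therefore
multiplied by the random weight `a²/(a+Q)`, with `Q` the running maximum of the mixing times times
`log₂ Tmax`. The weight damps this product where `Q` is large; the lost contraction is paid for by
the boundedness of the projected critic (`criticWeight_mul_le`), and since `Q` is nondecreasing the
weight grows no faster than `a`, so summation by parts still works (`criticWeight_sub_le`,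
`sum_mul_sub_le`). -/

set_option linter.unusedSectionVars false

namespace MAC

/-! ### Finite Markov chains: stationary laws, Dobrushin contraction, cumulative deviation from
stationarity. -/

section ChainLemmas

variable {S : Type*} [Fintype S]

lemma tv_nonneg (μ ν : S → ℝ) : 0 ≤ tv μ ν := by
  unfold tv; positivity

lemma sum_abs_sub_eq_two_mul_tv (μ ν : S → ℝ) : ∑ s, |μ s - ν s| = 2 * tv μ ν := by
  unfold tv; ring

variable [DecidableEq S]

/-- A row-stochastic matrix on a nonempty finite type has a stationary distribution. -/
lemma exists_isStationary [Nonempty S] {P : Matrix S S ℝ} (hP : P ∈ Matrix.rowStochastic ℝ S) :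
    ∃ d, IsStationary P d := by
  rw [Matrix.mem_rowStochastic_iff_sum] at hP
  obtain ⟨h0, h1⟩ := hP
  -- Constant vectors lie in the right kernel of `1 - P`, so there is a nonzero left null vector, of
  -- unknown sign.
  have hdet : (1 - P).det = 0 := by
    rw [← Matrix.exists_mulVec_eq_zero_iff]
    refine ⟨1, one_ne_zero, ?_⟩
    ext i
    rw [Matrix.sub_mulVec, Matrix.one_mulVec]
    simp [Matrix.mulVec, dotProduct, h1]
  obtain ⟨v, hv, hv0⟩ := Matrix.exists_vecMul_eq_zero_iff.2 hdet
  have hinv : ∀ s', ∑ s, v s * P s s' = v s' := by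
    intro s'
    have := congrFun hv0 s'
    simp only [Matrix.vecMul_sub, Matrix.vecMul_one, Pi.sub_apply, Pi.zero_apply] at this
    simp only [Matrix.vecMul, dotProduct] at this
    linarith
  have hle : ∀ s', |v s'| ≤ ∑ s, |v s| * P s s' := by
    intro s'
    rw [← hinv s']
    refine (Finset.abs_sum_le_sum_abs _ _).trans (le_of_eq ?_)
    exact Finset.sum_congr rfl fun s _ => by rw [abs_mul, abs_of_nonneg (h0 s s')]
  have htot : ∑ s', ∑ s, |v s| * P s s' = ∑ s', |v s'| := by
    rw [Finset.sum_comm]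
    exact Finset.sum_congr rfl fun s _ => by rw [← Finset.mul_sum, h1, mul_one]
  -- `|v|` is dominated by its image under `P`, and both have the same total mass, so `|v|` is
  -- itself invariant and can be normalised.
  have heq := (Finset.sum_eq_sum_iff_of_le (fun s' _ => hle s')).1 htot.symm
  have hpos : 0 < ∑ s, |v s| := by
    obtain ⟨s, hs⟩ := Function.ne_iff.1 hv
    exact Finset.sum_pos' (fun _ _ => abs_nonneg _) ⟨s, Finset.mem_univ s, abs_pos.2 hs⟩
  refine ⟨fun s => |v s| / ∑ s, |v s|, fun s => by positivity, ?_, fun s' => ?_⟩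
  · rw [← Finset.sum_div, div_self hpos.ne']
  · rw [heq s' (Finset.mem_univ s'), Finset.sum_div]
    exact Finset.sum_congr rfl fun s _ => by ring

lemma isStationary_stationary [Nonempty S] {P : Matrix S S ℝ}
    (hP : P ∈ Matrix.rowStochastic ℝ S) : IsStationary P (stationary P) := by
  have h := exists_isStationary hP
  rw [stationary, dif_pos h]
  exact h.choose_spec

lemma IsStationary.pow {P : Matrix S S ℝ} {d : S → ℝ} (h : IsStationary P d) (k : ℕ) :
    IsStationary (P ^ k) d := by
  have hP : d ᵥ* P = d := funext fun s' => h.invariant s'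
  have hk : ∀ k, d ᵥ* P ^ k = d := by
    intro k
    induction k with
    | zero => simp
    | succ k ih => rw [pow_succ, ← Matrix.vecMul_vecMul, ih, hP]
  exact ⟨h.nonneg, h.sum_one, fun s' => congrFun (hk k) s'⟩

lemma tv_le_ergodicityCoeff (Q : Matrix S S ℝ) (s t : S) : tv (Q s) (Q t) ≤ ergodicityCoeff Q :=
  (le_ciSup (Finite.bddAbove_range fun t => tv (Q s) (Q t)) t).trans
    (le_ciSup (Finite.bddAbove_range fun s => ⨆ t, tv (Q s) (Q t)) s)

/-- Dobrushin's contraction: on signed measures of total mass zero. -/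
lemma sum_abs_vecMul_le (Q : Matrix S S ℝ) (v : S → ℝ) (hv : ∑ s, v s = 0) :
    ∑ s', |(v ᵥ* Q) s'| ≤ ergodicityCoeff Q * ∑ s, |v s| := by
  set c := ∑ s, (v s)⁺ with hc
  have hpn : ∀ s, v s = (v s)⁺ - (v s)⁻ := fun s => (posPart_sub_negPart (v s)).symm
  have hc' : ∑ s, (v s)⁻ = c := by
    have : ∑ s, ((v s)⁺ - (v s)⁻) = 0 := by rw [← hv]; exact Finset.sum_congr rfl fun s _ => (hpn s).symm
    rw [Finset.sum_sub_distrib] at this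
    linarith
  have habs : ∑ s, |v s| = 2 * c := by
    have : ∑ s, |v s| = ∑ s, ((v s)⁺ + (v s)⁻) :=
      Finset.sum_congr rfl fun s _ => (posPart_add_negPart (v s)).symm
    rw [this, Finset.sum_add_distrib, hc']; ring
  have hp : ∀ s, 0 ≤ (v s)⁺ := fun s => posPart_nonneg _
  have hn : ∀ s, 0 ≤ (v s)⁻ := fun s => negPart_nonneg _
  have hc0 : 0 ≤ c := Finset.sum_nonneg fun s _ => hp s
  rcases hc0.eq_or_lt with h0 | h0
  · have hz : ∀ s, v s = 0 := by
      have : ∑ s, |v s| = 0 := by rw [habs, ← h0]; ring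
      intro s
      have := (Finset.sum_eq_zero_iff_of_nonneg (fun s _ => abs_nonneg (v s))).1 this s
        (Finset.mem_univ s)
      simpa using this
    simp [funext hz, Matrix.vecMul, dotProduct]
  -- The positive and negative parts have the same mass `c`. Coupling them by their product writes
  -- `c` times the image of `v` as a combination of differences of rows of `Q`, each controlled by
  -- the ergodicity coefficient.
  have key : ∀ s', c * (v ᵥ* Q) s' = ∑ s, ∑ t, (v s)⁺ * (v t)⁻ * (Q s s' - Q t s') := by
    intro s'
    have h1 : ∑ s, ∑ t, (v s)⁺ * (v t)⁻ * (Q s s' - Q t s')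
        = (∑ s, (v s)⁺ * Q s s') * (∑ t, (v t)⁻) - (∑ s, (v s)⁺) * (∑ t, (v t)⁻ * Q t s') := by
      rw [Finset.sum_mul_sum, Finset.sum_mul_sum, ← Finset.sum_sub_distrib]
      refine Finset.sum_congr rfl fun s _ => ?_
      rw [← Finset.sum_sub_distrib]
      exact Finset.sum_congr rfl fun t _ => by ring
    rw [h1, hc', ← hc, mul_comm _ c, ← mul_sub, ← Finset.sum_sub_distrib]
    congr 1
    simp only [Matrix.vecMul, dotProduct]
    refine Finset.sum_congr rfl fun s _ => ?_
    rw [← sub_mul, ← hpn]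
  have h2 : c * ∑ s', |(v ᵥ* Q) s'| ≤ c * (ergodicityCoeff Q * ∑ s, |v s|) := by
    calc c * ∑ s', |(v ᵥ* Q) s'| = ∑ s', |c * (v ᵥ* Q) s'| := by
          rw [Finset.mul_sum]
          exact Finset.sum_congr rfl fun s' _ => by rw [abs_mul, abs_of_pos h0]
      _ ≤ ∑ s', ∑ s, ∑ t, (v s)⁺ * (v t)⁻ * |Q s s' - Q t s'| := by
          refine Finset.sum_le_sum fun s' _ => ?_
          rw [key]
          refine (Finset.abs_sum_le_sum_abs _ _).trans (Finset.sum_le_sum fun s _ => ?_)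
          refine (Finset.abs_sum_le_sum_abs _ _).trans (Finset.sum_le_sum fun t _ => ?_)
          rw [abs_mul, abs_of_nonneg (mul_nonneg (hp s) (hn t))]
      _ = ∑ s, ∑ t, (v s)⁺ * (v t)⁻ * (2 * tv (Q s) (Q t)) := by
          rw [Finset.sum_comm]
          refine Finset.sum_congr rfl fun s _ => ?_
          rw [Finset.sum_comm]
          refine Finset.sum_congr rfl fun t _ => ?_
          rw [← Finset.mul_sum, sum_abs_sub_eq_two_mul_tv]
      _ ≤ ∑ s, ∑ t, (v s)⁺ * (v t)⁻ * (2 * ergodicityCoeff Q) := by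
          refine Finset.sum_le_sum fun s _ => Finset.sum_le_sum fun t _ => ?_
          have := tv_le_ergodicityCoeff Q s t
          have := mul_nonneg (hp s) (hn t)
          gcongr
      _ = c * (ergodicityCoeff Q * ∑ s, |v s|) := by
          simp_rw [← Finset.sum_mul, ← Finset.mul_sum]
          rw [← Finset.sum_mul, hc', habs, ← hc]; ring
  exact le_of_mul_le_mul_left h2 h0

lemma sum_vecMul_eq {Q : Matrix S S ℝ} (hQ : Q ∈ Matrix.rowStochastic ℝ S) (v : S → ℝ) :
    ∑ s', (v ᵥ* Q) s' = ∑ s, v s := by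
  simp only [Matrix.vecMul, dotProduct]
  rw [Finset.sum_comm]
  refine Finset.sum_congr rfl fun s _ => ?_
  rw [← Finset.mul_sum, Matrix.sum_row_of_mem_rowStochastic hQ, mul_one]

lemma ergodicityCoeff_nonneg (Q : Matrix S S ℝ) : 0 ≤ ergodicityCoeff Q :=
  Real.iSup_nonneg fun _ => Real.iSup_nonneg fun _ => tv_nonneg _ _

lemma sum_abs_vecMul_pow_le {Q : Matrix S S ℝ} (hQ : Q ∈ Matrix.rowStochastic ℝ S) (v : S → ℝ)
    (hv : ∑ s, v s = 0) (j : ℕ) :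
    ∑ s', |(v ᵥ* Q ^ j) s'| ≤ ergodicityCoeff Q ^ j * ∑ s, |v s| := by
  induction j with
  | zero => simp
  | succ j ih =>
    rw [pow_succ, ← Matrix.vecMul_vecMul]
    refine (sum_abs_vecMul_le Q _ ?_).trans ?_
    · rw [sum_vecMul_eq (pow_mem hQ j), hv]
    · calc ergodicityCoeff Q * ∑ s', |(v ᵥ* Q ^ j) s'|
          ≤ ergodicityCoeff Q * (ergodicityCoeff Q ^ j * ∑ s, |v s|) :=
            mul_le_mul_of_nonneg_left ih (ergodicityCoeff_nonneg Q)
        _ = ergodicityCoeff Q ^ (j + 1) * ∑ s, |v s| := by ring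

/-- An ergodic kernel has no invariant signed measure of total mass zero. -/
lemma eq_zero_of_vecMul_eq {P : Matrix S S ℝ} {k : ℕ} (hk : ergodicityCoeff (P ^ k) < 1)
    {v : S → ℝ} (hv : ∑ s, v s = 0) (hinv : v ᵥ* P = v) : v = 0 := by
  have hpow : ∀ k, v ᵥ* P ^ k = v := by
    intro k
    induction k with
    | zero => simp
    | succ k ih => rw [pow_succ, ← Matrix.vecMul_vecMul, ih, hinv]
  have h := sum_abs_vecMul_le (P ^ k) v hv
  rw [hpow k] at h
  have h0 : 0 ≤ ∑ s, |v s| := Finset.sum_nonneg fun _ _ => abs_nonneg _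
  have hz : ∑ s, |v s| = 0 := by nlinarith
  ext s
  have := (Finset.sum_eq_zero_iff_of_nonneg (fun s _ => abs_nonneg (v s))).1 hz s
    (Finset.mem_univ s)
  simpa using this

lemma IsStationary.eq_smul_of_vecMul_eq {P : Matrix S S ℝ} {k : ℕ}
    (hk : ergodicityCoeff (P ^ k) < 1) {d : S → ℝ} (hd : IsStationary P d) {v : S → ℝ}
    (hinv : v ᵥ* P = v) : v = (∑ s, v s) • d := by
  have hdP : d ᵥ* P = d := funext fun s' => hd.invariant s'
  have := eq_zero_of_vecMul_eq hk (v := v - (∑ s, v s) • d) (by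
    simp [Finset.sum_sub_distrib, ← Finset.mul_sum, hd.sum_one]) (by
    rw [Matrix.sub_vecMul, Matrix.smul_vecMul, hinv, hdP])
  exact sub_eq_zero.1 this

/-- Contraction applied to the point mass at `s` minus `d`; its `ℓ¹` norm is at most 2, which
cancels the `1/2` in `tv`. -/
lemma IsStationary.tendsto_tv {P : Matrix S S ℝ} (hP : P ∈ Matrix.rowStochastic ℝ S) {k : ℕ}
    {d : S → ℝ} (hd : IsStationary P d) (s : S) (j : ℕ) :
    tv ((P ^ (k * j)) s) d ≤ ergodicityCoeff (P ^ k) ^ j := by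
  have hdP : d ᵥ* (P ^ k) ^ j = d := by
    rw [← pow_mul]; exact funext fun s' => (hd.pow (k * j)).invariant s'
  have h := sum_abs_vecMul_pow_le (pow_mem hP k) (Pi.single s 1 - d)
    (by simp [Finset.sum_sub_distrib, hd.sum_one]) j
  rw [Matrix.sub_vecMul, hdP, Matrix.single_one_vecMul, ← pow_mul] at h
  have h2 : ∑ t, |(Pi.single s (1 : ℝ) - d : S → ℝ) t| ≤ 2 := by
    calc ∑ t, |(Pi.single s (1 : ℝ) - d : S → ℝ) t|
        ≤ ∑ t, ((Pi.single s (1 : ℝ) : S → ℝ) t + d t) := by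
          refine Finset.sum_le_sum fun t _ => ?_
          refine (abs_sub _ _).trans (le_of_eq ?_)
          rw [abs_of_nonneg (hd.nonneg t), abs_of_nonneg]
          by_cases hst : t = s
          · subst hst; simp
          · simp [hst]
      _ = 2 := by rw [Finset.sum_add_distrib, hd.sum_one]; simp; norm_num
  have h3 : ∑ t, |(P ^ (k * j)) s t - d t| ≤ ergodicityCoeff (P ^ k) ^ j * 2 :=
    h.trans (mul_le_mul_of_nonneg_left h2 (pow_nonneg (ergodicityCoeff_nonneg _) _))
  rw [sum_abs_sub_eq_two_mul_tv] at h3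
  linarith

/-- The mixing time of an ergodic kernel is attained. -/
lemma mixingTime_spec [Nonempty S] {P : Matrix S S ℝ} (hP : P ∈ Matrix.rowStochastic ℝ S) {k : ℕ}
    (hk : ergodicityCoeff (P ^ k) < 1) :
    1 ≤ mixingTime P ∧ ∀ s, tv ((P ^ mixingTime P) s) (stationary P) ≤ 1 / 4 := by
  have hd := isStationary_stationary hP
  refine Nat.sInf_mem (s := {t : ℕ | 1 ≤ t ∧ ∀ s, tv ((P ^ t) s) (stationary P) ≤ 1 / 4}) ?_
  obtain ⟨j, hj⟩ := exists_pow_lt_of_lt_one (show (0 : ℝ) < 1 / 4 by norm_num) hk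
  have hlim : ∀ s, tv ((P ^ (k * (j + 1))) s) (stationary P) ≤ 1 / 4 := fun s =>
    (hd.tendsto_tv hP s (j + 1)).trans <|
      (pow_le_pow_of_le_one (ergodicityCoeff_nonneg _) hk.le (Nat.le_succ j)).trans hj.le
  -- The mixing time ranges over `t ≥ 1`, whereas ergodicity allows the power `k = 0`. In that case
  -- the identity matrix has coefficient below one, which forces a single state, and `t = 1` serves.
  rcases Nat.eq_zero_or_pos (k * (j + 1)) with h0 | h0
  · refine ⟨1, le_rfl, fun s => ?_⟩
    have hk0 : k = 0 := by
      rcases Nat.mul_eq_zero.1 h0 with h | h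
      · exact h
      · omega
    subst hk0
    have hsub : ∀ s t : S, s = t := by
      intro s t
      by_contra hst
      have h1 := tv_le_ergodicityCoeff (P ^ 0) s t
      have h2 : tv ((P ^ 0) s) ((P ^ 0) t) = 1 := by
        have h3 : ∑ u, |(1 : Matrix S S ℝ) s u - (1 : Matrix S S ℝ) t u| = 2 := by
          rw [← Finset.sum_subset (Finset.subset_univ {s, t})]
          · rw [Finset.sum_pair hst]
            simp [hst, Ne.symm hst]; norm_num
          · intro u _ hu
            simp only [Finset.mem_insert, Finset.mem_singleton, not_or] at hu
            simp [Ne.symm hu.1, Ne.symm hu.2]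
        rw [sum_abs_sub_eq_two_mul_tv] at h3
        rw [pow_zero]; linarith
      linarith
    have hu : (Finset.univ : Finset S) = {s} := by
      ext t; simp [hsub t s]
    have h1 := Matrix.sum_row_of_mem_rowStochastic (pow_mem hP 1) s
    have h2 := hd.sum_one
    rw [hu, Finset.sum_singleton] at h1 h2
    simp only [tv]
    rw [hu, Finset.sum_singleton, h1, h2]
    norm_num
  · exact ⟨_, h0, hlim⟩

/-- Right-invariant functions of an ergodic kernel are constant. -/
lemma eq_const_of_mulVec_eq {P : Matrix S S ℝ} (hP : P ∈ Matrix.rowStochastic ℝ S) {k : ℕ}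
    (hk : ergodicityCoeff (P ^ k) < 1) {x : S → ℝ} (hx : P *ᵥ x = x) (s t : S) : x s = x t := by
  have hpow : ∀ k, P ^ k *ᵥ x = x := by
    intro k
    induction k with
    | zero => simp
    | succ k ih => rw [pow_succ, ← Matrix.mulVec_mulVec, hx, ih]
  have hbound : ∀ j : ℕ, |x s - x t| ≤ ergodicityCoeff (P ^ k) ^ j * (2 * ∑ u, |x u|) := by
    intro j
    have h := sum_abs_vecMul_pow_le (pow_mem hP k) (Pi.single s 1 - Pi.single t 1)
      (by simp [Finset.sum_sub_distrib]) j
    rw [← pow_mul] at h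
    have h2 : ∑ u, |(Pi.single s (1 : ℝ) - Pi.single t 1 : S → ℝ) u| ≤ 2 := by
      calc _ ≤ ∑ u, (|(Pi.single s (1 : ℝ) : S → ℝ) u| + |(Pi.single t (1 : ℝ) : S → ℝ) u|) :=
            Finset.sum_le_sum fun u _ => abs_sub _ _
        _ = 2 := by
          rw [Finset.sum_add_distrib]
          have : ∀ s : S, ∑ u, |(Pi.single s (1 : ℝ) : S → ℝ) u| = 1 := by
            intro s
            rw [Finset.sum_eq_single s] <;> simp +contextual
          rw [this, this]; norm_num
    -- Invariance moves the powers of `P` from `x` onto the difference of two point masses, which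
    -- has mass zero and is contracted.
    have hrep : x s - x t = ∑ u, ((Pi.single s (1 : ℝ) - Pi.single t 1 : S → ℝ) ᵥ* P ^ (k * j)) u * x u := by
      change _ = _ ⬝ᵥ x
      rw [← Matrix.dotProduct_mulVec, hpow, sub_dotProduct]
      simp
    rw [hrep]
    set v := ((Pi.single s (1 : ℝ) - Pi.single t 1 : S → ℝ) ᵥ* P ^ (k * j))
    calc |∑ u, v u * x u| ≤ ∑ u, |v u| * |x u| :=
          (Finset.abs_sum_le_sum_abs _ _).trans
            (le_of_eq (Finset.sum_congr rfl fun u _ => abs_mul _ _))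
      _ ≤ ∑ u, |v u| * ∑ u, |x u| := by
          refine Finset.sum_le_sum fun u _ => mul_le_mul_of_nonneg_left ?_ (abs_nonneg _)
          exact Finset.single_le_sum (f := fun u => |x u|) (fun _ _ => abs_nonneg _)
            (Finset.mem_univ u)
      _ = (∑ u, |v u|) * ∑ u, |x u| := by rw [Finset.sum_mul]
      _ ≤ (ergodicityCoeff (P ^ k) ^ j * 2) * ∑ u, |x u| := by
          refine mul_le_mul_of_nonneg_right (h.trans ?_)
            (Finset.sum_nonneg fun _ _ => abs_nonneg _)
          exact mul_le_mul_of_nonneg_left h2 (pow_nonneg (ergodicityCoeff_nonneg _) _)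
      _ = _ := by ring
  have hlim : Filter.Tendsto (fun j : ℕ => ergodicityCoeff (P ^ k) ^ j * (2 * ∑ u, |x u|))
      Filter.atTop (nhds (0 * (2 * ∑ u, |x u|))) :=
    (tendsto_pow_atTop_nhds_zero_of_lt_one (ergodicityCoeff_nonneg _) hk).mul_const _
  rw [zero_mul] at hlim
  have := ge_of_tendsto' hlim hbound
  exact sub_eq_zero.1 (abs_nonpos_iff.1 this)

variable {E : Type*} [NormedAddCommGroup E] [NormedSpace ℝ E]

/-- The action of a matrix on vector-valued functions. -/
def transOp (P : Matrix S S ℝ) (f : S → E) (s : S) : E := ∑ s', P s s' • f s'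

/-- Subtracting the vanishing `d`-mean replaces the row `P s` by `P s - d`, whose `ℓ¹` norm is twice
the total variation distance. -/
lemma norm_transOp_le_of_centered {P : Matrix S S ℝ} {d : S → ℝ} {f : S → E} {F : ℝ}
    (hf : ∀ s, ‖f s‖ ≤ F) (hcent : ∑ s, d s • f s = 0) (s : S) :
    ‖transOp P f s‖ ≤ 2 * tv (P s) d * F := by
  have : transOp P f s = ∑ s', (P s s' - d s') • f s' := by
    simp only [transOp, sub_smul, Finset.sum_sub_distrib, hcent, sub_zero]
  rw [this, ← sum_abs_sub_eq_two_mul_tv, Finset.sum_mul]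
  refine (norm_sum_le _ _).trans (Finset.sum_le_sum fun s' _ => ?_)
  rw [norm_smul, Real.norm_eq_abs]
  exact mul_le_mul_of_nonneg_left (hf s') (abs_nonneg _)

lemma norm_transOp_le {P : Matrix S S ℝ} (hP : P ∈ Matrix.rowStochastic ℝ S) {f : S → E} {F : ℝ}
    (hf : ∀ s, ‖f s‖ ≤ F) (s : S) : ‖transOp P f s‖ ≤ F := by
  calc ‖transOp P f s‖ ≤ ∑ s', P s s' * F := by
        refine (norm_sum_le _ _).trans (Finset.sum_le_sum fun s' _ => ?_)
        rw [norm_smul, Real.norm_eq_abs, abs_of_nonneg (Matrix.nonneg_of_mem_rowStochastic hP)]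
        exact mul_le_mul_of_nonneg_left (hf s') (Matrix.nonneg_of_mem_rowStochastic hP)
    _ = F := by rw [← Finset.sum_mul, Matrix.sum_row_of_mem_rowStochastic hP, one_mul]

lemma transOp_transOp (P Q : Matrix S S ℝ) (f : S → E) :
    transOp P (transOp Q f) = transOp (P * Q) f := by
  ext s
  simp only [transOp, Matrix.mul_apply, Finset.smul_sum, Finset.sum_smul, smul_smul]
  rw [Finset.sum_comm]

lemma transOp_one (f : S → E) : transOp (1 : Matrix S S ℝ) f = f := by
  ext s
  simp [transOp, Matrix.one_apply]

lemma IsStationary.sum_smul_transOp {P : Matrix S S ℝ} {d : S → ℝ} (hd : IsStationary P d)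
    (f : S → E) : ∑ s, d s • transOp P f s = ∑ s, d s • f s := by
  simp only [transOp, Finset.smul_sum, smul_smul]
  rw [Finset.sum_comm]
  refine Finset.sum_congr rfl fun s' _ => ?_
  rw [← Finset.sum_smul, hd.invariant]

/-- The cumulative deviation from stationarity is of the order of the mixing time. -/
lemma sum_norm_transOp_pow_le [Nonempty S] {P : Matrix S S ℝ} (hP : P ∈ Matrix.rowStochastic ℝ S)
    {k : ℕ} (hk : ergodicityCoeff (P ^ k) < 1) (s : S) (N : ℕ) (f : S → E) (F : ℝ)
    (hf : ∀ s, ‖f s‖ ≤ F) (hcent : ∑ s, stationary P s • f s = 0) :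
    ∑ i ∈ Finset.range N, ‖transOp (P ^ i) f s‖ ≤ 2 * mixingTime P * F := by
  obtain ⟨hτ, hmix⟩ := mixingTime_spec hP hk
  have hd := isStationary_stationary hP
  set τ := mixingTime P
  induction N using Nat.strong_induction_on generalizing f F with
  | _ N ih =>
    have hF : 0 ≤ F := (norm_nonneg _).trans (hf s)
    have hshort : ∀ n : ℕ, ∑ i ∈ Finset.range n, ‖transOp (P ^ i) f s‖ ≤ n * F := by
      intro n
      refine (Finset.sum_le_sum fun i _ => norm_transOp_le (pow_mem hP i) hf s).trans ?_
      simp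
    rcases le_total N τ with hN | hN
    · have h1 := hshort N
      have h2 : (N : ℝ) * F ≤ τ * F := by gcongr
      nlinarith [mul_nonneg (Nat.cast_nonneg (α := ℝ) τ) hF]
    · obtain ⟨n, rfl⟩ := Nat.exists_eq_add_of_le hN
      rw [Finset.sum_range_add]
      have h1 := hshort τ
      -- One block of `τ` steps halves the bound, as `2 * (1/4) = 1/2`, and preserves centring. The
      -- first block contributes at most `τ F`, the remainder `2 τ (F/2)`.
      have h2 := ih n (by omega) (transOp (P ^ τ) f) (F / 2) (fun s => by
        refine (norm_transOp_le_of_centered hf hcent s).trans ?_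
        nlinarith [hmix s]) (by rw [(hd.pow τ).sum_smul_transOp, hcent])
      simp only [transOp_transOp, ← pow_add] at h2
      simp_rw [add_comm τ]
      linarith

end ChainLemmas

/-! ### Principal minors of `1 - P` and multiplicative perturbation of stationary laws. -/

section LogLipschitz

variable {S : Type*} [Fintype S] [DecidableEq S]

/-- A weakly diagonally dominant matrix with nonnegative diagonal has nonnegative determinant. -/
lemma det_nonneg_of_sum_row_le_diag (A : Matrix S S ℝ)
    (h : ∀ i, ∑ j ∈ Finset.univ.erase i, |A i j| ≤ A i i) : 0 ≤ A.det := by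
  -- Deformation to the identity: for `t > 0` the dominance is strict, so the determinant cannot
  -- vanish between `t` and 1, where it equals 1. The claim is the limit `t → 0`.
  let f : ℝ → ℝ := fun t => (t • (1 : Matrix S S ℝ) + (1 - t) • A).det
  have hf : Continuous f := by
    refine Continuous.matrix_det ?_
    fun_prop
  have hfne : ∀ t ∈ Set.Ioc (0 : ℝ) 1, f t ≠ 0 := by
    intro t ht
    refine det_ne_zero_of_sum_row_lt_diag fun i => ?_
    have h0 : 0 ≤ A i i := (Finset.sum_nonneg fun _ _ => abs_nonneg _).trans (h i)
    have ht1 : 0 ≤ 1 - t := by linarith [ht.2]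
    have h1 : ∑ j ∈ Finset.univ.erase i, ‖(t • (1 : Matrix S S ℝ) + (1 - t) • A) i j‖
        = (1 - t) * ∑ j ∈ Finset.univ.erase i, |A i j| := by
      rw [Finset.mul_sum]
      refine Finset.sum_congr rfl fun j hj => ?_
      rw [Matrix.add_apply, Matrix.smul_apply, Matrix.one_apply_ne (Finset.ne_of_mem_erase hj).symm]
      simp [abs_of_nonneg ht1]
    have h2 : (t • (1 : Matrix S S ℝ) + (1 - t) • A) i i = t + (1 - t) * A i i := by simp
    rw [h1, h2, Real.norm_eq_abs, abs_of_nonneg (by nlinarith [ht.1])]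
    nlinarith [h i, ht.1]
  have hf1 : f 1 = 1 := by simp [f]
  have hfpos : ∀ t ∈ Set.Ioc (0 : ℝ) 1, 0 < f t := by
    intro t ht
    by_contra hneg
    push Not at hneg
    obtain ⟨u, hu, hu0⟩ := intermediate_value_Icc ht.2 hf.continuousOn
      (show (0 : ℝ) ∈ Set.Icc (f t) (f 1) from ⟨hneg, by rw [hf1]; norm_num⟩)
    exact hfne u ⟨ht.1.trans_le hu.1, hu.2⟩ hu0
  have hlim : Filter.Tendsto f (nhdsWithin 0 (Set.Ioi 0)) (nhds (f 0)) :=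
    (hf.tendsto 0).mono_left nhdsWithin_le_nhds
  have hge : 0 ≤ f 0 := by
    refine ge_of_tendsto hlim ?_
    filter_upwards [Ioc_mem_nhdsGT (show (0 : ℝ) < 1 by norm_num)] with t ht
    exact (hfpos t ht).le
  simpa [f] using hge

/-- The matrix whose `i`-th row is `∑ k, W i k (e_i - e_k)`, except for row `j` which is `e_j`. -/
def groundedLaplacian (W : Matrix S S ℝ) (j : S) : Matrix S S ℝ :=
  (Matrix.diagonal (fun i => ∑ k, W i k) - W).updateRow j (Pi.single j 1)

lemma laplacian_row_dominant (W : S → ℝ) (hW : ∀ k, 0 ≤ W k) (i : S) :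
    ∑ k ∈ Finset.univ.erase i, |(Pi.single i (∑ k, W k) - W : S → ℝ) k|
      ≤ (Pi.single i (∑ k, W k) - W : S → ℝ) i := by
  have h1 : ∑ k ∈ Finset.univ.erase i, |(Pi.single i (∑ k, W k) - W : S → ℝ) k|
      = ∑ k ∈ Finset.univ.erase i, W k := by
    refine Finset.sum_congr rfl fun k hk => ?_
    simp [Finset.ne_of_mem_erase hk, abs_of_nonneg (hW k)]
  rw [h1, ← Finset.add_sum_erase _ _ (Finset.mem_univ i)]
  simp

lemma single_row_dominant (j : S) :
    ∑ k ∈ Finset.univ.erase j, |(Pi.single j (1 : ℝ) : S → ℝ) k|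
      ≤ (Pi.single j (1 : ℝ) : S → ℝ) j := by
  rw [Finset.sum_eq_zero fun k hk => by simp [Finset.ne_of_mem_erase hk]]
  simp

lemma groundedLaplacian_apply_ne (W : Matrix S S ℝ) {i j : S} (h : i ≠ j) :
    groundedLaplacian W j i = Pi.single i (∑ k, W i k) - W i := by
  ext k
  rw [groundedLaplacian, Matrix.updateRow_ne h, Matrix.sub_apply]
  by_cases hk : k = i
  · subst hk; simp
  · simp [hk, Matrix.diagonal_apply_ne _ (Ne.symm hk)]

lemma groundedLaplacian_apply_self (W : Matrix S S ℝ) (j : S) :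
    groundedLaplacian W j j = Pi.single j 1 := by
  rw [groundedLaplacian, Matrix.updateRow_self]

/-- The determinant of the grounded Laplacian is monotone in the weights. -/
lemma det_groundedLaplacian_mono {W W' : Matrix S S ℝ} (hW : ∀ i k, 0 ≤ W i k)
    (hWW' : ∀ i k, W i k ≤ W' i k) (j : S) :
    (groundedLaplacian W j).det ≤ (groundedLaplacian W' j).det := by
  have hW' : ∀ i k, 0 ≤ W' i k := fun i k => (hW i k).trans (hWW' i k)
  -- The rows of `W` are exchanged for those of `W'` one at a time, since the determinant is
  -- additive in a single row.
  let G : Finset S → Matrix S S ℝ := fun R =>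
    groundedLaplacian (Matrix.of fun i k => if i ∈ R then W' i k else W i k) j
  have hstep : ∀ R : Finset S, (groundedLaplacian W j).det ≤ (G R).det := by
    intro R
    induction R using Finset.induction_on with
    | empty =>
      have : G ∅ = groundedLaplacian W j := by
        simp only [G, Finset.notMem_empty, if_false]; rfl
      rw [this]
    | insert i R hi ih =>
      refine ih.trans ?_
      by_cases hij : i = j
      · subst hij
        refine le_of_eq (congrArg _ ?_)
        ext a
        by_cases ha : a = i
        · subst ha; simp only [G, groundedLaplacian_apply_self]
        · simp only [G, groundedLaplacian_apply_ne _ ha, Matrix.of_apply, Finset.mem_insert, ha,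
            false_or, Pi.sub_apply]
      -- The change of row `i` is the Laplacian row of the nonnegative weights `W' i - W i`.
      -- Substituting it for row `i` leaves a weakly dominant matrix, so the determinant increases.
      have hrow : G (insert i R) = (G R).updateRow i
          (G R i + (Pi.single i (∑ k, (W' i k - W i k)) - (W' i - W i))) := by
        ext a k
        by_cases ha : a = i
        · subst ha
          rw [Matrix.updateRow_self]
          simp only [G, groundedLaplacian_apply_ne _ hij, Matrix.of_apply, Finset.mem_insert,
            true_or, if_true, hi, if_false, Pi.sub_apply, Pi.add_apply, Finset.sum_sub_distrib,
            Pi.single_sub]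
          ring
        · rw [Matrix.updateRow_ne ha]
          by_cases haj : a = j
          · subst haj; simp only [G, groundedLaplacian_apply_self]
          · simp only [G, groundedLaplacian_apply_ne _ haj, Matrix.of_apply, Finset.mem_insert, ha,
              false_or, Pi.sub_apply]
      rw [hrow, Matrix.det_updateRow_add, Matrix.updateRow_eq_self]
      refine le_add_of_nonneg_right (det_nonneg_of_sum_row_le_diag _ fun a => ?_)
      by_cases ha : a = i
      · subst ha
        simp only [Matrix.updateRow_self]
        exact laplacian_row_dominant (W' a - W a) (fun k => sub_nonneg.2 (hWW' a k)) a
      · rw [Matrix.updateRow_ne ha]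
        by_cases haj : a = j
        · subst haj
          simp only [G, groundedLaplacian_apply_self]
          exact single_row_dominant a
        · simp only [G, groundedLaplacian_apply_ne _ haj]
          refine laplacian_row_dominant _ (fun k => ?_) a
          simp only [Matrix.of_apply]
          split_ifs
          · exact hW' a k
          · exact hW a k
  have hu : G Finset.univ = groundedLaplacian W' j := by
    simp only [G, Finset.mem_univ, if_true]; rfl
  rw [← hu]
  exact hstep _

lemma det_groundedLaplacian_nonneg {W : Matrix S S ℝ} (hW : ∀ i k, 0 ≤ W i k) (j : S) :
    0 ≤ (groundedLaplacian W j).det := by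
  refine det_nonneg_of_sum_row_le_diag _ fun a => ?_
  by_cases ha : a = j
  · subst ha
    rw [groundedLaplacian_apply_self]
    exact single_row_dominant a
  · rw [groundedLaplacian_apply_ne _ ha]
    exact laplacian_row_dominant _ (hW a) a

/-- Scaling the weights by `c ≥ 1` multiplies the determinant by at most `c ^ |S|`. -/
lemma det_groundedLaplacian_smul_le {W : Matrix S S ℝ} (hW : ∀ i k, 0 ≤ W i k) {c : ℝ}
    (hc : 1 ≤ c) (j : S) :
    (groundedLaplacian (c • W) j).det ≤ c ^ Fintype.card S * (groundedLaplacian W j).det := by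
  have h : groundedLaplacian (c • W) j
      = Matrix.of fun i => (if i = j then 1 else c) • groundedLaplacian W j i := by
    ext a k
    by_cases ha : a = j
    · subst ha
      simp [groundedLaplacian_apply_self]
    · rw [groundedLaplacian_apply_ne _ ha, Matrix.of_apply, if_neg ha,
        groundedLaplacian_apply_ne _ ha]
      by_cases hk : k = a
      · subst hk
        simp [← Finset.mul_sum, mul_sub]
      · simp [hk]
  rw [h]
  have h2 := Matrix.det_mul_column (fun i => if i = j then 1 else c) (groundedLaplacian W j)
  have h3 : (Matrix.of fun i => (if i = j then (1 : ℝ) else c) • groundedLaplacian W j i)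
      = Matrix.of fun i k => (if i = j then (1 : ℝ) else c) * groundedLaplacian W j i k := rfl
  rw [h3, h2]
  refine mul_le_mul_of_nonneg_right ?_ (det_groundedLaplacian_nonneg hW j)
  -- Only the rows other than `j` are scaled; the exponent `|S| - 1` is rounded up using `c ≥ 1`.
  calc ∏ i, (if i = j then (1 : ℝ) else c) ≤ ∏ _i : S, c := by
        refine Finset.prod_le_prod (fun i _ => ?_) (fun i _ => ?_) <;> split_ifs <;> linarith
    _ = c ^ Fintype.card S := by simp

lemma groundedLaplacian_of_mem_rowStochastic {P : Matrix S S ℝ}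
    (hP : P ∈ Matrix.rowStochastic ℝ S) (j : S) :
    groundedLaplacian P j = (1 - P).updateRow j (Pi.single j 1) := by
  rw [groundedLaplacian]
  congr 2
  simp_rw [Matrix.sum_row_of_mem_rowStochastic hP]
  exact Matrix.diagonal_one

/-- The stationary distribution of an ergodic kernel is proportional to the principal minors of
`1 - P`. -/
lemma IsStationary.det_groundedLaplacian_eq {P : Matrix S S ℝ}
    (hP : P ∈ Matrix.rowStochastic ℝ S) {k : ℕ} (hk : ergodicityCoeff (P ^ k) < 1) {d : S → ℝ}
    (hd : IsStationary P d) :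
    ∃ c : ℝ, 0 < c ∧ ∀ j, (groundedLaplacian P j).det = c * d j := by
  obtain ⟨s, hs⟩ : ∃ s, 0 < d s := by
    by_contra h
    push Not at h
    have := hd.sum_one
    rw [Finset.sum_eq_zero fun s _ => le_antisymm (h s) (hd.nonneg s)] at this
    exact zero_ne_one this
  set L := (1 : Matrix S S ℝ) - P with hL
  have hdet : L.det = 0 := by
    rw [← Matrix.exists_vecMul_eq_zero_iff]
    refine ⟨d, fun h => by simp [h] at hs, ?_⟩
    rw [hL, Matrix.vecMul_sub, Matrix.vecMul_one]
    ext s'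
    simp only [Pi.sub_apply, Pi.zero_apply]
    rw [← hd.invariant s']
    simp [Matrix.vecMul, dotProduct, hd.invariant]
  -- The minors are the diagonal of the adjugate of `L = 1 - P`. As `L` is singular, the rows of the
  -- adjugate are left invariant, hence multiples of `d`, and its columns are right invariant, hence
  -- constant; so all rows are the same multiple of `d`.
  have hadj : ∀ j, L.adjugate j j = (groundedLaplacian P j).det := fun j => by
    rw [Matrix.adjugate_apply, groundedLaplacian_of_mem_rowStochastic hP]
  have hleft : ∀ i, (L.adjugate i) ᵥ* P = L.adjugate i := by
    intro i
    have h1 : L.adjugate i ᵥ* L = 0 := by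
      have := congrFun (Matrix.adjugate_mul L) i
      rw [hdet, zero_smul] at this
      ext j
      have := congrFun this j
      simpa [Matrix.mul_apply, Matrix.vecMul, dotProduct] using this
    rw [hL, Matrix.vecMul_sub, Matrix.vecMul_one] at h1
    exact (sub_eq_zero.1 h1).symm
  have hrep : ∀ i j, L.adjugate i j = (∑ t, L.adjugate i t) * d j := fun i j =>
    congrFun (hd.eq_smul_of_vecMul_eq hk (hleft i)) j
  have hright : P *ᵥ (fun i => L.adjugate i s) = fun i => L.adjugate i s := by
    have h1 : L *ᵥ (fun i => L.adjugate i s) = 0 := by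
      ext i
      have := congrFun (congrFun (Matrix.mul_adjugate L) i) s
      rw [hdet, zero_smul] at this
      simpa [Matrix.mul_apply, Matrix.mulVec, dotProduct] using this
    rw [hL, Matrix.sub_mulVec, Matrix.one_mulVec] at h1
    exact (sub_eq_zero.1 h1).symm
  have hconst : ∀ i, (∑ t, L.adjugate i t) = ∑ t, L.adjugate s t := by
    intro i
    have h1 : L.adjugate i s = L.adjugate s s := eq_const_of_mulVec_eq hP hk hright i s
    rw [hrep i s, hrep s s] at h1
    exact mul_right_cancel₀ hs.ne' h1
  have hF : ∀ j, (groundedLaplacian P j).det = (∑ t, L.adjugate s t) * d j := fun j => by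
    rw [← hadj, hrep, hconst]
  refine ⟨_, ?_, hF⟩
  -- For a null vector `x` of the grounded matrix, `L x` vanishes off `s`, and `d ⬝ L x = 0` with `d
  -- s > 0` makes it vanish at `s` too. Then `x` is constant, equal to `x s = 0`.
  have hne : (groundedLaplacian P s).det ≠ 0 := by
    intro h0
    obtain ⟨x, hx, hx0⟩ := Matrix.exists_mulVec_eq_zero_iff.2 h0
    rw [groundedLaplacian_of_mem_rowStochastic hP] at hx0
    have hxs : x s = 0 := by
      have := congrFun hx0 s
      simpa [Matrix.mulVec] using this
    have hxo : ∀ i, i ≠ s → (L *ᵥ x) i = 0 := by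
      intro i hi
      have := congrFun hx0 i
      rw [Matrix.mulVec, Matrix.updateRow_ne hi] at this
      exact this
    have hdL : d ⬝ᵥ (L *ᵥ x) = 0 := by
      rw [Matrix.dotProduct_mulVec, hL, Matrix.vecMul_sub, Matrix.vecMul_one]
      have : d ᵥ* P = d := funext fun s' => hd.invariant s'
      rw [this, sub_self, zero_dotProduct]
    have hLs : (L *ᵥ x) s = 0 := by
      rw [dotProduct, Finset.sum_eq_single s (fun i _ hi => by rw [hxo i hi, mul_zero])
        (fun h => absurd (Finset.mem_univ s) h)] at hdL
      exact (mul_eq_zero.1 hdL).resolve_left hs.ne'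
    have hPx : P *ᵥ x = x := by
      have : L *ᵥ x = 0 := by
        ext i
        by_cases hi : i = s
        · rw [hi, hLs]; rfl
        · rw [hxo i hi]; rfl
      rw [hL, Matrix.sub_mulVec, Matrix.one_mulVec] at this
      exact (sub_eq_zero.1 this).symm
    refine hx (funext fun i => ?_)
    rw [eq_const_of_mulVec_eq hP hk hPx i s, hxs]; rfl
  have hnn := det_groundedLaplacian_nonneg (W := P)
    (fun i k => Matrix.nonneg_of_mem_rowStochastic hP) s
  have hpos : 0 < (groundedLaplacian P s).det := lt_of_le_of_ne hnn hne.symm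
  rw [hF s] at hpos
  exact (pos_iff_pos_of_mul_pos hpos).2 hs

/-- If two ergodic kernels are comparable entrywise up to a factor `c`, then so are their
stationary distributions, up to a factor which depends only on `c` and the number of states. -/
lemma IsStationary.le_mul_of_le_mul {P P' : Matrix S S ℝ} (hP : P ∈ Matrix.rowStochastic ℝ S)
    (hP' : P' ∈ Matrix.rowStochastic ℝ S) {k k' : ℕ} (hk : ergodicityCoeff (P ^ k) < 1)
    (hk' : ergodicityCoeff (P' ^ k') < 1) {d d' : S → ℝ} (hd : IsStationary P d)
    (hd' : IsStationary P' d') {c : ℝ} (hc : 1 ≤ c) (h : ∀ i j, P i j ≤ c * P' i j)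
    (h' : ∀ i j, P' i j ≤ c * P i j) (s : S) :
    d' s ≤ c ^ (2 * Fintype.card S) * d s := by
  obtain ⟨a, ha, hda⟩ := hd.det_groundedLaplacian_eq hP hk
  obtain ⟨a', ha', hda'⟩ := hd'.det_groundedLaplacian_eq hP' hk'
  have hc0 : 0 ≤ c := zero_le_one.trans hc
  have hPn : ∀ i j, 0 ≤ P i j := fun i j => Matrix.nonneg_of_mem_rowStochastic hP
  have hPn' : ∀ i j, 0 ≤ P' i j := fun i j => Matrix.nonneg_of_mem_rowStochastic hP'
  have h1 : ∀ j, a * d j ≤ c ^ Fintype.card S * (a' * d' j) := fun j => by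
    rw [← hda, ← hda']
    exact (det_groundedLaplacian_mono hPn (W' := c • P') h j).trans
      (det_groundedLaplacian_smul_le hPn' hc j)
  have h2 : ∀ j, a' * d' j ≤ c ^ Fintype.card S * (a * d j) := fun j => by
    rw [← hda, ← hda']
    exact (det_groundedLaplacian_mono hPn' (W' := c • P) h' j).trans
      (det_groundedLaplacian_smul_le hPn hc j)
  -- Summing over states eliminates the stationary laws and compares the two unknown normalising
  -- constants. This second use of the comparison is why the exponent is `2 |S|`.
  have h3 : a ≤ c ^ Fintype.card S * a' := by
    have := Finset.sum_le_sum fun j (_ : j ∈ Finset.univ) => h1 j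
    rwa [← Finset.mul_sum, ← Finset.mul_sum, ← Finset.mul_sum, hd.sum_one, hd'.sum_one, mul_one,
      mul_one] at this
  have h4 : a' * d' s ≤ a' * (c ^ (2 * Fintype.card S) * d s) := by
    calc a' * d' s ≤ c ^ Fintype.card S * (a * d s) := h2 s
      _ ≤ c ^ Fintype.card S * ((c ^ Fintype.card S * a') * d s) := by
          have := hd.nonneg s
          gcongr
      _ = _ := by ring
  exact le_of_mul_le_mul_left h4 ha'

end LogLipschitz

/-! ### Stationary means of functions of a transition and their dependence on the policy parameter.
-/

noncomputable section TargetLemmas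

variable {S A : Type*} [Fintype S] [DecidableEq S] [Fintype A] {rmax : ℝ} {d m : ℕ}
  {M : MDP S A rmax} {pol : PolicyClass S A d} {φ : S → EuclideanSpace ℝ (Fin m)}
  {B K L lam Rω : ℝ}

lemma kernel_mem_rowStochastic (M : MDP S A rmax) (pol : PolicyClass S A d)
    (θ : EuclideanSpace ℝ (Fin d)) : kernel M pol θ ∈ Matrix.rowStochastic ℝ S := by
  rw [Matrix.mem_rowStochastic_iff_sum]
  refine ⟨fun s s' => Finset.sum_nonneg fun a _ =>
    mul_nonneg (pol.π_pos θ s a).le (M.p_nonneg s a s'), fun s => ?_⟩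
  simp only [kernel, Matrix.of_apply]
  rw [Finset.sum_comm]
  simp_rw [← Finset.mul_sum, M.p_sum, mul_one]
  exact pol.π_sum θ s

/-- Policies with a bounded score are log-Lipschitz. -/
lemma PolicyClass.Regular.prob_le (h : pol.Regular B K L) (θ θ' : EuclideanSpace ℝ (Fin d))
    (s : S) (a : A) : pol.π θ' s a ≤ Real.exp (B * ‖θ' - θ‖) * pol.π θ s a := by
  have h1 : ‖Real.log (pol.π θ' s a) - Real.log (pol.π θ s a)‖ ≤ B * ‖θ' - θ‖ := by
    refine Convex.norm_image_sub_le_of_norm_fderiv_le (𝕜 := ℝ)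
      (f := fun θ => Real.log (pol.π θ s a)) (s := Set.univ)
      (fun x _ => h.differentiable s a x) (fun x _ => ?_) convex_univ (Set.mem_univ _)
      (Set.mem_univ _)
    have := h.score_bound x s a
    rwa [PolicyClass.score, gradient, LinearIsometryEquiv.norm_map] at this
  have h2 : Real.log (pol.π θ' s a) ≤ B * ‖θ' - θ‖ + Real.log (pol.π θ s a) := by
    have := (le_abs_self _).trans h1
    linarith
  calc pol.π θ' s a = Real.exp (Real.log (pol.π θ' s a)) := (Real.exp_log (pol.π_pos _ _ _)).symm
    _ ≤ Real.exp (B * ‖θ' - θ‖ + Real.log (pol.π θ s a)) := Real.exp_le_exp.2 h2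
    _ = _ := by rw [Real.exp_add, Real.exp_log (pol.π_pos _ _ _)]

/-- The stationary law of a transition `(s, a, s')`. -/
def jointLaw (M : MDP S A rmax) (pol : PolicyClass S A d) (θ : EuclideanSpace ℝ (Fin d))
    (z : S × A × S) : ℝ :=
  stationary (kernel M pol θ) z.1 * pol.π θ z.1 z.2.1 * M.p z.1 z.2.1 z.2.2

variable {E : Type*} [NormedAddCommGroup E] [NormedSpace ℝ E]

/-- The stationary mean of a function of a transition. -/
def statMean (M : MDP S A rmax) (pol : PolicyClass S A d) (θ : EuclideanSpace ℝ (Fin d))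
    (u : S × A × S → E) : E :=
  ∑ z, jointLaw M pol θ z • u z

/-- The mean of a function of a transition which starts at `s`. -/
def stepMean (M : MDP S A rmax) (pol : PolicyClass S A d) (θ : EuclideanSpace ℝ (Fin d))
    (u : S × A × S → E) (s : S) : E :=
  ∑ a, ∑ s', (pol.π θ s a * M.p s a s') • u (s, a, s')

lemma statMean_eq_sum_stepMean (θ : EuclideanSpace ℝ (Fin d)) (u : S × A × S → E) :
    statMean M pol θ u = ∑ s, stationary (kernel M pol θ) s • stepMean M pol θ u s := by
  simp only [statMean, stepMean, jointLaw, Fintype.sum_prod_type, Finset.smul_sum, smul_smul,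
    mul_assoc]

lemma stepMean_comp_fst (θ : EuclideanSpace ℝ (Fin d)) (f : S → E) (s : S) :
    stepMean M pol θ (fun z => f z.1) s = f s := by
  simp only [stepMean]
  simp_rw [← Finset.sum_smul, ← Finset.mul_sum, M.p_sum, mul_one, pol.π_sum, one_smul]

lemma stepMean_comp_last (θ : EuclideanSpace ℝ (Fin d)) (f : S → E) (s : S) :
    stepMean M pol θ (fun z => f z.2.2) s = transOp (kernel M pol θ) f s := by
  simp only [stepMean, transOp, kernel, Matrix.of_apply, Finset.sum_smul]
  rw [Finset.sum_comm]

lemma norm_stepMean_le (θ : EuclideanSpace ℝ (Fin d)) {u : S × A × S → E} {U : ℝ}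
    (hu : ∀ z, ‖u z‖ ≤ U) (s : S) : ‖stepMean M pol θ u s‖ ≤ U := by
  calc ‖stepMean M pol θ u s‖ ≤ ∑ a, ∑ s', (pol.π θ s a * M.p s a s') * U := by
        refine (norm_sum_le _ _).trans (Finset.sum_le_sum fun a _ => ?_)
        refine (norm_sum_le _ _).trans (Finset.sum_le_sum fun s' _ => ?_)
        have h := mul_nonneg (pol.π_pos θ s a).le (M.p_nonneg s a s')
        rw [norm_smul, Real.norm_eq_abs, abs_of_nonneg h]
        exact mul_le_mul_of_nonneg_left (hu _) h
    _ = U := by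
        simp_rw [← Finset.sum_mul, ← Finset.mul_sum, M.p_sum, mul_one, pol.π_sum, one_mul]

section Nonempty

variable [Nonempty S]

lemma isStationary_kernel (θ : EuclideanSpace ℝ (Fin d)) :
    IsStationary (kernel M pol θ) (stationary (kernel M pol θ)) :=
  isStationary_stationary (kernel_mem_rowStochastic M pol θ)

lemma jointLaw_nonneg (θ : EuclideanSpace ℝ (Fin d)) (z : S × A × S) :
    0 ≤ jointLaw M pol θ z :=
  mul_nonneg (mul_nonneg ((isStationary_kernel θ).nonneg _) (pol.π_pos _ _ _).le)
    (M.p_nonneg _ _ _)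

lemma statMean_comp_fst (θ : EuclideanSpace ℝ (Fin d)) (f : S → E) :
    statMean M pol θ (fun z => f z.1) = ∑ s, stationary (kernel M pol θ) s • f s := by
  simp_rw [statMean_eq_sum_stepMean, stepMean_comp_fst]

/-- By invariance both endpoints of a stationary transition have the same marginal. The Dirichlet
identity for the critic matrix rests on this. -/
lemma statMean_comp_last (θ : EuclideanSpace ℝ (Fin d)) (f : S → E) :
    statMean M pol θ (fun z => f z.2.2) = ∑ s, stationary (kernel M pol θ) s • f s := by
  simp_rw [statMean_eq_sum_stepMean, stepMean_comp_last]
  exact (isStationary_kernel θ).sum_smul_transOp f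

lemma statMean_const (θ : EuclideanSpace ℝ (Fin d)) (c : E) :
    statMean M pol θ (fun _ => c) = c := by
  rw [statMean_comp_fst θ (fun _ => c), ← Finset.sum_smul, (isStationary_kernel θ).sum_one,
    one_smul]

lemma sum_jointLaw (θ : EuclideanSpace ℝ (Fin d)) : ∑ z, jointLaw M pol θ z = 1 := by
  have := statMean_const (M := M) (pol := pol) θ (1 : ℝ)
  simpa [statMean] using this

lemma norm_statMean_le (θ : EuclideanSpace ℝ (Fin d)) {u : S × A × S → E} {U : ℝ}
    (hu : ∀ z, ‖u z‖ ≤ U) : ‖statMean M pol θ u‖ ≤ U := by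
  calc ‖statMean M pol θ u‖ ≤ ∑ z, jointLaw M pol θ z * U := by
        refine (norm_sum_le _ _).trans (Finset.sum_le_sum fun z _ => ?_)
        rw [norm_smul, Real.norm_eq_abs, abs_of_nonneg (jointLaw_nonneg θ z)]
        exact mul_le_mul_of_nonneg_left (hu z) (jointLaw_nonneg θ z)
    _ = U := by rw [← Finset.sum_mul, sum_jointLaw, one_mul]

lemma statMean_add (θ : EuclideanSpace ℝ (Fin d)) (u v : S × A × S → E) :
    statMean M pol θ (fun z => u z + v z) = statMean M pol θ u + statMean M pol θ v := by
  simp only [statMean, smul_add, Finset.sum_add_distrib]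

lemma statMean_sub (θ : EuclideanSpace ℝ (Fin d)) (u v : S × A × S → E) :
    statMean M pol θ (fun z => u z - v z) = statMean M pol θ u - statMean M pol θ v := by
  simp only [statMean, smul_sub, Finset.sum_sub_distrib]

lemma statMean_smul (θ : EuclideanSpace ℝ (Fin d)) (c : ℝ) (u : S × A × S → E) :
    statMean M pol θ (fun z => c • u z) = c • statMean M pol θ u := by
  simp only [statMean, Finset.smul_sum]
  exact Finset.sum_congr rfl fun z _ => smul_comm _ _ _

lemma avgReward_eq_statMean (θ : EuclideanSpace ℝ (Fin d)) :
    avgReward M pol θ = statMean M pol θ (fun z => M.r z.1 z.2.1) := by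
  simp only [avgReward, statMean, jointLaw, Fintype.sum_prod_type, smul_eq_mul]
  refine Finset.sum_congr rfl fun s _ => Finset.sum_congr rfl fun a _ => ?_
  simp_rw [← Finset.sum_mul, ← Finset.mul_sum, M.p_sum, mul_one]

lemma MDP.abs_r_le (M : MDP S A rmax) (s : S) (a : A) : |M.r s a| ≤ rmax := by
  rw [abs_of_nonneg (M.r_nonneg s a)]; exact M.r_le s a

lemma avgReward_nonneg (θ : EuclideanSpace ℝ (Fin d)) : 0 ≤ avgReward M pol θ := by
  rw [avgReward_eq_statMean]
  exact Finset.sum_nonneg fun z _ => mul_nonneg (jointLaw_nonneg θ z) (M.r_nonneg _ _)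

lemma avgReward_le (θ : EuclideanSpace ℝ (Fin d)) : avgReward M pol θ ≤ rmax := by
  rw [avgReward_eq_statMean]
  exact (le_abs_self _).trans (norm_statMean_le (E := ℝ) θ fun z => M.abs_r_le _ _)

/-- A Lipschitz constant of the stationary law with respect to the policy parameter. -/
def lawLip (n : ℕ) (B : ℝ) : ℝ := ((2 * n + 1 : ℕ) * B) * Real.exp ((2 * n + 1 : ℕ) * B)

/-- The law of a transition changes at most by the factor `c^(2n+1)`: `c^(2n)` from the stationary
distribution and one `c` from the policy. A multiplicative comparison of probability vectors gives
an `ℓ¹` bound, linear in the displacement because the latter is at most 1. -/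
lemma sum_abs_jointLaw_sub_le (hreg : pol.Regular B K L) (herg : Ergodic M pol) (hB : 0 ≤ B)
    {θ θ' : EuclideanSpace ℝ (Fin d)} (hθ : ‖θ' - θ‖ ≤ 1) :
    ∑ z, |jointLaw M pol θ' z - jointLaw M pol θ z|
      ≤ lawLip (Fintype.card S) B * ‖θ' - θ‖ := by
  set n := Fintype.card S
  set Δ := ‖θ' - θ‖
  have hΔ0 : 0 ≤ Δ := norm_nonneg _
  set c := Real.exp (B * Δ) with hc
  have hc1 : 1 ≤ c := Real.one_le_exp (by positivity)
  have hπ : ∀ s a, pol.π θ' s a ≤ c * pol.π θ s a := hreg.prob_le θ θ'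
  have hπ' : ∀ s a, pol.π θ s a ≤ c * pol.π θ' s a := fun s a => by
    have := hreg.prob_le θ' θ s a
    rwa [norm_sub_rev] at this
  have hker : ∀ {θ₁ θ₂ : EuclideanSpace ℝ (Fin d)}, (∀ s a, pol.π θ₂ s a ≤ c * pol.π θ₁ s a) →
      ∀ s s', kernel M pol θ₂ s s' ≤ c * kernel M pol θ₁ s s' := by
    intro θ₁ θ₂ h s s'
    simp only [kernel, Matrix.of_apply, Finset.mul_sum]
    refine Finset.sum_le_sum fun a _ => ?_
    rw [← mul_assoc]
    exact mul_le_mul_of_nonneg_right (h s a) (M.p_nonneg _ _ _)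
  have hlaw : ∀ {θ₁ θ₂ : EuclideanSpace ℝ (Fin d)}, (∀ s a, pol.π θ₂ s a ≤ c * pol.π θ₁ s a) →
      (∀ s a, pol.π θ₁ s a ≤ c * pol.π θ₂ s a) →
      ∀ z, jointLaw M pol θ₂ z ≤ c ^ (2 * n + 1) * jointLaw M pol θ₁ z := by
    intro θ₁ θ₂ h h' z
    obtain ⟨k₁, hk₁⟩ := herg θ₁
    obtain ⟨k₂, hk₂⟩ := herg θ₂
    have hd := (isStationary_kernel (M := M) (pol := pol) θ₁).le_mul_of_le_mul
      (kernel_mem_rowStochastic M pol θ₁) (kernel_mem_rowStochastic M pol θ₂) hk₁ hk₂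
      (isStationary_kernel θ₂) hc1 (hker h') (hker h) z.1
    have h0 := (isStationary_kernel (M := M) (pol := pol) θ₁).nonneg z.1
    have h2 := (pol.π_pos θ₂ z.1 z.2.1).le
    calc jointLaw M pol θ₂ z
        ≤ (c ^ (2 * n) * stationary (kernel M pol θ₁) z.1) * (c * pol.π θ₁ z.1 z.2.1)
          * M.p z.1 z.2.1 z.2.2 := by
          refine mul_le_mul_of_nonneg_right ?_ (M.p_nonneg _ _ _)
          exact mul_le_mul hd (h _ _) h2 (by positivity)
      _ = _ := by rw [jointLaw]; ring
  have hpt : ∀ z, |jointLaw M pol θ' z - jointLaw M pol θ z|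
      ≤ (c ^ (2 * n + 1) - 1) * jointLaw M pol θ z := by
    intro z
    have h1 := hlaw hπ hπ' z
    have h2 := hlaw hπ' hπ z
    have h3 := jointLaw_nonneg (M := M) (pol := pol) θ z
    have hC : 0 ≤ c ^ (2 * n + 1) - 1 := sub_nonneg.2 (one_le_pow₀ hc1)
    rw [abs_le]
    constructor
    -- The reverse comparison bounds a loss of mass by a multiple of the new probability, which in
    -- the case of a loss is the smaller of the two.
    · by_cases h4 : jointLaw M pol θ' z ≤ jointLaw M pol θ z
      · nlinarith
      · nlinarith
    · linarith
  refine (Finset.sum_le_sum fun z _ => hpt z).trans ?_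
  rw [← Finset.mul_sum, sum_jointLaw, mul_one]
  set N : ℝ := ((2 * n + 1 : ℕ) : ℝ) with hN
  have hcp : c ^ (2 * n + 1) = Real.exp (N * B * Δ) := by
    rw [hc, ← Real.exp_nat_mul]; congr 1; rw [hN]; ring
  rw [hcp, lawLip]
  have hx0 : 0 ≤ N * B * Δ := by positivity
  have h1 : Real.exp (N * B * Δ) - 1 ≤ (N * B * Δ) * Real.exp (N * B * Δ) := by
    have h2 := Real.one_sub_le_exp_neg (N * B * Δ)
    have h3 : Real.exp (N * B * Δ) * Real.exp (-(N * B * Δ)) = 1 := by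
      rw [← Real.exp_add]; simp
    nlinarith [Real.exp_pos (N * B * Δ)]
  refine h1.trans ?_
  have h4 : Real.exp (N * B * Δ) ≤ Real.exp (N * B) :=
    Real.exp_le_exp.2 (mul_le_of_le_one_right (by positivity) hθ)
  calc (N * B * Δ) * Real.exp (N * B * Δ) ≤ (N * B * Δ) * Real.exp (N * B) := by gcongr
    _ = _ := by ring

lemma norm_statMean_sub_le (hreg : pol.Regular B K L) (herg : Ergodic M pol) (hB : 0 ≤ B)
    {θ θ' : EuclideanSpace ℝ (Fin d)} (hθ : ‖θ' - θ‖ ≤ 1) {u : S × A × S → E} {U : ℝ}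
    (hU : 0 ≤ U) (hu : ∀ z, ‖u z‖ ≤ U) :
    ‖statMean M pol θ' u - statMean M pol θ u‖
      ≤ lawLip (Fintype.card S) B * ‖θ' - θ‖ * U := by
  have h : statMean M pol θ' u - statMean M pol θ u
      = ∑ z, (jointLaw M pol θ' z - jointLaw M pol θ z) • u z := by
    simp only [statMean, sub_smul, Finset.sum_sub_distrib]
  rw [h]
  calc _ ≤ ∑ z, |jointLaw M pol θ' z - jointLaw M pol θ z| * U := by
        refine (norm_sum_le _ _).trans (Finset.sum_le_sum fun z _ => ?_)
        rw [norm_smul, Real.norm_eq_abs]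
        exact mul_le_mul_of_nonneg_left (hu z) (abs_nonneg _)
    _ ≤ _ := by
        rw [← Finset.sum_mul]
        exact mul_le_mul_of_nonneg_right (sum_abs_jointLaw_sub_le hreg herg hB hθ) hU

lemma abs_avgReward_sub_le (hreg : pol.Regular B K L) (herg : Ergodic M pol) (hB : 0 ≤ B)
    (hr : 0 ≤ rmax) {θ θ' : EuclideanSpace ℝ (Fin d)} (hθ : ‖θ' - θ‖ ≤ 1) :
    |avgReward M pol θ' - avgReward M pol θ|
      ≤ lawLip (Fintype.card S) B * ‖θ' - θ‖ * rmax := by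
  rw [avgReward_eq_statMean, avgReward_eq_statMean]
  exact norm_statMean_sub_le (E := ℝ) hreg herg hB hθ hr fun z => M.abs_r_le _ _

end Nonempty

/-! ### The temporal difference direction -/

/-- One sample of the critic direction. -/
def tdSample (M : MDP S A rmax) (φ : S → EuclideanSpace ℝ (Fin m)) (η : ℝ)
    (ω : EuclideanSpace ℝ (Fin m)) (z : S × A × S) : EuclideanSpace ℝ (Fin m) :=
  (M.r z.1 z.2.1 - η + inner ℝ (φ z.2.2 - φ z.1) ω) • φ z.1

/-- The linear map with matrix `A_θ`. -/
def tdMap (M : MDP S A rmax) (pol : PolicyClass S A d) (φ : S → EuclideanSpace ℝ (Fin m))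
    (θ : EuclideanSpace ℝ (Fin d)) (x : EuclideanSpace ℝ (Fin m)) : EuclideanSpace ℝ (Fin m) :=
  WithLp.toLp 2 (tdMatrix M pol φ θ *ᵥ x.ofLp)

lemma tdMap_eq_statMean (θ : EuclideanSpace ℝ (Fin d)) (x : EuclideanSpace ℝ (Fin m)) :
    tdMap M pol φ θ x
      = statMean M pol θ (fun z => (inner ℝ (φ z.1 - φ z.2.2) x : ℝ) • φ z.1) := by
  ext i
  simp only [tdMap, tdMatrix, statMean, jointLaw, Matrix.mulVec, dotProduct, Matrix.of_apply,
    WithLp.ofLp_sum, Finset.sum_apply, PiLp.smul_apply, smul_eq_mul, Fintype.sum_prod_type,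
    Finset.sum_mul, PiLp.inner_apply, PiLp.sub_apply, RCLike.inner_apply, conj_trivial]
  rw [Finset.sum_comm]
  refine Finset.sum_congr rfl fun s _ => ?_
  rw [Finset.sum_comm]
  refine Finset.sum_congr rfl fun a _ => ?_
  rw [Finset.sum_comm]
  refine Finset.sum_congr rfl fun s' _ => ?_
  rw [Finset.mul_sum]
  exact Finset.sum_congr rfl fun j _ => by ring

lemma tdMap_sub (θ : EuclideanSpace ℝ (Fin d)) (x y : EuclideanSpace ℝ (Fin m)) :
    tdMap M pol φ θ (x - y) = tdMap M pol φ θ x - tdMap M pol φ θ y := by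
  simp only [tdMap, WithLp.ofLp_sub, Matrix.mulVec_sub, WithLp.toLp_sub]

lemma tdVector_eq_statMean (θ : EuclideanSpace ℝ (Fin d)) :
    tdVector M pol φ θ
      = statMean M pol θ (fun z => (M.r z.1 z.2.1 - avgReward M pol θ) • φ z.1) := by
  simp only [tdVector, statMean, jointLaw, Fintype.sum_prod_type]
  refine Finset.sum_congr rfl fun s _ => Finset.sum_congr rfl fun a _ => ?_
  simp_rw [smul_smul]
  rw [← Finset.sum_smul]
  congr 1
  rw [← Finset.sum_mul, ← Finset.mul_sum, M.p_sum, mul_one]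

lemma abs_inner_feature_le (hφ : ∀ s, ‖φ s‖ ≤ 1) (s s' : S) (x : EuclideanSpace ℝ (Fin m)) :
    |(inner ℝ (φ s - φ s') x : ℝ)| ≤ 2 * ‖x‖ := by
  refine (abs_real_inner_le_norm _ _).trans (mul_le_mul_of_nonneg_right ?_ (norm_nonneg _))
  refine (norm_sub_le _ _).trans ?_
  linarith [hφ s, hφ s']

lemma norm_tdSample_le (hφ : ∀ s, ‖φ s‖ ≤ 1) (η : ℝ) (ω : EuclideanSpace ℝ (Fin m))
    {D : ℝ} (hD : ∀ s a, |M.r s a - η| ≤ D) (z : S × A × S) :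
    ‖tdSample M φ η ω z‖ ≤ D + 2 * ‖ω‖ := by
  rw [tdSample, norm_smul, Real.norm_eq_abs]
  have h1 := abs_inner_feature_le hφ z.2.2 z.1 ω
  have h2 := hD z.1 z.2.1
  have h3 := hφ z.1
  calc _ ≤ (D + 2 * ‖ω‖) * 1 := by
        refine mul_le_mul ((abs_add_le _ _).trans (add_le_add h2 h1)) h3 (norm_nonneg _) ?_
        exact add_nonneg ((abs_nonneg _).trans h2) (by positivity)
    _ = _ := mul_one _

/-- Splitting `r - η = (r - J) + (J - η)` isolates the influence of the reward error on the critic: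
a perturbation of norm at most `|J - η|` for features of norm at most one. -/
lemma statMean_tdSample [Nonempty S] (θ : EuclideanSpace ℝ (Fin d)) (η : ℝ)
    (ω : EuclideanSpace ℝ (Fin m)) :
    statMean M pol θ (tdSample M φ η ω)
      = tdVector M pol φ θ - tdMap M pol φ θ ω
        + (avgReward M pol θ - η) • statMean M pol θ (fun z => φ z.1) := by
  rw [tdVector_eq_statMean, tdMap_eq_statMean, ← statMean_smul, ← statMean_sub, ← statMean_add]
  congr 1
  ext1 z
  have : (inner ℝ (φ z.2.2 - φ z.1) ω : ℝ) = -inner ℝ (φ z.1 - φ z.2.2) ω := by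
    rw [← inner_neg_left, neg_sub]
  rw [tdSample, this]
  module

end TargetLemmas

/-! ### Coercivity of `A_θ` and the Lipschitz bound for the critic target. -/

noncomputable section CriticLemmas

lemma pow_card_le_norm_multiset_prod {lam : ℝ} (hlam : 0 ≤ lam) (s : Multiset ℂ)
    (hs : ∀ z ∈ s, lam ≤ ‖z‖) : lam ^ s.card ≤ ‖s.prod‖ := by
  induction s using Multiset.induction_on with
  | empty => simp
  | cons a s ih =>
    rw [Multiset.prod_cons, norm_mul, Multiset.card_cons, pow_succ, mul_comm]
    exact mul_le_mul (hs a (Multiset.mem_cons_self a s))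
      (ih fun z hz => hs z (Multiset.mem_cons_of_mem hz)) (by positivity) (norm_nonneg _)

/-- If all eigenvalues have modulus at least `lam`, then `|det A| ≥ lam ^ m`. -/
lemma pow_le_abs_det {m : ℕ} {lam : ℝ} (hlam : 0 ≤ lam) (A : Matrix (Fin m) (Fin m) ℝ)
    (h : ∀ z ∈ spectrum ℂ (A.map (fun x : ℝ => (x : ℂ))), lam ≤ ‖z‖) : lam ^ m ≤ |A.det| := by
  set Ac : Matrix (Fin m) (Fin m) ℂ := A.map (fun x : ℝ => (x : ℂ)) with hAc
  have hdet : Ac.det = (A.det : ℂ) := by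
    have := RingHom.map_det (Complex.ofRealHom) A
    exact this.symm
  have h1 : ‖Ac.det‖ = |A.det| := by rw [hdet, Complex.norm_real, Real.norm_eq_abs]
  rw [← h1, Matrix.det_eq_prod_roots_charpoly]
  have hcard : Ac.charpoly.roots.card = m := by
    rw [IsAlgClosed.card_roots_eq_natDegree, Matrix.charpoly_natDegree_eq_dim, Fintype.card_fin]
  have h2 := pow_card_le_norm_multiset_prod hlam Ac.charpoly.roots fun z hz =>
    h z (Matrix.mem_spectrum_iff_isRoot_charpoly.2 (Polynomial.isRoot_of_mem_roots hz))
  rwa [hcard] at h2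

/-- A bound on the inverse of a matrix with entries in `[-2, 2]` whose eigenvalues have modulus at
least `lam`. -/
def invBound (m : ℕ) (lam : ℝ) : ℝ := m * (m * (m.factorial * 2 ^ m)) / lam ^ m

lemma invBound_nonneg (m : ℕ) {lam : ℝ} (hlam : 0 < lam) : 0 ≤ invBound m lam := by
  unfold invBound; positivity

lemma norm_le_sum_abs {m : ℕ} (x : EuclideanSpace ℝ (Fin m)) : ‖x‖ ≤ ∑ i, |x i| := by
  calc ‖x‖ = ‖∑ i, x i • EuclideanSpace.single i (1 : ℝ)‖ := by
        congr 1
        ext j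
        simp [Pi.single_apply]
    _ ≤ ∑ i, |x i| := by
        refine (norm_sum_le _ _).trans (Finset.sum_le_sum fun i _ => ?_)
        rw [norm_smul, Real.norm_eq_abs]
        simp

lemma abs_apply_le_norm {m : ℕ} (x : EuclideanSpace ℝ (Fin m)) (i : Fin m) : |x i| ≤ ‖x‖ :=
  PiLp.norm_apply_le x i

lemma norm_le_invBound_mul {m : ℕ} {lam : ℝ} (hlam : 0 < lam) (A : Matrix (Fin m) (Fin m) ℝ)
    (hA : ∀ i j, |A i j| ≤ 2) (h : lam ^ m ≤ |A.det|) (x : EuclideanSpace ℝ (Fin m)) :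
    ‖x‖ ≤ invBound m lam * ‖(WithLp.toLp 2 (A *ᵥ x.ofLp) : EuclideanSpace ℝ (Fin m))‖ := by
  set y : EuclideanSpace ℝ (Fin m) := WithLp.toLp 2 (A *ᵥ x.ofLp) with hy
  have hl : 0 < lam ^ m := by positivity
  have hadj : ∀ i j, |A.adjugate i j| ≤ m.factorial * 2 ^ m := by
    intro i j
    rw [Matrix.adjugate_apply]
    -- An entry of the adjugate is a determinant with entries of size at most 2, and the Leibniz
    -- formula has `m!` terms.
    have := Matrix.det_le (A := A.updateRow j (Pi.single i 1)) (abv := AbsoluteValue.abs) (x := 2)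
      (fun a b => by
        simp only [AbsoluteValue.abs_apply]
        by_cases ha : a = j
        · subst ha
          rw [Matrix.updateRow_self]
          by_cases hb : b = i
          · subst hb; simp
          · simp [hb]
        · rw [Matrix.updateRow_ne ha]; exact hA a b)
    simpa using this
  have hcomp : ∀ i, lam ^ m * |x i| ≤ m * (m.factorial * 2 ^ m) * ‖y‖ := by
    intro i
    have h1 : A.det * x i = ∑ j, A.adjugate i j * y j := by
      have h2 : A.adjugate *ᵥ (A *ᵥ x.ofLp) = A.det • x.ofLp := by
        rw [Matrix.mulVec_mulVec, Matrix.adjugate_mul, Matrix.smul_mulVec, Matrix.one_mulVec]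
      have := congrFun h2 i
      simp only [Pi.smul_apply, smul_eq_mul] at this
      rw [← this]
      rfl
    calc lam ^ m * |x i| ≤ |A.det| * |x i| := by gcongr
      _ = |∑ j, A.adjugate i j * y j| := by rw [← abs_mul, h1]
      _ ≤ ∑ j : Fin m, (m.factorial * 2 ^ m) * ‖y‖ := by
          refine (Finset.abs_sum_le_sum_abs _ _).trans (Finset.sum_le_sum fun j _ => ?_)
          rw [abs_mul]
          exact mul_le_mul (hadj i j) (abs_apply_le_norm y j) (abs_nonneg _) (by positivity)
      _ = _ := by simp; ring
  have hsum : lam ^ m * ‖x‖ ≤ m * (m * (m.factorial * 2 ^ m)) * ‖y‖ := by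
    calc lam ^ m * ‖x‖ ≤ lam ^ m * ∑ i, |x i| := by gcongr; exact norm_le_sum_abs x
      _ ≤ ∑ i : Fin m, (m * (m.factorial * 2 ^ m) * ‖y‖) := by
          rw [Finset.mul_sum]
          exact Finset.sum_le_sum fun i _ => hcomp i
      _ = _ := by simp; ring
  rw [invBound, div_mul_eq_mul_div, le_div_iff₀ hl, mul_comm]
  exact hsum

variable {S A : Type*} [Fintype S] [DecidableEq S] [Fintype A] {rmax : ℝ} {d m : ℕ}
  {M : MDP S A rmax} {pol : PolicyClass S A d} {φ : S → EuclideanSpace ℝ (Fin m)}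
  {B K L lam Rω : ℝ} [Nonempty S]

lemma abs_tdMatrix_le (hφ : ∀ s, ‖φ s‖ ≤ 1) (θ : EuclideanSpace ℝ (Fin d)) (i j : Fin m) :
    |tdMatrix M pol φ θ i j| ≤ 2 := by
  have h : tdMatrix M pol φ θ i j
      = statMean M pol θ (fun z => φ z.1 i * (φ z.1 j - φ z.2.2 j)) := by
    simp only [tdMatrix, statMean, jointLaw, Matrix.of_apply, Fintype.sum_prod_type, smul_eq_mul]
  rw [h]
  refine norm_statMean_le (E := ℝ) θ fun z => ?_
  have h1 := (abs_apply_le_norm (φ z.1) i).trans (hφ _)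
  have h2 := (abs_apply_le_norm (φ z.1) j).trans (hφ _)
  have h3 := (abs_apply_le_norm (φ z.2.2) j).trans (hφ _)
  rw [Real.norm_eq_abs, abs_mul]
  have h4 : |(φ z.1) j - (φ z.2.2) j| ≤ 2 := (abs_sub _ _).trans (by linarith)
  calc |(φ z.1) i| * |(φ z.1) j - (φ z.2.2) j| ≤ 1 * 2 :=
        mul_le_mul h1 h4 (abs_nonneg _) zero_le_one
    _ = 2 := one_mul _

lemma norm_le_invBound_mul_tdMap (hlam : 0 < lam) (hφ : ∀ s, ‖φ s‖ ≤ 1)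
    (hA : CriticPosDef M pol φ lam) (θ : EuclideanSpace ℝ (Fin d))
    (x : EuclideanSpace ℝ (Fin m)) : ‖x‖ ≤ invBound m lam * ‖tdMap M pol φ θ x‖ :=
  norm_le_invBound_mul hlam _ (abs_tdMatrix_le hφ θ) (pow_le_abs_det hlam.le _ (hA θ).2) x

lemma tdMap_criticTarget (hlam : 0 < lam) (hA : CriticPosDef M pol φ lam)
    (θ : EuclideanSpace ℝ (Fin d)) :
    tdMap M pol φ θ (criticTarget M pol φ θ) = tdVector M pol φ θ := by
  have hdet : IsUnit (tdMatrix M pol φ θ).det := by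
    rw [isUnit_iff_ne_zero]
    intro h0
    have := pow_le_abs_det hlam.le _ (hA θ).2
    rw [h0, abs_zero] at this
    exact absurd this (not_le.2 (by positivity))
  simp only [tdMap, criticTarget, Matrix.mulVec_mulVec, Matrix.mul_nonsing_inv _ hdet,
    Matrix.one_mulVec]

/-- The Dirichlet form controls the matrix `A_θ`. -/
lemma norm_tdMap_sq_le (hφ : ∀ s, ‖φ s‖ ≤ 1) (θ : EuclideanSpace ℝ (Fin d))
    (x : EuclideanSpace ℝ (Fin m)) :
    ‖tdMap M pol φ θ x‖ ^ 2 ≤ 2 * inner ℝ (tdMap M pol φ θ x) x := by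
  let v : S → ℝ := fun s => inner ℝ (φ s) x
  let D : S × A × S → ℝ := fun z => v z.1 - v z.2.2
  have hD : ∀ z : S × A × S, (inner ℝ (φ z.1 - φ z.2.2) x : ℝ) = D z := fun z => inner_sub_left _ _ _
  -- With `v(s) = ⟨φ(s), x⟩` and `D = v(s) - v(s')`, one has `D v(s) = D²/2 + (v(s)² - v(s')²)/2`,
  -- and the last term has stationary mean zero.
  have hinner : (inner ℝ (tdMap M pol φ θ x) x : ℝ)
      = 1 / 2 * statMean M pol θ (fun z => D z ^ 2) := by
    have h1 : (inner ℝ (tdMap M pol φ θ x) x : ℝ) = statMean M pol θ (fun z => D z * v z.1) := by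
      rw [tdMap_eq_statMean]
      simp only [statMean, sum_inner, inner_smul_left, conj_trivial, hD, smul_eq_mul]
      rfl
    have h2 : statMean M pol θ (fun z => v z.1 ^ 2) = statMean M pol θ (fun z => v z.2.2 ^ 2) := by
      rw [statMean_comp_fst θ (fun s => v s ^ 2), statMean_comp_last θ (fun s => v s ^ 2)]
    have h3 : statMean M pol θ (fun z => D z * v z.1)
        = statMean M pol θ (fun z => ((1 / 2 : ℝ) • D z ^ 2
          + (1 / 2 : ℝ) • (v z.1 ^ 2 - v z.2.2 ^ 2))) := by
      congr 1
      ext1 z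
      simp only [D, smul_eq_mul]; ring
    rw [h1, h3, statMean_add, statMean_smul, statMean_smul, statMean_sub, h2, sub_self]
    simp
  have hnorm : ‖tdMap M pol φ θ x‖ ≤ statMean M pol θ (fun z => |D z|) := by
    rw [tdMap_eq_statMean]
    refine (norm_sum_le _ _).trans (Finset.sum_le_sum fun z _ => ?_)
    rw [norm_smul, norm_smul, hD, Real.norm_eq_abs, Real.norm_eq_abs,
      abs_of_nonneg (jointLaw_nonneg θ z), smul_eq_mul]
    exact mul_le_mul_of_nonneg_left (mul_le_of_le_one_right (abs_nonneg _) (hφ _))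
      (jointLaw_nonneg θ z)
  set a := statMean M pol θ (fun z => |D z|) with ha
  -- The Cauchy–Schwarz inequality `(E|D|)² ≤ E D²`, as nonnegativity of a variance; `E|D|` bounds
  -- `‖A x‖` because the features have norm at most one.
  have hvar : 0 ≤ statMean M pol θ (fun z => (|D z| - a) ^ 2) :=
    Finset.sum_nonneg fun z _ => mul_nonneg (jointLaw_nonneg θ z) (sq_nonneg _)
  have hexp : statMean M pol θ (fun z => (|D z| - a) ^ 2)
      = statMean M pol θ (fun z => D z ^ 2) - a ^ 2 := by
    have : (fun z => (|D z| - a) ^ 2) = fun z => (D z ^ 2 - (2 * a) • |D z|) + a ^ 2 := by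
      ext1 z
      rw [sub_sq, sq_abs, smul_eq_mul]; ring
    rw [this, statMean_add, statMean_sub, statMean_smul, statMean_const, ← ha, smul_eq_mul]
    ring
  have : ‖tdMap M pol φ θ x‖ ^ 2 ≤ a ^ 2 := pow_le_pow_left₀ (norm_nonneg _) hnorm 2
  rw [hinner]
  linarith

/-- The coercivity constant of `A_θ`. -/
def coercConst (m : ℕ) (lam : ℝ) : ℝ := 1 / (2 * invBound m lam ^ 2 + 1)

lemma coercConst_pos (m : ℕ) (lam : ℝ) : 0 < coercConst m lam := by
  unfold coercConst; positivity

lemma coercConst_le_one (m : ℕ) (lam : ℝ) : coercConst m lam ≤ 1 := by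
  unfold coercConst
  rw [div_le_one (by positivity)]
  linarith [sq_nonneg (invBound m lam)]

lemma coercConst_mul_le_inner (hlam : 0 < lam) (hφ : ∀ s, ‖φ s‖ ≤ 1)
    (hA : CriticPosDef M pol φ lam) (θ : EuclideanSpace ℝ (Fin d))
    (x : EuclideanSpace ℝ (Fin m)) :
    coercConst m lam * ‖x‖ ^ 2 ≤ inner ℝ (tdMap M pol φ θ x) x := by
  have h1 := norm_le_invBound_mul_tdMap hlam hφ hA θ x
  have h2 := norm_tdMap_sq_le (M := M) (pol := pol) hφ θ x
  have h3 : ‖x‖ ^ 2 ≤ invBound m lam ^ 2 * ‖tdMap M pol φ θ x‖ ^ 2 := by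
    rw [← mul_pow]; exact pow_le_pow_left₀ (norm_nonneg _) h1 2
  have h4 : (0 : ℝ) ≤ inner ℝ (tdMap M pol φ θ x) x := by
    have := sq_nonneg ‖tdMap M pol φ θ x‖; linarith
  -- The chain `‖x‖² ≤ κ² ‖A x‖² ≤ 2 κ² ⟨A x, x⟩` with `κ = invBound m lam`. The extra 1 in the
  -- denominator keeps it positive when `κ = 0` and makes the constant at most 1.
  rw [coercConst, one_div_mul_eq_div, div_le_iff₀ (by positivity)]
  have h5 := mul_le_mul_of_nonneg_left h2 (sq_nonneg (invBound m lam))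
  nlinarith

/-- A Lipschitz constant of the TD(0) fixed point. -/
def criticLip (n m : ℕ) (B lam rmax Rω : ℝ) : ℝ :=
  invBound m lam * (lawLip n B * (2 * rmax + 2 * Rω))

/-- The critic direction evaluated at `(J(θ), ω*(θ))` has mean zero under `θ`. Under `θ'` its mean
is `A_θ' (ω*(θ') - ω*(θ))` up to the change of `J`. The change of the stationary law bounds this
mean, and inverting `A_θ'` bounds the displacement, with no need to differentiate `A_θ⁻¹`. -/
lemma norm_criticTarget_sub_le (hlam : 0 < lam) (hφ : ∀ s, ‖φ s‖ ≤ 1)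
    (hreg : pol.Regular B K L) (herg : Ergodic M pol) (hB : 0 ≤ B) (hr : 0 ≤ rmax)
    (hA : CriticPosDef M pol φ lam) (hR : ∀ θ, ‖criticTarget M pol φ θ‖ ≤ Rω)
    {θ θ' : EuclideanSpace ℝ (Fin d)} (hθ : ‖θ' - θ‖ ≤ 1) :
    ‖criticTarget M pol φ θ' - criticTarget M pol φ θ‖
      ≤ criticLip (Fintype.card S) m B lam rmax Rω * ‖θ' - θ‖ := by
  set w := criticTarget M pol φ θ
  set w' := criticTarget M pol φ θ'
  set J := avgReward M pol θ
  set J' := avgReward M pol θ'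
  have hR0 : 0 ≤ Rω := (norm_nonneg _).trans (hR θ)
  have h0 : statMean M pol θ (tdSample M φ J w) = 0 := by
    rw [statMean_tdSample, tdMap_criticTarget hlam hA, sub_self, sub_self, zero_smul, add_zero]
  have h0' : statMean M pol θ' (tdSample M φ J w)
      = tdMap M pol φ θ' (w' - w) + (J' - J) • statMean M pol θ' (fun z => φ z.1) := by
    rw [statMean_tdSample, tdMap_sub, tdMap_criticTarget hlam hA]
  have hD : ∀ s a, |M.r s a - J| ≤ rmax := fun s a => by
    rw [abs_le]
    constructor <;> linarith [M.r_nonneg s a, M.r_le s a, avgReward_nonneg (M := M) (pol := pol) θ,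
      avgReward_le (M := M) (pol := pol) θ]
  have h1 : ‖statMean M pol θ' (tdSample M φ J w)‖
      ≤ lawLip (Fintype.card S) B * ‖θ' - θ‖ * (rmax + 2 * Rω) := by
    have := norm_statMean_sub_le (M := M) hreg herg hB hθ (u := tdSample M φ J w)
      (U := rmax + 2 * Rω) (by positivity) fun z => (norm_tdSample_le hφ J w hD z).trans (by
        have := hR θ; linarith)
    rwa [h0, sub_zero] at this
  have h2 := abs_avgReward_sub_le (M := M) hreg herg hB hr hθ
  have h3 : ‖statMean M pol θ' (fun z => φ z.1)‖ ≤ 1 := norm_statMean_le θ' fun z => hφ _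
  have h4 : ‖tdMap M pol φ θ' (w' - w)‖
      ≤ lawLip (Fintype.card S) B * (2 * rmax + 2 * Rω) * ‖θ' - θ‖ := by
    have h5 : tdMap M pol φ θ' (w' - w) = statMean M pol θ' (tdSample M φ J w)
        - (J' - J) • statMean M pol θ' (fun z => φ z.1) := by rw [h0']; abel
    rw [h5]
    refine (norm_sub_le _ _).trans ?_
    rw [norm_smul, Real.norm_eq_abs]
    have h6 : |J' - J| * ‖statMean M pol θ' (fun z => φ z.1)‖
        ≤ lawLip (Fintype.card S) B * ‖θ' - θ‖ * rmax :=
      (mul_le_of_le_one_right (abs_nonneg _) h3).trans h2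
    linarith
  refine (norm_le_invBound_mul_tdMap hlam hφ hA θ' _).trans ?_
  rw [criticLip, mul_assoc]
  exact mul_le_mul_of_nonneg_left h4 (invBound_nonneg m hlam)

end CriticLemmas

/-! ### Means over trajectories with a fixed policy; bias and second moment of multi-level
estimates. -/

noncomputable section PathLemmas

/-- Prepend an element to a sequence. -/
def consSeq {α : Type*} (a : α) (x : ℕ → α) : ℕ → α
  | 0 => a
  | n + 1 => x n

variable {S A : Type*} [Fintype S] [DecidableEq S] [Fintype A] {rmax : ℝ} {d : ℕ}
  {M : MDP S A rmax} {pol : PolicyClass S A d} {θ : EuclideanSpace ℝ (Fin d)}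
  {E F : Type*} [NormedAddCommGroup E] [NormedSpace ℝ E] [NormedAddCommGroup F] [NormedSpace ℝ F]

lemma stepMean_add (u v : S × A × S → E) (s : S) :
    stepMean M pol θ (fun z => u z + v z) s = stepMean M pol θ u s + stepMean M pol θ v s := by
  simp only [stepMean, smul_add, Finset.sum_add_distrib]

lemma stepMean_clm (T : E →L[ℝ] F) (u : S × A × S → E) (s : S) :
    stepMean M pol θ (fun z => T (u z)) s = T (stepMean M pol θ u s) := by
  simp only [stepMean, map_sum, map_smul]

lemma stepMean_const (c : E) (s : S) : stepMean M pol θ (fun _ => c) s = c :=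
  stepMean_comp_fst θ (fun _ => c) s

lemma stepMean_mono {u v : S × A × S → ℝ} (h : ∀ z, u z ≤ v z) (s : S) :
    stepMean M pol θ u s ≤ stepMean M pol θ v s :=
  Finset.sum_le_sum fun a _ => Finset.sum_le_sum fun s' _ =>
    mul_le_mul_of_nonneg_left (h _) (mul_nonneg (pol.π_pos θ s a).le (M.p_nonneg s a s'))

variable [Nonempty S] [Nonempty A]

/-- The mean of a function of the first `N` transitions of a trajectory started at `s`. -/
def pathMean (M : MDP S A rmax) (pol : PolicyClass S A d) (θ : EuclideanSpace ℝ (Fin d)) :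
    ℕ → S → ((ℕ → S × A × S) → E) → E
  | 0, _, Ψ => Ψ fun _ => Classical.arbitrary _
  | N + 1, s, Ψ => stepMean M pol θ (fun z => pathMean M pol θ N z.2.2 fun ζ => Ψ (consSeq z ζ)) s

lemma pathMean_const (N : ℕ) (s : S) (c : E) : pathMean M pol θ N s (fun _ => c) = c := by
  induction N generalizing s with
  | zero => rfl
  | succ N ih => simp only [pathMean, ih, stepMean_const]

lemma pathMean_add (N : ℕ) (s : S) (Ψ Φ : (ℕ → S × A × S) → E) :
    pathMean M pol θ N s (fun ζ => Ψ ζ + Φ ζ) = pathMean M pol θ N s Ψ + pathMean M pol θ N s Φ := by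
  induction N generalizing s Ψ Φ with
  | zero => rfl
  | succ N ih => simp only [pathMean, ih, stepMean_add]

lemma pathMean_clm (T : E →L[ℝ] F) (N : ℕ) (s : S) (Ψ : (ℕ → S × A × S) → E) :
    pathMean M pol θ N s (fun ζ => T (Ψ ζ)) = T (pathMean M pol θ N s Ψ) := by
  induction N generalizing s Ψ with
  | zero => rfl
  | succ N ih => simp only [pathMean, ih, stepMean_clm]

lemma pathMean_smul (c : ℝ) (N : ℕ) (s : S) (Ψ : (ℕ → S × A × S) → E) :
    pathMean M pol θ N s (fun ζ => c • Ψ ζ) = c • pathMean M pol θ N s Ψ :=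
  pathMean_clm (c • ContinuousLinearMap.id ℝ E) N s Ψ

lemma pathMean_sub (N : ℕ) (s : S) (Ψ Φ : (ℕ → S × A × S) → E) :
    pathMean M pol θ N s (fun ζ => Ψ ζ - Φ ζ) = pathMean M pol θ N s Ψ - pathMean M pol θ N s Φ := by
  have := pathMean_add (M := M) (pol := pol) (θ := θ) N s Ψ (fun ζ => (-1 : ℝ) • Φ ζ)
  rw [pathMean_smul, neg_one_smul] at this
  simpa only [neg_one_smul, ← sub_eq_add_neg] using this

lemma pathMean_sum (N : ℕ) (s : S) (I : Finset ℕ) (Ψ : ℕ → (ℕ → S × A × S) → E) :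
    pathMean M pol θ N s (fun ζ => ∑ i ∈ I, Ψ i ζ) = ∑ i ∈ I, pathMean M pol θ N s (Ψ i) := by
  induction I using Finset.induction_on with
  | empty => simp only [Finset.sum_empty, pathMean_const]
  | insert i I hi ih => simp only [Finset.sum_insert hi, pathMean_add, ih]

lemma pathMean_mono (N : ℕ) (s : S) {Ψ Φ : (ℕ → S × A × S) → ℝ} (h : ∀ ζ, Ψ ζ ≤ Φ ζ) :
    pathMean M pol θ N s Ψ ≤ pathMean M pol θ N s Φ := by
  induction N generalizing s Ψ Φ with
  | zero => exact h _
  | succ N ih => exact stepMean_mono (fun z => ih _ fun ζ => h _) s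

/-- The Markov property: the `i`-th sample is averaged first over its own transition, then over `i`
steps of the state chain. Later transitions integrate out. -/
lemma pathMean_apply (u : S × A × S → E) {i N : ℕ} (hi : i < N) (s : S) :
    pathMean M pol θ N s (fun ζ => u (ζ i))
      = transOp (kernel M pol θ ^ i) (stepMean M pol θ u) s := by
  induction i generalizing N s with
  | zero =>
    obtain ⟨N, rfl⟩ := Nat.exists_eq_add_of_lt hi
    rw [zero_add, pow_zero, transOp_one]
    simp only [pathMean, consSeq, pathMean_const]
  | succ i ih =>
    obtain ⟨N, rfl⟩ := Nat.exists_eq_succ_of_ne_zero (Nat.ne_zero_of_lt hi)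
    rw [pow_succ', ← transOp_transOp]
    simp only [pathMean, consSeq]
    simp_rw [ih (Nat.succ_lt_succ_iff.1 hi)]
    exact stepMean_comp_last θ _ s

/-- The expected sum of the first `k` samples. -/
def sumMean (M : MDP S A rmax) (pol : PolicyClass S A d) (θ : EuclideanSpace ℝ (Fin d))
    (u : S × A × S → E) (k : ℕ) (s : S) : E :=
  ∑ i ∈ Finset.range k, transOp (kernel M pol θ ^ i) (stepMean M pol θ u) s

lemma pathMean_sum_range (u : S × A × S → E) {k N : ℕ} (hk : k ≤ N) (s : S) :
    pathMean M pol θ N s (fun ζ => ∑ i ∈ Finset.range k, u (ζ i)) = sumMean M pol θ u k s := by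
  rw [pathMean_sum, sumMean]
  exact Finset.sum_congr rfl fun i hi =>
    pathMean_apply u ((Finset.mem_range.1 hi).trans_le hk) s

lemma norm_sumMean_le (herg : Ergodic M pol) {u : S × A × S → E} {U : ℝ} (hu : ∀ z, ‖u z‖ ≤ U)
    (hcent : statMean M pol θ u = 0) (k : ℕ) (s : S) :
    ‖sumMean M pol θ u k s‖ ≤ 2 * mixingTime (kernel M pol θ) * U := by
  obtain ⟨n, hn⟩ := herg θ
  refine (norm_sum_le _ _).trans ?_
  refine sum_norm_transOp_pow_le (kernel_mem_rowStochastic M pol θ) hn s k _ U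
    (norm_stepMean_le θ hu) ?_
  rw [← statMean_eq_sum_stepMean, hcent]

/-- The trivial bound, with no centring. Its product with the mixing bound makes the squared bias
linear in the mixing time. -/
lemma norm_sumMean_le' {u : S × A × S → E} {U : ℝ} (hu : ∀ z, ‖u z‖ ≤ U) (k : ℕ) (s : S) :
    ‖sumMean M pol θ u k s‖ ≤ k * U := by
  calc ‖sumMean M pol θ u k s‖ ≤ ∑ _i ∈ Finset.range k, U :=
        (norm_sum_le _ _).trans (Finset.sum_le_sum fun i _ =>
          norm_transOp_le (pow_mem (kernel_mem_rowStochastic M pol θ) i) (norm_stepMean_le θ hu) s)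
    _ = k * U := by simp

lemma one_le_mixingTime (herg : Ergodic M pol) (θ : EuclideanSpace ℝ (Fin d)) :
    1 ≤ mixingTime (kernel M pol θ) := by
  obtain ⟨n, hn⟩ := herg θ
  exact (mixingTime_spec (kernel_mem_rowStochastic M pol θ) hn).1

section Inner

variable {H : Type*} [NormedAddCommGroup H] [InnerProductSpace ℝ H]

/-- The second moment of a sum of centred samples is of the order of the mixing time times the
number of samples. -/
lemma pathMean_norm_sum_sq_le (herg : Ergodic M pol) {u : S × A × S → H} {U : ℝ}
    (hu : ∀ z, ‖u z‖ ≤ U) (hcent : statMean M pol θ u = 0) {k N : ℕ} (hk : k ≤ N) (s : S) :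
    pathMean M pol θ N s (fun ζ => ‖∑ i ∈ Finset.range k, u (ζ i)‖ ^ 2)
      ≤ k * (5 * mixingTime (kernel M pol θ) * U ^ 2) := by
  have hτ : (1 : ℝ) ≤ mixingTime (kernel M pol θ) := by exact_mod_cast one_le_mixingTime herg θ
  set τ : ℝ := (mixingTime (kernel M pol θ) : ℝ) with hτdef
  induction k generalizing N s with
  | zero => simp [pathMean_const]
  | succ k ih =>
    obtain ⟨N, rfl⟩ := Nat.exists_eq_succ_of_ne_zero (Nat.ne_zero_of_lt hk)
    have hkN : k ≤ N := Nat.succ_le_succ_iff.1 hk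
    have hz : ∀ z : S × A × S, pathMean M pol θ N z.2.2
        (fun ζ => ‖∑ i ∈ Finset.range (k + 1), u (consSeq z ζ i)‖ ^ 2)
        ≤ (k + 1 : ℕ) * (5 * τ * U ^ 2) := by
      intro z
      have hU : 0 ≤ U := (norm_nonneg _).trans (hu z)
      -- The square is expanded around the first sample. Given that sample, the cross term is an
      -- inner product with a conditional mean of norm at most `2 τ U`, so each added sample costs
      -- at most `U² + 4 τ U² ≤ 5 τ U²`.
      have h1 : (fun ζ : ℕ → S × A × S => ‖∑ i ∈ Finset.range (k + 1), u (consSeq z ζ i)‖ ^ 2)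
          = fun ζ => (‖u z‖ ^ 2 + (2 : ℝ) • innerSL ℝ (u z) (∑ i ∈ Finset.range k, u (ζ i)))
            + ‖∑ i ∈ Finset.range k, u (ζ i)‖ ^ 2 := by
        ext1 ζ
        rw [Finset.sum_range_succ', add_comm]
        simp only [consSeq]
        rw [norm_add_sq_real, innerSL_apply_apply, smul_eq_mul]
      rw [h1, pathMean_add, pathMean_add, pathMean_const, pathMean_smul, pathMean_clm,
        pathMean_sum_range u hkN]
      have h2 : innerSL ℝ (u z) (sumMean M pol θ u k z.2.2) ≤ U * (2 * τ * U) := by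
        rw [innerSL_apply_apply]
        refine (real_inner_le_norm _ _).trans ?_
        exact mul_le_mul (hu z) (norm_sumMean_le herg hu hcent k _) (norm_nonneg _) hU
      have h3 : ‖u z‖ ^ 2 ≤ U ^ 2 := pow_le_pow_left₀ (norm_nonneg _) (hu z) 2
      have h4 := ih hkN z.2.2
      have h5 : U ^ 2 ≤ τ * U ^ 2 := le_mul_of_one_le_left (sq_nonneg U) hτ
      rw [smul_eq_mul]
      push_cast
      nlinarith
    calc _ ≤ stepMean M pol θ (fun _ => ((k + 1 : ℕ) : ℝ) * (5 * τ * U ^ 2)) s :=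
          stepMean_mono hz s
      _ = _ := stepMean_const _ s

end Inner

/-! ### Multi-level Monte Carlo estimates -/

lemma mlmc_eq_of_not_le {V : Type*} [AddCommGroup V] [Module ℝ V] {Tmax j : ℕ} (h : ¬ 2 ^ j ≤ Tmax)
    (l : ℕ → V) : mlmc Tmax j l = l 0 := by
  simp [mlmc, h, levelAvg]

lemma mlmc_zero {V : Type*} [AddCommGroup V] [Module ℝ V] (Tmax : ℕ) (l : ℕ → V) :
    mlmc Tmax 0 l = l 0 := by
  simp [mlmc, levelAvg]

lemma mlmc_eq_sum {V : Type*} [AddCommGroup V] [Module ℝ V] {Tmax j : ℕ} (h : 2 ^ j ≤ Tmax)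
    (hj : 1 ≤ j) (l : ℕ → V) :
    mlmc Tmax j l = l 0 + (∑ i ∈ Finset.range (2 ^ j), l i
      - (2 : ℝ) • ∑ i ∈ Finset.range (2 ^ (j - 1)), l i) := by
  obtain ⟨j, rfl⟩ := Nat.exists_eq_add_of_le' hj
  have h2 : (2 : ℝ) ^ (j + 1) * (2 ^ j)⁻¹ = 2 := by
    rw [pow_succ, mul_comm, ← mul_assoc, inv_mul_cancel₀ (by positivity), one_mul]
  simp only [mlmc, h, if_true, levelAvg, smul_sub, smul_smul, Nat.add_sub_cancel, h2]
  rw [mul_inv_cancel₀ (by positivity)]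
  simp

lemma mlmc_congr {V : Type*} [AddCommGroup V] [Module ℝ V] {Tmax j : ℕ} {l l' : ℕ → V}
    (h : ∀ i < 2 ^ j, l i = l' i) : mlmc Tmax j l = mlmc Tmax j l' := by
  have h1 : ∀ k ≤ j, levelAvg l k = levelAvg l' k := by
    intro k hk
    simp only [levelAvg]
    congr 1
    refine Finset.sum_congr rfl fun i hi => h i ?_
    exact (Finset.mem_range.1 hi).trans_le (Nat.pow_le_pow_right two_pos hk)
  simp only [mlmc, h1 0 (Nat.zero_le j), h1 j le_rfl, h1 (j - 1) (Nat.sub_le j 1)]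

lemma levelAvg_const_add {V : Type*} [AddCommGroup V] [Module ℝ V] (c : V) (l : ℕ → V) (j : ℕ) :
    levelAvg (fun i => c + l i) j = c + levelAvg l j := by
  simp only [levelAvg, Finset.sum_add_distrib, smul_add, Finset.sum_const, Finset.card_range]
  rw [← Nat.cast_smul_eq_nsmul ℝ, smul_smul]
  push_cast
  rw [inv_mul_cancel₀ (by positivity), one_smul]

lemma mlmc_const_add {V : Type*} [AddCommGroup V] [Module ℝ V] (Tmax j : ℕ) (c : V) (l : ℕ → V) :
    mlmc Tmax j (fun i => c + l i) = c + mlmc Tmax j l := by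
  simp only [mlmc, levelAvg_const_add, add_sub_add_left_eq_sub]
  rw [add_assoc]

lemma levelAvg_neg {V : Type*} [AddCommGroup V] [Module ℝ V] (l : ℕ → V) (j : ℕ) :
    levelAvg (fun i => -l i) j = -levelAvg l j := by
  simp only [levelAvg, Finset.sum_neg_distrib, smul_neg]

lemma mlmc_neg {V : Type*} [AddCommGroup V] [Module ℝ V] (Tmax j : ℕ) (l : ℕ → V) :
    mlmc Tmax j (fun i => -l i) = -mlmc Tmax j l := by
  simp only [mlmc, levelAvg_neg]
  split_ifs
  · module
  · simp

/-- The conditional mean of a function of one round: `Ψ j` is its value at level `j`, where the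
levels above `J` share the value `Ψ 0`, which depends on the first transition only. -/
def roundMean (M : MDP S A rmax) (pol : PolicyClass S A d) (θ : EuclideanSpace ℝ (Fin d))
    (J : ℕ) (s : S) (Ψ : ℕ → (ℕ → S × A × S) → E) : E :=
  ∑ j ∈ Finset.Icc 1 J, (1 / 2 : ℝ) ^ j • pathMean M pol θ (2 ^ j) s (Ψ j)
    + (1 / 2 : ℝ) ^ J • pathMean M pol θ 1 s (Ψ 0)

lemma sum_half_pow_add (J : ℕ) :
    ∑ j ∈ Finset.Icc 1 J, (1 / 2 : ℝ) ^ j + (1 / 2 : ℝ) ^ J = 1 := by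
  induction J with
  | zero => simp
  | succ J ih => rw [Finset.sum_Icc_succ_top (by omega)]; rw [pow_succ] at *; linarith

/-- The probability of level `j` cancels the factor `2^j`, so the corrections telescope from the
one-sample mean to the mean of the longest admissible average. The induction is on the truncation
level. -/
lemma roundMean_mlmc {Tmax : ℕ} (hT : Tmax ≠ 0) (u : S × A × S → E) (s : S) :
    roundMean M pol θ (Nat.log 2 Tmax) s (fun j ζ => mlmc Tmax j fun i => u (ζ i))
      = ((2 : ℝ) ^ Nat.log 2 Tmax)⁻¹ • sumMean M pol θ u (2 ^ Nat.log 2 Tmax) s := by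
  let μ : ℕ → E := fun j => ((2 : ℝ) ^ j)⁻¹ • sumMean M pol θ u (2 ^ j) s
  have hμ0 : μ 0 = stepMean M pol θ u s := by simp [μ, sumMean, transOp_one]
  have key : ∀ J ≤ Nat.log 2 Tmax,
      roundMean M pol θ J s (fun j ζ => mlmc Tmax j fun i => u (ζ i)) = μ J := by
    intro J
    induction J with
    | zero =>
      intro _
      simp only [roundMean, mlmc_zero]
      rw [pathMean_apply u one_pos, pow_zero, pow_zero, transOp_one, hμ0]
      simp
    | succ J ih =>
      intro hJ
      have hle : 2 ^ (J + 1) ≤ Tmax := Nat.pow_le_of_le_log hT hJ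
      have h1 := ih (by omega)
      have hp : pathMean M pol θ (2 ^ (J + 1)) s (fun ζ => mlmc Tmax (J + 1) fun i => u (ζ i))
          = μ 0 + (2 : ℝ) ^ (J + 1) • (μ (J + 1) - μ J) := by
        simp only [mlmc_eq_sum hle (by omega : 1 ≤ J + 1), Nat.add_sub_cancel]
        rw [pathMean_add, pathMean_sub, pathMean_smul, pathMean_apply u (by positivity),
          pathMean_sum_range u le_rfl,
          pathMean_sum_range u (Nat.pow_le_pow_right two_pos (Nat.le_succ J)), pow_zero,
          transOp_one, hμ0]
        have h2 : (2 : ℝ) ^ (J + 1) * (2 ^ J)⁻¹ = 2 := by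
          rw [pow_succ, mul_comm, ← mul_assoc, inv_mul_cancel₀ (by positivity), one_mul]
        simp only [μ, smul_sub, smul_smul, h2]
        rw [mul_inv_cancel₀ (by positivity), one_smul]
      have h0 : pathMean M pol θ 1 s (fun ζ => mlmc Tmax 0 fun i => u (ζ i)) = μ 0 := by
        simp only [mlmc_zero]
        rw [pathMean_apply u one_pos, pow_zero, transOp_one, hμ0]
      rw [roundMean, h0] at h1
      rw [roundMean, Finset.sum_Icc_succ_top (by omega), hp, h0]
      have h3 : (1 / 2 : ℝ) ^ (J + 1) * 2 ^ (J + 1) = 1 := by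
        rw [← mul_pow]; norm_num
      rw [smul_add, smul_smul ((1 / 2 : ℝ) ^ (J + 1)) ((2 : ℝ) ^ (J + 1)), h3, one_smul]
      have h4 : (1 / 2 : ℝ) ^ (J + 1) = (1 / 2) ^ J * (1 / 2) := pow_succ _ _
      rw [h4]
      -- The tail mass beyond `J` splits equally between level `J + 1` and the new tail; both
      -- contain the one-sample term.
      have h5 : ((1 / 2 : ℝ) ^ J * (1 / 2)) • μ 0 + ((1 / 2 : ℝ) ^ J * (1 / 2)) • μ 0
          = (1 / 2 : ℝ) ^ J • μ 0 := by rw [← add_smul]; congr 1; ring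
      rw [← h5] at h1
      set a := ∑ j ∈ Finset.Icc 1 J, (1 / 2 : ℝ) ^ j •
        pathMean M pol θ (2 ^ j) s (fun ζ => mlmc Tmax j fun i => u (ζ i))
      set b := ((1 / 2 : ℝ) ^ J * (1 / 2)) • μ 0
      calc a + (b + (μ (J + 1) - μ J)) + b = (a + (b + b)) + (μ (J + 1) - μ J) := by abel
        _ = μ (J + 1) := by rw [h1]; abel
  exact key _ le_rfl

lemma lt_two_mul_pow_log (Tmax : ℕ) : (Tmax : ℝ) ≤ 2 * 2 ^ Nat.log 2 Tmax := by
  have := Nat.lt_pow_succ_log_self (b := 2) one_lt_two Tmax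
  rw [pow_succ, mul_comm] at this
  exact_mod_cast this.le

/-- The squared bias of a multi-level Monte Carlo estimate. -/
lemma norm_roundMean_mlmc_sq_le (herg : Ergodic M pol) {u : S × A × S → E} {U : ℝ}
    (hu : ∀ z, ‖u z‖ ≤ U) (hcent : statMean M pol θ u = 0) {Tmax : ℕ} (hT : Tmax ≠ 0) (s : S) :
    ‖roundMean M pol θ (Nat.log 2 Tmax) s (fun j ζ => mlmc Tmax j fun i => u (ζ i))‖ ^ 2
      ≤ 4 * U ^ 2 * (mixingTime (kernel M pol θ) / Tmax) := by
  rw [roundMean_mlmc hT, norm_smul, Real.norm_eq_abs, abs_of_pos (by positivity)]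
  set N : ℝ := 2 ^ Nat.log 2 Tmax with hN
  have hNpos : 0 < N := by positivity
  set x := ‖sumMean M pol θ u (2 ^ Nat.log 2 Tmax) s‖
  have hx0 : 0 ≤ x := norm_nonneg _
  have h1 : x ≤ 2 * mixingTime (kernel M pol θ) * U := norm_sumMean_le herg hu hcent _ s
  have h2 : x ≤ N * U := by
    have := norm_sumMean_le' (M := M) (pol := pol) (θ := θ) hu (2 ^ Nat.log 2 Tmax) s
    push_cast at this
    exact this
  have hTpos : (0 : ℝ) < Tmax := by exact_mod_cast Nat.pos_of_ne_zero hT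
  have h3 : (Tmax : ℝ) ≤ 2 * N := lt_two_mul_pow_log Tmax
  set τ : ℝ := (mixingTime (kernel M pol θ) : ℝ)
  have hτ0 : 0 ≤ τ := Nat.cast_nonneg _
  -- One factor is bounded by mixing and the other trivially, which leaves a single power of the
  -- mixing time. The bound `Tmax ≤ 2 N` then replaces `N` by `Tmax`.
  have h4 : x ^ 2 ≤ (2 * τ * U) * (N * U) := by
    rw [sq]; exact mul_le_mul h1 h2 hx0 (hx0.trans h1)
  calc (N⁻¹ * x) ^ 2 = x ^ 2 / N ^ 2 := by rw [mul_pow, inv_pow]; field_simp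
    _ ≤ (2 * τ * U) * (N * U) / N ^ 2 := by gcongr
    _ = 2 * U ^ 2 * (τ / N) := by field_simp
    _ ≤ 2 * U ^ 2 * (2 * τ / Tmax) := by
        refine mul_le_mul_of_nonneg_left ?_ (by positivity)
        rw [div_le_div_iff₀ hNpos hTpos]
        nlinarith
    _ = _ := by ring

/-- The second moment of a multi-level Monte Carlo estimate. -/
lemma roundMean_norm_mlmc_sq_le {H : Type*} [NormedAddCommGroup H] [InnerProductSpace ℝ H]
    (herg : Ergodic M pol) {u : S × A × S → H} {U : ℝ}
    (hu : ∀ z, ‖u z‖ ≤ U) (hcent : statMean M pol θ u = 0) {Tmax : ℕ} (hT : 2 ≤ Tmax) (s : S) :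
    roundMean M pol θ (Nat.log 2 Tmax) s (fun j ζ => ‖mlmc Tmax j fun i => u (ζ i)‖ ^ 2)
      ≤ 62 * (mixingTime (kernel M pol θ) * Nat.log 2 Tmax) * U ^ 2 := by
  have hτ : (1 : ℝ) ≤ mixingTime (kernel M pol θ) := by exact_mod_cast one_le_mixingTime herg θ
  have hJ : 1 ≤ Nat.log 2 Tmax := Nat.log_pos one_lt_two hT
  set τ : ℝ := (mixingTime (kernel M pol θ) : ℝ) with hτdef
  set J := Nat.log 2 Tmax with hJdef
  have hsq : ∀ z, ‖u z‖ ^ 2 ≤ U ^ 2 := fun z => pow_le_pow_left₀ (norm_nonneg _) (hu z) 2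
  have h1 : ∀ j ∈ Finset.Icc 1 J, pathMean M pol θ (2 ^ j) s
      (fun ζ => ‖mlmc Tmax j fun i => u (ζ i)‖ ^ 2) ≤ 2 * U ^ 2 + 2 ^ j * (60 * τ * U ^ 2) := by
    intro j hj
    obtain ⟨hj1, hjJ⟩ := Finset.mem_Icc.1 hj
    have hle : 2 ^ j ≤ Tmax := Nat.pow_le_of_le_log (by omega) hjJ
    -- With coefficients 4 and 16 the two sums contribute `4 * 5 * 2^j + 16 * 5 * 2^(j-1) = 60 *
    -- 2^j` times `τ U²`.
    have hpt : ∀ ζ : ℕ → S × A × S, ‖mlmc Tmax j fun i => u (ζ i)‖ ^ 2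
        ≤ (2 * U ^ 2 + (4 : ℝ) • ‖∑ i ∈ Finset.range (2 ^ j), u (ζ i)‖ ^ 2)
          + (16 : ℝ) • ‖∑ i ∈ Finset.range (2 ^ (j - 1)), u (ζ i)‖ ^ 2 := by
      intro ζ
      rw [mlmc_eq_sum hle hj1]
      set a := u (ζ 0)
      set b := ∑ i ∈ Finset.range (2 ^ j), u (ζ i)
      set c := ∑ i ∈ Finset.range (2 ^ (j - 1)), u (ζ i)
      have h2 : ‖a + (b - (2 : ℝ) • c)‖ ≤ ‖a‖ + (‖b‖ + 2 * ‖c‖) := by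
        refine (norm_add_le _ _).trans (add_le_add le_rfl ((norm_sub_le _ _).trans ?_))
        rw [norm_smul]; norm_num
      have h3 : ‖a + (b - (2 : ℝ) • c)‖ ^ 2 ≤ (‖a‖ + (‖b‖ + 2 * ‖c‖)) ^ 2 :=
        pow_le_pow_left₀ (norm_nonneg _) h2 2
      have h4 : ‖a‖ ^ 2 ≤ U ^ 2 := hsq _
      simp only [smul_eq_mul]
      nlinarith [sq_nonneg (‖a‖ - (‖b‖ + 2 * ‖c‖)), sq_nonneg (‖b‖ - 2 * ‖c‖)]
    refine (pathMean_mono _ s hpt).trans ?_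
    rw [pathMean_add, pathMean_add, pathMean_const, pathMean_smul, pathMean_smul, smul_eq_mul,
      smul_eq_mul]
    have h5 := pathMean_norm_sum_sq_le herg hu hcent (le_refl (2 ^ j)) s
    have h6 := pathMean_norm_sum_sq_le herg hu hcent
      (Nat.pow_le_pow_right two_pos (Nat.sub_le j 1) : 2 ^ (j - 1) ≤ 2 ^ j) s
    have h7 : (2 : ℝ) ^ j = 2 * 2 ^ (j - 1) := by
      rw [← pow_succ']; congr 1; omega
    push_cast at h5 h6
    rw [← hτdef] at h5 h6
    rw [h7] at h5 ⊢
    have h8 : 0 ≤ (2 : ℝ) ^ (j - 1) * (5 * τ * U ^ 2) := by positivity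
    nlinarith
  have h0 : pathMean M pol θ 1 s (fun ζ => ‖mlmc Tmax 0 fun i => u (ζ i)‖ ^ 2) ≤ 2 * U ^ 2 := by
    simp only [mlmc_zero]
    calc _ ≤ pathMean M pol θ 1 s (fun _ => 2 * U ^ 2) := pathMean_mono _ s fun ζ => by
          have := hsq (ζ 0); linarith [sq_nonneg U]
      _ = _ := pathMean_const _ s _
  have h2 : roundMean M pol θ J s (fun j ζ => ‖mlmc Tmax j fun i => u (ζ i)‖ ^ 2)
      ≤ ∑ j ∈ Finset.Icc 1 J, ((1 / 2 : ℝ) ^ j * (2 * U ^ 2) + 60 * τ * U ^ 2)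
        + (1 / 2 : ℝ) ^ J * (2 * U ^ 2) := by
    refine add_le_add (Finset.sum_le_sum fun j hj => ?_) ?_
    · have h3 : (1 / 2 : ℝ) ^ j * 2 ^ j = 1 := by rw [← mul_pow]; norm_num
      rw [smul_eq_mul]
      calc _ ≤ (1 / 2 : ℝ) ^ j * (2 * U ^ 2 + 2 ^ j * (60 * τ * U ^ 2)) :=
            mul_le_mul_of_nonneg_left (h1 j hj) (by positivity)
        _ = (1 / 2 : ℝ) ^ j * (2 * U ^ 2) + ((1 / 2 : ℝ) ^ j * 2 ^ j) * (60 * τ * U ^ 2) := by ring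
        _ = _ := by rw [h3, one_mul]
    · rw [smul_eq_mul]
      exact mul_le_mul_of_nonneg_left h0 (by positivity)
  refine h2.trans ?_
  -- After weighting by `2^{-j}` each level contributes `60 τ U²`, and the first samples together `2
  -- U²`. With `τ` and the number of levels at least 1, the total constant is 62.
  rw [Finset.sum_add_distrib, ← Finset.sum_mul, add_right_comm, ← add_mul, sum_half_pow_add,
    Finset.sum_const, Nat.card_Icc, nsmul_eq_mul, Nat.add_sub_cancel]
  have hJ' : (1 : ℝ) ≤ J := by exact_mod_cast hJ
  have h9 : U ^ 2 ≤ (τ * J) * U ^ 2 :=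
    le_mul_of_one_le_left (sq_nonneg U) (one_le_mul_of_one_le_of_one_le hτ hJ')
  nlinarith

end PathLemmas

/-! ### Random quantities with finitely many values, for which conditioning reduces to finite sums
over fibres. -/

noncomputable section FiniteRange

/-- A function with finitely many values and measurable fibres. -/
structure FinMeas {Ω α : Type*} (m : MeasurableSpace Ω) (f : Ω → α) : Prop where
  finite : (Set.range f).Finite
  fiber : ∀ v, MeasurableSet[m] (f ⁻¹' {v})

variable {Ω α β γ : Type*} {m m' : MeasurableSpace Ω}

/-- A finite union of fibres is measurable, so `g` is arbitrary. Average reward, critic target and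
mixing time can thus be composed with the iterates without any measurability in `θ`. -/
lemma FinMeas.comp {f : Ω → α} (hf : FinMeas m f) (g : α → β) : FinMeas m fun w => g (f w) := by
  refine ⟨(hf.finite.image g).subset ?_, fun v => ?_⟩
  · rintro _ ⟨w, rfl⟩
    exact ⟨f w, ⟨w, rfl⟩, rfl⟩
  · have : (fun w => g (f w)) ⁻¹' {v} = ⋃ u ∈ Set.range f ∩ g ⁻¹' {v}, f ⁻¹' {u} := by
      ext w
      simp
    rw [this]
    exact (hf.finite.inter_of_left _).measurableSet_biUnion fun u _ => hf.fiber u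

lemma FinMeas.prodMk {f : Ω → α} {g : Ω → β} (hf : FinMeas m f) (hg : FinMeas m g) :
    FinMeas m fun w => (f w, g w) := by
  refine ⟨(hf.finite.prod hg.finite).subset ?_, fun v => ?_⟩
  · rintro _ ⟨w, rfl⟩
    exact ⟨⟨w, rfl⟩, ⟨w, rfl⟩⟩
  · have : (fun w => (f w, g w)) ⁻¹' {v} = f ⁻¹' {v.1} ∩ g ⁻¹' {v.2} := by
      ext w
      simp [Prod.ext_iff]
    rw [this]
    exact (hf.fiber _).inter (hg.fiber _)

lemma FinMeas.comp₂ {f : Ω → α} {g : Ω → β} (hf : FinMeas m f) (hg : FinMeas m g)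
    (F : α → β → γ) : FinMeas m fun w => F (f w) (g w) :=
  (hf.prodMk hg).comp fun p => F p.1 p.2

lemma finMeas_const (c : α) : FinMeas m fun _ : Ω => c :=
  ⟨(Set.finite_singleton c).subset (by rintro _ ⟨w, rfl⟩; rfl), fun v => by
    by_cases h : c = v <;> simp [h]⟩

lemma FinMeas.mono {f : Ω → α} (hf : FinMeas m f) (h : m ≤ m') : FinMeas m' f :=
  ⟨hf.finite, fun v => h _ (hf.fiber v)⟩

lemma FinMeas.sum {ι : Type*} {V : Type*} [AddCommMonoid V] {I : Finset ι} {f : ι → Ω → V}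
    (hf : ∀ i ∈ I, FinMeas m (f i)) : FinMeas m fun w => ∑ i ∈ I, f i w := by
  classical
  induction I using Finset.induction_on with
  | empty => simpa using finMeas_const (m := m) (0 : V)
  | insert i I hi ih =>
    simp only [Finset.sum_insert hi]
    exact (hf i (Finset.mem_insert_self _ _)).comp₂
      (ih fun k hk => hf k (Finset.mem_insert_of_mem hk)) (· + ·)

/-- The level is unbounded, but once `2^j > Tmax` the estimate is the first sample; only levels `j ≤
2^j ≤ Tmax` produce other values. -/
lemma FinMeas.mlmc {V : Type*} [AddCommGroup V] [Module ℝ V] {lev : Ω → ℕ}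
    (hlev : ∀ j, MeasurableSet[m] {w | lev w = j}) {l : ℕ → Ω → V} (hl : ∀ i, FinMeas m (l i))
    (Tmax : ℕ) : FinMeas m fun w => mlmc Tmax (lev w) fun i => l i w := by
  have hj : ∀ j, FinMeas m fun w => MAC.mlmc Tmax j fun i => l i w := by
    intro j
    have hlevel : ∀ k, FinMeas m fun w => levelAvg (fun i => l i w) k := fun k =>
      (FinMeas.sum fun i _ => hl i).comp fun v => ((2 : ℝ) ^ k)⁻¹ • v
    by_cases h : 2 ^ j ≤ Tmax
    · simp only [MAC.mlmc, h, if_true]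
      exact (hlevel 0).comp₂ ((hlevel j).comp₂ (hlevel (j - 1))
        fun a b => ((2 : ℝ) ^ j) • (a - b)) (· + ·)
    · simp only [MAC.mlmc, h, if_false, add_zero]
      exact hlevel 0
  refine ⟨?_, fun v => ?_⟩
  · refine Set.Finite.subset ((Set.finite_Iic Tmax).biUnion
      (t := fun j => Set.range fun w => MAC.mlmc Tmax j fun i => l i w) (fun j _ => (hj j).finite)
      |>.union (hl 0).finite) ?_
    rintro _ ⟨w, rfl⟩
    by_cases h : 2 ^ lev w ≤ Tmax
    · left
      simp only [Set.mem_iUnion]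
      exact ⟨lev w, (Nat.lt_two_pow_self.le.trans h), w, rfl⟩
    · right
      exact ⟨w, (mlmc_eq_of_not_le h fun i => l i w).symm⟩
  · have : (fun w => MAC.mlmc Tmax (lev w) fun i => l i w) ⁻¹' {v}
        = ⋃ j, {w | lev w = j} ∩ (fun w => MAC.mlmc Tmax j fun i => l i w) ⁻¹' {v} := by
      ext w
      simp
    rw [this]
    exact MeasurableSet.iUnion fun j => (hlev j).inter ((hj j).fiber v)

lemma FinMeas.of_fintype [Finite α] {f : Ω → α} (h : ∀ v, MeasurableSet[m] {w | f w = v}) :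
    FinMeas m f := ⟨Set.toFinite _, h⟩

lemma FinMeas.of_measurable [MeasurableSpace α] [MeasurableSingletonClass α] {f : Ω → α}
    (h : Measurable[m] f) (hf : (Set.range f).Finite) : FinMeas m f :=
  ⟨hf, fun v => h (measurableSet_singleton v)⟩

lemma FinMeas.integrable {mΩ : MeasurableSpace Ω} {V : Type*} [NormedAddCommGroup V] {f : Ω → V}
    (hf : FinMeas mΩ f) (μ : Measure Ω) [IsFiniteMeasure μ] : Integrable f μ :=
  (SimpleFunc.mk f hf.fiber hf.finite).integrable_of_isFiniteMeasure

/-- An integral splits over the fibres of a function with finitely many values. -/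
lemma FinMeas.integral_eq_sum {mΩ : MeasurableSpace Ω} {V : Ω → α} (hV : FinMeas mΩ V)
    {μ : Measure Ω} {f : Ω → ℝ} (hf : Integrable f μ) :
    ∫ w, f w ∂μ = ∑ v ∈ hV.finite.toFinset, ∫ w in V ⁻¹' {v}, f w ∂μ := by
  rw [← integral_biUnion_finset hV.finite.toFinset (fun v _ => hV.fiber v)
    (fun u _ v _ huv => Disjoint.preimage V (by simpa using huv)) (fun v _ => hf.integrableOn)]
  have : ⋃ v ∈ hV.finite.toFinset, V ⁻¹' {v} = Set.univ := by
    ext w; simp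
  rw [this, setIntegral_univ]

lemma FinMeas.integral_le {mΩ : MeasurableSpace Ω} {V : Ω → α} (hV : FinMeas mΩ V)
    {μ : Measure Ω} {f g : Ω → ℝ} (hf : Integrable f μ) (hg : Integrable g μ)
    (h : ∀ v, ∫ w in V ⁻¹' {v}, f w ∂μ ≤ ∫ w in V ⁻¹' {v}, g w ∂μ) :
    ∫ w, f w ∂μ ≤ ∫ w, g w ∂μ := by
  rw [hV.integral_eq_sum hf, hV.integral_eq_sum hg]
  exact Finset.sum_le_sum fun v _ => h v

end FiniteRange

/-! ### From the conditional law of a round to integrals over events of the past. -/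

noncomputable section PathLaw

variable {S A : Type*} [Fintype S] [DecidableEq S] [Fintype A] {rmax : ℝ} {d : ℕ}
  {M : MDP S A rmax} {pol : PolicyClass S A d} {θ : EuclideanSpace ℝ (Fin d)}
  [Nonempty S] [Nonempty A]
  {E : Type*} [NormedAddCommGroup E] [NormedSpace ℝ E] [CompleteSpace E]
  {Ω : Type*} [mΩ : MeasurableSpace Ω] {μ : Measure Ω} [IsFiniteMeasure μ]

/-- The mean of a function of a trajectory, on an event on which all finite-dimensional
distributions are known. -/
lemma setIntegral_path (N : ℕ) (st : ℕ → Ω → S) (act : ℕ → Ω → A)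
    (hst : ∀ i s, MeasurableSet {w | st i w = s}) (hact : ∀ i a, MeasurableSet {w | act i w = a})
    (D : Set Ω) (hD : MeasurableSet D) (s : S) (hs : ∀ w ∈ D, st 0 w = s) (c : ℝ)
    (hlaw : ∀ (x : ℕ → S) (a : ℕ → A), x 0 = s →
      μ.real (D ∩ {w | ∀ i < N, act i w = a i ∧ st (i + 1) w = x (i + 1)})
        = c * ∏ i ∈ Finset.range N, (pol.π θ (x i) (a i) * M.p (x i) (a i) (x (i + 1))))
    (Ψ : (ℕ → S × A × S) → E) (hΨ : ∀ ζ ζ', (∀ i < N, ζ i = ζ' i) → Ψ ζ = Ψ ζ')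
    (hint : IntegrableOn (fun w => Ψ fun i => (st i w, act i w, st (i + 1) w)) D μ) :
    ∫ w in D, Ψ (fun i => (st i w, act i w, st (i + 1) w)) ∂μ = c • pathMean M pol θ N s Ψ := by
  induction N generalizing st act D s c Ψ with
  | zero =>
    have h1 := hlaw (fun _ => s) (fun _ => Classical.arbitrary A) rfl
    simp only [Nat.not_lt_zero, false_imp_iff, implies_true, Set.ofPred_true, Set.inter_univ,
      Finset.range_zero, Finset.prod_empty, mul_one] at h1
    have h2 : ∀ ζ, Ψ ζ = Ψ fun _ => Classical.arbitrary _ := fun ζ => hΨ _ _ (by simp)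
    simp_rw [h2]
    rw [setIntegral_const, h1]
    rfl
  | succ N ih =>
    -- The event is split by the first transition. On each piece the shifted trajectory satisfies
    -- the same hypotheses, with the probability of that transition absorbed into `c`.
    let G : A × S → Set Ω := fun p => D ∩ {w | act 0 w = p.1 ∧ st 1 w = p.2}
    have hG : ∀ p, MeasurableSet (G p) := fun p => hD.inter ((hact 0 p.1).inter (hst 1 p.2))
    have hunion : D = ⋃ p ∈ (Finset.univ : Finset (A × S)), G p := by
      ext w
      simp [G]
    have hdisj : Set.Pairwise (↑(Finset.univ : Finset (A × S))) (Function.onFun Disjoint G) := by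
      intro p _ q _ hpq
      rw [Function.onFun, Set.disjoint_left]
      rintro w ⟨_, h1, h2⟩ ⟨_, h3, h4⟩
      exact hpq (Prod.ext (h1.symm.trans h3) (h2.symm.trans h4))
    have hsub : ∀ p, G p ⊆ D := fun p => Set.inter_subset_left
    have hcongr : ∀ p : A × S, Set.EqOn (fun w => Ψ fun i => (st i w, act i w, st (i + 1) w))
        (fun w => Ψ (consSeq (s, p.1, p.2)
          fun i => (st (i + 1) w, act (i + 1) w, st (i + 1 + 1) w))) (G p) := by
      rintro p w ⟨hw, h1, h2⟩
      simp only
      congr 1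
      ext1 i
      cases i with
      | zero => simp only [consSeq, hs w hw, h1, h2, zero_add]
      | succ i => rfl
    have hpiece : ∀ p : A × S, ∫ w in G p, Ψ (fun i => (st i w, act i w, st (i + 1) w)) ∂μ
        = (c * (pol.π θ s p.1 * M.p s p.1 p.2)) •
          pathMean M pol θ N p.2 (fun ζ => Ψ (consSeq (s, p.1, p.2) ζ)) := by
      intro p
      rw [setIntegral_congr_fun (hG p) (hcongr p)]
      refine ih (fun i => st (i + 1)) (fun i => act (i + 1)) (fun i => hst _) (fun i => hact _)
        (G p) (hG p) p.2 (fun w hw => hw.2.2) _ ?_ (fun ζ => Ψ (consSeq (s, p.1, p.2) ζ)) ?_ ?_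
      · intro x a hx
        have h1 := hlaw (consSeq s x) (consSeq p.1 a) rfl
        rw [Finset.prod_range_succ'] at h1
        simp only [consSeq] at h1
        rw [hx] at h1
        rw [mul_assoc, mul_comm (pol.π θ s p.1 * M.p s p.1 p.2), ← h1]
        congr 1
        ext w
        simp only [G, Set.mem_inter_iff, Set.mem_ofPred_eq]
        constructor
        · rintro ⟨⟨hw, h2, h3⟩, h4⟩
          refine ⟨hw, fun i hi => ?_⟩
          cases i with
          | zero => exact ⟨h2, by simpa [consSeq, hx] using h3⟩
          | succ i => exact h4 i (by omega)
        · rintro ⟨hw, h4⟩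
          have h5 := h4 0 (by omega)
          refine ⟨⟨hw, h5.1, ?_⟩, fun i hi => h4 (i + 1) (by omega)⟩
          have := h5.2
          simpa [consSeq, hx] using this
      · intro ζ ζ' h
        refine hΨ _ _ fun i hi => ?_
        cases i with
        | zero => rfl
        | succ i => exact h i (by omega)
      · exact (hint.mono_set (hsub p)).congr_fun (hcongr p) (hG p)
    conv_lhs => rw [hunion]
    rw [integral_biUnion_finset _ (fun p _ => hG p) hdisj (fun p _ => hint.mono_set (hsub p))]
    simp_rw [hpiece]
    simp only [pathMean, stepMean, Finset.smul_sum, smul_smul, Fintype.sum_prod_type]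

variable {ℱ : Filtration ℕ mΩ} {m : ℕ} {φ : S → EuclideanSpace ℝ (Fin m)}
  {X : Iterates Ω S A d m} {Tmax : ℕ} {Rω ν σ η₁ : ℝ}

/-- The transitions of round `t`. -/
def Iterates.trans (X : Iterates Ω S A d m) (t : ℕ) (w : Ω) (i : ℕ) : S × A × S :=
  (X.st t i w, X.act t i w, X.st t (i + 1) w)

/-- On `D` the parameter and the initial state are constant, so the conditional probability of each
trajectory prescribed at level `j` is a constant there. Integration over `D` turns it into an
unconditional path probability. -/
lemma Iterates.IsRun.setIntegral_level (hX : X.IsRun μ ℱ M pol φ Tmax Rω ν σ η₁)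
    {t : ℕ} (ht : 1 ≤ t) {D : Set Ω} (hD : MeasurableSet[ℱ t] D) {s : S}
    (hθ : ∀ w ∈ D, X.θ t w = θ) (hs : ∀ w ∈ D, X.st t 0 w = s) {j : ℕ} (hj : 1 ≤ j)
    (Ψ : (ℕ → S × A × S) → E) (hΨ : ∀ ζ ζ', (∀ i < 2 ^ j, ζ i = ζ' i) → Ψ ζ = Ψ ζ')
    (hint : IntegrableOn (fun w => Ψ (X.trans t w)) (D ∩ {w | X.lev t w = j}) μ) :
    ∫ w in D ∩ {w | X.lev t w = j}, Ψ (X.trans t w) ∂μ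
      = (μ.real D * (1 / 2) ^ j) • pathMean M pol θ (2 ^ j) s Ψ := by
  have hD' : MeasurableSet D := ℱ.le t _ hD
  have hle := ℱ.le (t + 1)
  have hlev := fun j => hle _ (hX.lev_meas t ht j)
  have hst := fun i s => hle _ (hX.st_meas t ht i s)
  have hact := fun i a => hle _ (hX.act_meas t ht i a)
  refine setIntegral_path (2 ^ j) (X.st t) (X.act t) hst hact _ (hD'.inter (hlev j)) s
    (fun w hw => hs w hw.1) _ (fun x a hx => ?_) Ψ hΨ hint
  set C := {w | X.lev t w = j ∧ (∀ i ≤ 2 ^ j, X.st t i w = x i) ∧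
        (∀ i < 2 ^ j, X.act t i w = a i)} with hC
  have hCm : MeasurableSet C := by
    refine (hlev j).inter (MeasurableSet.inter ?_ ?_)
    · have : {w | ∀ i ≤ 2 ^ j, X.st t i w = x i} = ⋂ i ∈ Set.Iic (2 ^ j), {w | X.st t i w = x i} := by
        ext; simp
      change MeasurableSet {w | ∀ i ≤ 2 ^ j, X.st t i w = x i}
      rw [this]
      exact MeasurableSet.biInter (Set.to_countable _) fun i _ => hst i _
    · have : {w | ∀ i < 2 ^ j, X.act t i w = a i} = ⋂ i ∈ Set.Iio (2 ^ j), {w | X.act t i w = a i} := by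
        ext; simp
      change MeasurableSet {w | ∀ i < 2 ^ j, X.act t i w = a i}
      rw [this]
      exact MeasurableSet.biInter (Set.to_countable _) fun i _ => hact i _
  have hset : D ∩ {w | X.lev t w = j} ∩
      {w | ∀ i < 2 ^ j, X.act t i w = a i ∧ X.st t (i + 1) w = x (i + 1)} = C ∩ D := by
    ext w
    simp only [hC, Set.mem_inter_iff, Set.mem_ofPred_eq]
    constructor
    · rintro ⟨⟨hw, hl⟩, h⟩
      refine ⟨⟨hl, fun i hi => ?_, fun i hi => (h i hi).1⟩, hw⟩
      cases i with
      | zero => rw [hs w hw, hx]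
      | succ i => exact (h i (by omega)).2
    · rintro ⟨⟨hl, h1, h2⟩, hw⟩
      exact ⟨⟨hw, hl⟩, fun i hi => ⟨h2 i hi, h1 (i + 1) (by omega)⟩⟩
  have h1 : ∫ w in D, (μ⟦C | ℱ t⟧) w ∂μ = μ.real (C ∩ D) := by
    rw [setIntegral_condExp (ℱ.le t) ((integrable_const (1 : ℝ)).indicator hCm) hD,
      setIntegral_indicator hCm, setIntegral_const, smul_eq_mul, mul_one, Set.inter_comm]
  have h2 := hX.sample t ht j hj x a
  rw [hset, ← h1, setIntegral_congr_ae (g := fun _ => (1 / 2 : ℝ) ^ j *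
    ∏ i ∈ Finset.range (2 ^ j), (pol.π θ (x i) (a i) * M.p (x i) (a i) (x (i + 1)))) hD'
    (h2.mono fun w hw hwD => ?_), setIntegral_const, smul_eq_mul, mul_assoc]
  rw [hw, Set.indicator_of_mem (by rw [Set.mem_ofPred_eq, hs w hwD, hx]), hθ w hwD]

lemma pathMean_indicator {N : ℕ} (hN : 0 < N) (s : S) (p : A × S) :
    pathMean M pol θ N s (fun ζ => Set.indicator {(s, p.1, p.2)} (fun _ => (1 : ℝ)) (ζ 0))
      = pol.π θ s p.1 * M.p s p.1 p.2 := by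
  classical
  rw [pathMean_apply (Set.indicator {(s, p.1, p.2)} fun _ => (1 : ℝ)) hN, pow_zero, transOp_one]
  simp only [stepMean, Set.indicator_apply, Set.mem_singleton_iff, Prod.mk.injEq, true_and,
    smul_eq_mul, mul_ite, mul_one, mul_zero]
  rw [Finset.sum_eq_single p.1 (fun a _ ha => by simp [ha]) (by simp)]
  simp

lemma measurableSet_notMem_of_fibers {f : Ω → ℕ} (hf : ∀ j, MeasurableSet {w | f w = j})
    (I : Finset ℕ) : MeasurableSet {w | f w ∉ I} := by
  have : {w | f w ∉ I} = (⋃ j ∈ I, {w | f w = j})ᶜ := by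
    ext w
    simp only [Set.mem_compl_iff, Set.mem_iUnion, Set.mem_ofPred_eq, exists_prop, exists_eq_right']
  rw [this]
  exact (Finset.measurableSet_biUnion _ fun j _ => hf j).compl

/-- The first transition of a round, on the event that the level is large. -/
lemma Iterates.IsRun.setIntegral_tail (hX : X.IsRun μ ℱ M pol φ Tmax Rω ν σ η₁)
    {t : ℕ} (ht : 1 ≤ t) {D : Set Ω} (hD : MeasurableSet[ℱ t] D) {s : S}
    (hθ : ∀ w ∈ D, X.θ t w = θ) (hs : ∀ w ∈ D, X.st t 0 w = s) (J : ℕ)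
    (Ψ : (ℕ → S × A × S) → E) (hΨ : ∀ ζ ζ', ζ 0 = ζ' 0 → Ψ ζ = Ψ ζ')
    (hint : IntegrableOn (fun w => Ψ (X.trans t w)) (D ∩ {w | X.lev t w ∉ Finset.Icc 1 J}) μ) :
    ∫ w in D ∩ {w | X.lev t w ∉ Finset.Icc 1 J}, Ψ (X.trans t w) ∂μ
      = (μ.real D * (1 / 2) ^ J) • pathMean M pol θ 1 s Ψ := by
  have hD' : MeasurableSet D := ℱ.le t _ hD
  have hle := ℱ.le (t + 1)
  have hlev := fun j => hle _ (hX.lev_meas t ht j)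
  have hst := fun i s => hle _ (hX.st_meas t ht i s)
  have hact := fun i a => hle _ (hX.act_meas t ht i a)
  let Q : A × S → Set Ω := fun p => {w | X.act t 0 w = p.1 ∧ X.st t 1 w = p.2}
  have hQ : ∀ p, MeasurableSet (Q p) := fun p => (hact 0 p.1).inter (hst 1 p.2)
  let k : A × S → ℝ := fun p => pol.π θ s p.1 * M.p s p.1 p.2
  have hk1 : ∑ p, k p = 1 := by
    simp only [k, Fintype.sum_prod_type, ← Finset.mul_sum, M.p_sum, mul_one, pol.π_sum]
  have hR := fun J : ℕ => measurableSet_notMem_of_fibers hlev (Finset.Icc 1 J)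
  have hlevel : ∀ j, 1 ≤ j → ∀ p, μ.real (D ∩ {w | X.lev t w = j} ∩ Q p)
      = μ.real D * (1 / 2) ^ j * k p := by
    intro j hj p
    have hmeas : MeasurableSet (D ∩ {w | X.lev t w = j}) := hD'.inter (hlev j)
    have hfun : Set.EqOn (fun w => Set.indicator {(s, p.1, p.2)} (fun _ => (1 : ℝ)) (X.trans t w 0))
        (fun w => Set.indicator (Q p) (fun _ => (1 : ℝ)) w) (D ∩ {w | X.lev t w = j}) := by
      intro w hw
      have : X.trans t w 0 ∈ ({(s, p.1, p.2)} : Set (S × A × S)) ↔ w ∈ Q p := by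
        simp [Iterates.trans, Q, hs w hw.1, Prod.ext_iff]
      by_cases h : w ∈ Q p
      · simp only [Set.indicator_of_mem h, Set.indicator_of_mem (this.2 h)]
      · simp only [Set.indicator_of_notMem h, Set.indicator_of_notMem (fun h' => h (this.1 h'))]
    have h1 := hX.setIntegral_level (E := ℝ) ht hD hθ hs hj
      (fun ζ => Set.indicator {(s, p.1, p.2)} (fun _ => (1 : ℝ)) (ζ 0))
      (fun ζ ζ' h => by rw [h 0 (by positivity)])
      (((integrable_const (1 : ℝ)).indicator (hQ p)).integrableOn.congr_fun hfun.symm hmeas)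
    rw [setIntegral_congr_fun hmeas hfun, setIntegral_indicator (hQ p), setIntegral_const,
      smul_eq_mul, mul_one, pathMean_indicator (by positivity), smul_eq_mul] at h1
    exact h1
  have hsplit : ∀ (J : ℕ) p, μ.real (D ∩ Q p)
      = ∑ j ∈ Finset.Icc 1 J, μ.real (D ∩ {w | X.lev t w = j} ∩ Q p)
        + μ.real (D ∩ {w | X.lev t w ∉ Finset.Icc 1 J} ∩ Q p) := by
    intro J p
    have h1 : D ∩ Q p = (⋃ j ∈ Finset.Icc 1 J, D ∩ {w | X.lev t w = j} ∩ Q p)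
        ∪ (D ∩ {w | X.lev t w ∉ Finset.Icc 1 J} ∩ Q p) := by
      ext w
      simp only [Set.mem_inter_iff, Set.mem_union, Set.mem_iUnion, Set.mem_ofPred_eq]
      by_cases h : X.lev t w ∈ Finset.Icc 1 J
      · constructor
        · rintro ⟨h1, h2⟩
          exact Or.inl ⟨_, h, ⟨h1, rfl⟩, h2⟩
        · rintro (⟨_, _, ⟨h1, _⟩, h2⟩ | ⟨⟨h1, _⟩, h2⟩) <;> exact ⟨h1, h2⟩
      · constructor
        · rintro ⟨h1, h2⟩
          exact Or.inr ⟨⟨h1, h⟩, h2⟩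
        · rintro (⟨_, _, ⟨h1, _⟩, h2⟩ | ⟨⟨h1, _⟩, h2⟩) <;> exact ⟨h1, h2⟩
    rw [h1, measureReal_union ?_ ((hD'.inter (hR J)).inter (hQ p)) (measure_ne_top _ _)
      (measure_ne_top _ _), measureReal_biUnion_finset]
    · intro i _ j _ hij
      rw [Function.onFun, Set.disjoint_left]
      rintro w ⟨⟨_, h2⟩, _⟩ ⟨⟨_, h3⟩, _⟩
      exact hij (h2.symm.trans h3)
    · exact fun j _ => (hD'.inter (hlev j)).inter (hQ p)
    · rw [Set.disjoint_left]
      intro w hw hw'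
      simp only [Set.mem_iUnion] at hw
      obtain ⟨j, hj, ⟨_, h2⟩, _⟩ := hw
      have h3 : X.lev t w = j := h2
      exact hw'.1.2 (h3 ▸ hj)
  have hsum : ∀ (J : ℕ) p, ∑ j ∈ Finset.Icc 1 J, μ.real (D ∩ {w | X.lev t w = j} ∩ Q p)
      = μ.real D * k p - μ.real D * (1 / 2) ^ J * k p := by
    intro J p
    rw [Finset.sum_congr rfl fun j hj => hlevel j (Finset.mem_Icc.1 hj).1 p, ← Finset.sum_mul,
      ← Finset.mul_sum]
    have := sum_half_pow_add J
    have h2 : ∑ j ∈ Finset.Icc 1 J, (1 / 2 : ℝ) ^ j = 1 - (1 / 2) ^ J := by linarith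
    rw [h2]; ring
  -- The hypothesis describes each level `j ≥ 1` separately. Summing finitely many levels and
  -- letting `J → ∞` gives one inequality for the law of the first transition.
  have hge : ∀ p, μ.real D * k p ≤ μ.real (D ∩ Q p) := by
    intro p
    have h1 : ∀ J : ℕ, μ.real D * k p - μ.real D * (1 / 2) ^ J * k p ≤ μ.real (D ∩ Q p) := by
      intro J
      rw [hsplit J p, hsum]
      exact le_add_of_nonneg_right measureReal_nonneg
    have hlim : Filter.Tendsto (fun J : ℕ => μ.real D * k p - μ.real D * (1 / 2 : ℝ) ^ J * k p)
        Filter.atTop (nhds (μ.real D * k p - μ.real D * 0 * k p)) :=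
      tendsto_const_nhds.sub (((tendsto_pow_atTop_nhds_zero_of_lt_one (by norm_num)
        (by norm_num)).const_mul _).mul_const _)
    rw [mul_zero, zero_mul, sub_zero] at hlim
    exact le_of_tendsto' hlim h1
  have htot : ∑ p, μ.real (D ∩ Q p) = μ.real D := by
    rw [← measureReal_biUnion_finset]
    · congr 1
      ext w
      simp [Q]
    · intro p _ q _ hpq
      rw [Function.onFun, Set.disjoint_left]
      rintro w ⟨_, h1, h2⟩ ⟨_, h3, h4⟩
      exact hpq (Prod.ext (h1.symm.trans h3) (h2.symm.trans h4))
    · exact fun p _ => hD'.inter (hQ p)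
  -- Both sides sum over `p` to the mass of `D`, so each inequality is an equality. The law on the
  -- tail, which includes level 0, follows by subtracting the levels up to `J`.
  have heq : ∀ p, μ.real (D ∩ Q p) = μ.real D * k p := by
    have h1 := (Finset.sum_eq_sum_iff_of_le (s := Finset.univ) fun p _ => hge p).1
      (by rw [← Finset.mul_sum, hk1, mul_one, htot])
    exact fun p => (h1 p (Finset.mem_univ p)).symm
  refine setIntegral_path 1 (X.st t) (X.act t) hst hact _ (hD'.inter (hR J)) s
    (fun w hw => hs w hw.1) _ (fun x a hx => ?_) Ψ (fun ζ ζ' h => hΨ ζ ζ' (h 0 one_pos)) hint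
  have h1 := hsplit J (a 0, x 1)
  rw [hsum, heq] at h1
  have hset : {w | ∀ i < 1, X.act t i w = a i ∧ X.st t (i + 1) w = x (i + 1)} = Q (a 0, x 1) := by
    ext w; simp [Q]
  rw [hset, Finset.prod_range_one, hx]
  simp only [k] at h1
  linarith

/-- The law of one round, on an event of the past which determines the policy parameter and the
initial state. -/
lemma Iterates.IsRun.setIntegral_round (hX : X.IsRun μ ℱ M pol φ Tmax Rω ν σ η₁)
    {t : ℕ} (ht : 1 ≤ t) {D : Set Ω} (hD : MeasurableSet[ℱ t] D) {s : S}
    (hθ : ∀ w ∈ D, X.θ t w = θ) (hs : ∀ w ∈ D, X.st t 0 w = s) (J : ℕ)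
    (Ψ : ℕ → (ℕ → S × A × S) → E) (hΨ : ∀ j ζ ζ', (∀ i < 2 ^ j, ζ i = ζ' i) → Ψ j ζ = Ψ j ζ')
    (hJ : ∀ j ∉ Finset.Icc 1 J, Ψ j = Ψ 0)
    (hint : Integrable (fun w => Ψ (X.lev t w) (X.trans t w)) μ) :
    ∫ w in D, Ψ (X.lev t w) (X.trans t w) ∂μ = μ.real D • roundMean M pol θ J s Ψ := by
  have hD' : MeasurableSet D := ℱ.le t _ hD
  have hlev := fun j => ℱ.le (t + 1) _ (hX.lev_meas t ht j)
  have hR := measurableSet_notMem_of_fibers hlev (Finset.Icc 1 J)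
  have hunion : D = (⋃ j ∈ Finset.Icc 1 J, D ∩ {w | X.lev t w = j})
      ∪ (D ∩ {w | X.lev t w ∉ Finset.Icc 1 J}) := by
    ext w
    simp only [Set.mem_inter_iff, Set.mem_union, Set.mem_iUnion, Set.mem_ofPred_eq]
    by_cases h : X.lev t w ∈ Finset.Icc 1 J
    · exact ⟨fun h1 => Or.inl ⟨_, h, h1, rfl⟩, by rintro (⟨_, _, h1, _⟩ | ⟨h1, _⟩) <;> exact h1⟩
    · exact ⟨fun h1 => Or.inr ⟨h1, h⟩, by rintro (⟨_, _, h1, _⟩ | ⟨h1, _⟩) <;> exact h1⟩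
  have hdisj : Disjoint (⋃ j ∈ Finset.Icc 1 J, D ∩ {w | X.lev t w = j})
      (D ∩ {w | X.lev t w ∉ Finset.Icc 1 J}) := by
    rw [Set.disjoint_left]
    intro w hw hw'
    simp only [Set.mem_iUnion] at hw
    obtain ⟨j, hj, _, h2⟩ := hw
    have h3 : X.lev t w = j := h2
    exact hw'.2 (h3 ▸ hj)
  have hcongr : ∀ j, Set.EqOn (fun w => Ψ (X.lev t w) (X.trans t w))
      (fun w => Ψ j (X.trans t w)) (D ∩ {w | X.lev t w = j}) := by
    intro j w hw
    have h3 : X.lev t w = j := hw.2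
    simp only [h3]
  have hcongr' : Set.EqOn (fun w => Ψ (X.lev t w) (X.trans t w))
      (fun w => Ψ 0 (X.trans t w)) (D ∩ {w | X.lev t w ∉ Finset.Icc 1 J}) := by
    intro w hw
    simp only [hJ _ hw.2]
  conv_lhs => rw [hunion]
  rw [setIntegral_union hdisj (hD'.inter hR) hint.integrableOn hint.integrableOn,
    integral_biUnion_finset _ (fun j _ => hD'.inter (hlev j)) ?_ fun j _ => hint.integrableOn]
  · rw [roundMean, smul_add, Finset.smul_sum, setIntegral_congr_fun (hD'.inter hR) hcongr',
      hX.setIntegral_tail ht hD hθ hs J (Ψ 0) (fun ζ ζ' h => hΨ 0 ζ ζ' (by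
        intro i hi
        have : i = 0 := by simpa using hi
        rw [this, h]))
        (hint.integrableOn.congr_fun hcongr' (hD'.inter hR)), smul_smul]
    congr 1
    refine Finset.sum_congr rfl fun j hj => ?_
    rw [setIntegral_congr_fun (hD'.inter (hlev j)) (hcongr j),
      hX.setIntegral_level ht hD hθ hs (Finset.mem_Icc.1 hj).1 (Ψ j) (hΨ j)
        (hint.integrableOn.congr_fun (hcongr j) (hD'.inter (hlev j))), smul_smul]
  · intro i _ j _ hij
    rw [Function.onFun, Set.disjoint_left]
    rintro w ⟨_, h2⟩ ⟨_, h3⟩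
    exact hij (h2.symm.trans h3)

end PathLaw

/-! ### Elementary properties of a run of the algorithm. -/

noncomputable section RunLemmas

variable {S A : Type*} [Fintype S] [DecidableEq S] [Fintype A] {rmax : ℝ} {d m : ℕ}
  {M : MDP S A rmax} {pol : PolicyClass S A d} {φ : S → EuclideanSpace ℝ (Fin m)}
  {B K L lam Rω ν σ η₁ : ℝ} {Tmax : ℕ}
  {Ω : Type*} [mΩ : MeasurableSpace Ω] {μ : Measure Ω} {ℱ : Filtration ℕ mΩ}
  {X : Iterates Ω S A d m}

/-- The standing assumptions on a run of the algorithm. -/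
structure GoodRun (X : Iterates Ω S A d m) (μ : Measure Ω) (ℱ : Filtration ℕ mΩ)
    (M : MDP S A rmax) (pol : PolicyClass S A d) (φ : S → EuclideanSpace ℝ (Fin m))
    (Tmax : ℕ) (Rω ν σ η₁ B K L lam : ℝ) : Prop where
  run : X.IsRun μ ℱ M pol φ Tmax Rω ν σ η₁
  two_le : 2 ≤ Tmax
  feature_le : ∀ s, ‖φ s‖ ≤ 1
  regular : pol.Regular B K L
  ergodic : Ergodic M pol
  posDef : CriticPosDef M pol φ lam
  target_le : ∀ θ, ‖criticTarget M pol φ θ‖ ≤ Rω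
  lam_pos : 0 < lam
  ν_pos : 0 < ν
  ν_lt_σ : ν < σ
  σ_lt_one : σ < 1

/-! ### The iterates take finitely many values -/

lemma Iterates.IsRun.finMeas_st (hX : X.IsRun μ ℱ M pol φ Tmax Rω ν σ η₁) {t : ℕ} (ht : 1 ≤ t)
    (i : ℕ) : FinMeas mΩ (X.st t i) :=
  FinMeas.of_fintype fun s => ℱ.le _ _ (hX.st_meas t ht i s)

lemma Iterates.IsRun.finMeas_act (hX : X.IsRun μ ℱ M pol φ Tmax Rω ν σ η₁) {t : ℕ} (ht : 1 ≤ t)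
    (i : ℕ) : FinMeas mΩ (X.act t i) :=
  FinMeas.of_fintype fun s => ℱ.le _ _ (hX.act_meas t ht i s)

lemma Iterates.IsRun.finMeas_trans (hX : X.IsRun μ ℱ M pol φ Tmax Rω ν σ η₁) {t : ℕ}
    (ht : 1 ≤ t) (i : ℕ) : FinMeas mΩ fun w => X.trans t w i :=
  (hX.finMeas_st ht i).prodMk ((hX.finMeas_act ht i).prodMk (hX.finMeas_st ht (i + 1)))

lemma Iterates.IsRun.measurableSet_lev (hX : X.IsRun μ ℱ M pol φ Tmax Rω ν σ η₁) {t : ℕ}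
    (ht : 1 ≤ t) (j : ℕ) : MeasurableSet {w | X.lev t w = j} :=
  ℱ.le _ _ (hX.lev_meas t ht j)

lemma Iterates.IsRun.finMeas_mlmc {V : Type*} [AddCommGroup V] [Module ℝ V]
    (hX : X.IsRun μ ℱ M pol φ Tmax Rω ν σ η₁) {t : ℕ} (ht : 1 ≤ t) {α : Type*} {f : Ω → α}
    (hf : FinMeas mΩ f) (F : α → S × A × S → V) :
    FinMeas mΩ fun w => mlmc Tmax (X.lev t w) fun i => F (f w) (X.trans t w i) :=
  FinMeas.mlmc (hX.measurableSet_lev ht) (fun i => hf.comp₂ (hX.finMeas_trans ht i) F) Tmax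

/-- The initial values are deterministic, and each round adds finitely many outcomes. The past actor
estimates are carried through the induction because the actor step depends on all of them. -/
lemma Iterates.IsRun.finMeas_aux (hX : X.IsRun μ ℱ M pol φ Tmax Rω ν σ η₁) {t : ℕ} (ht : 1 ≤ t) :
    FinMeas mΩ (X.θ t) ∧ FinMeas mΩ (X.η t) ∧ FinMeas mΩ (X.ω t) ∧
      ∀ k, 1 ≤ k → k < t → FinMeas mΩ (X.hMLMC M pol φ Tmax k) := by
  induction t, ht using Nat.le_induction with
  | base =>
    obtain ⟨θ₁, hθ⟩ := hX.θ_init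
    obtain ⟨ω₁, -, hω⟩ := hX.ω_init
    refine ⟨?_, ?_, ?_, fun k h1 h2 => absurd h1 (by omega)⟩
    · rw [show X.θ 1 = fun _ => θ₁ from funext hθ]; exact finMeas_const _
    · rw [show X.η 1 = fun _ => η₁ from funext hX.η_init]; exact finMeas_const _
    · rw [show X.ω 1 = fun _ => ω₁ from funext hω]; exact finMeas_const _
  | succ t ht ih =>
    obtain ⟨hθ, hη, hω, hh⟩ := ih
    have hf : FinMeas mΩ (X.fMLMC M Tmax t) :=
      hX.finMeas_mlmc ht hη fun η z => η - M.r z.1 z.2.1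
    have hg : FinMeas mΩ (X.gMLMC M φ Tmax t) :=
      hX.finMeas_mlmc ht (hη.prodMk hω) fun p z => tdSample M φ p.1 p.2 z
    have hht : FinMeas mΩ (X.hMLMC M pol φ Tmax t) :=
      hX.finMeas_mlmc ht (hθ.prodMk (hη.prodMk hω)) fun p z =>
        (M.r z.1 z.2.1 - p.2.1 + inner ℝ (φ z.2.2 - φ z.1) p.2.2) • pol.score p.1 z.1 z.2.1
    have hh' : ∀ k, 1 ≤ k → k < t + 1 → FinMeas mΩ (X.hMLMC M pol φ Tmax k) := by
      intro k h1 h2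
      rcases Nat.lt_succ_iff_lt_or_eq.1 h2 with h | h
      · exact hh k h1 h
      · exact h ▸ hht
    have hstep : FinMeas mΩ (X.actorStep M pol φ Tmax σ t) := by
      have : FinMeas mΩ fun w => ∑ k ∈ Finset.Icc 1 t, ‖X.hMLMC M pol φ Tmax k w‖ ^ 2 :=
        FinMeas.sum fun k hk => (hh' k (Finset.mem_Icc.1 hk).1
          (Nat.lt_succ_of_le (Finset.mem_Icc.1 hk).2)).comp fun v => ‖v‖ ^ 2
      exact this.comp fun v => (1 + (t : ℝ)) ^ (-σ) / √v
    refine ⟨?_, ?_, ?_, hh'⟩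
    · rw [show X.θ (t + 1) = _ from funext (hX.θ_step t ht)]
      exact hθ.comp₂ (hstep.comp₂ hht (· • ·)) (· + ·)
    · rw [show X.η (t + 1) = _ from funext (hX.η_step t ht)]
      exact hη.comp₂ hf fun a b => a - (1 + (t : ℝ)) ^ (-ν) * b
    · rw [show X.ω (t + 1) = _ from funext (hX.ω_step t ht)]
      exact hω.comp₂ hg fun a b => projBall Rω (a + (1 + (t : ℝ)) ^ (-ν) • b)

lemma Iterates.IsRun.finMeas_θ (hX : X.IsRun μ ℱ M pol φ Tmax Rω ν σ η₁) {t : ℕ} (ht : 1 ≤ t) :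
    FinMeas (ℱ t) (X.θ t) :=
  FinMeas.of_measurable (hX.θ_meas t ht) (hX.finMeas_aux ht).1.finite

lemma Iterates.IsRun.finMeas_η (hX : X.IsRun μ ℱ M pol φ Tmax Rω ν σ η₁) {t : ℕ} (ht : 1 ≤ t) :
    FinMeas (ℱ t) (X.η t) :=
  FinMeas.of_measurable (hX.η_meas t ht) (hX.finMeas_aux ht).2.1.finite

lemma Iterates.IsRun.finMeas_ω (hX : X.IsRun μ ℱ M pol φ Tmax Rω ν σ η₁) {t : ℕ} (ht : 1 ≤ t) :
    FinMeas (ℱ t) (X.ω t) :=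
  FinMeas.of_measurable (hX.ω_meas t ht) (hX.finMeas_aux ht).2.2.1.finite

lemma Iterates.IsRun.finMeas_start (hX : X.IsRun μ ℱ M pol φ Tmax Rω ν σ η₁) {t : ℕ}
    (ht : 1 ≤ t) : FinMeas (ℱ t) (X.st t 0) :=
  FinMeas.of_fintype (hX.start_meas t ht)

lemma Iterates.IsRun.finMeas_rewardErr (hX : X.IsRun μ ℱ M pol φ Tmax Rω ν σ η₁) {t : ℕ}
    (ht : 1 ≤ t) : FinMeas (ℱ t) (X.rewardErr M pol t) :=
  (hX.finMeas_η ht).comp₂ (hX.finMeas_θ ht) fun η θ => (η - avgReward M pol θ) ^ 2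

lemma Iterates.IsRun.finMeas_criticErr (hX : X.IsRun μ ℱ M pol φ Tmax Rω ν σ η₁) {t : ℕ}
    (ht : 1 ≤ t) : FinMeas (ℱ t) (X.criticErr M pol φ t) :=
  (hX.finMeas_ω ht).comp₂ (hX.finMeas_θ ht) fun ω θ => ‖ω - criticTarget M pol φ θ‖ ^ 2

lemma Iterates.IsRun.finMeas_mixingTime (hX : X.IsRun μ ℱ M pol φ Tmax Rω ν σ η₁) {t : ℕ}
    (ht : 1 ≤ t) : FinMeas (ℱ t) fun w => mixingTime (kernel M pol (X.θ t w)) :=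
  (hX.finMeas_θ ht).comp fun θ => mixingTime (kernel M pol θ)

lemma Iterates.maxMixing_succ (X : Iterates Ω S A d m) (M : MDP S A rmax) (pol : PolicyClass S A d)
    (t : ℕ) (w : Ω) : X.maxMixing M pol (t + 1) w
      = max (X.maxMixing M pol t w) (mixingTime (kernel M pol (X.θ (t + 1) w))) := by
  rw [maxMixing, ← Finset.insert_Icc_right_eq_Icc_add_one (by omega), Finset.sup_insert]
  exact max_comm _ _

lemma Iterates.IsRun.finMeas_maxMixing (hX : X.IsRun μ ℱ M pol φ Tmax Rω ν σ η₁) (t : ℕ) :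
    FinMeas (ℱ t) (X.maxMixing M pol t) := by
  induction t with
  | zero =>
    have : X.maxMixing M pol 0 = fun _ => 0 := by ext w; simp [Iterates.maxMixing]
    rw [this]; exact finMeas_const _
  | succ t ih =>
    rw [show X.maxMixing M pol (t + 1) = _ from funext (X.maxMixing_succ M pol t)]
    exact (ih.mono (ℱ.mono (Nat.le_succ t))).comp₂ (hX.finMeas_mixingTime (by omega)) max

lemma Iterates.mixingTime_le_maxMixing (X : Iterates Ω S A d m) (M : MDP S A rmax)
    (pol : PolicyClass S A d) {t T : ℕ} (ht : 1 ≤ t) (htT : t ≤ T) (w : Ω) :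
    mixingTime (kernel M pol (X.θ t w)) ≤ X.maxMixing M pol T w :=
  Finset.le_sup (f := fun t => mixingTime (kernel M pol (X.θ t w))) (Finset.mem_Icc.2 ⟨ht, htT⟩)

lemma Iterates.maxMixing_mono (X : Iterates Ω S A d m) (M : MDP S A rmax)
    (pol : PolicyClass S A d) {t T : ℕ} (htT : t ≤ T) (w : Ω) :
    X.maxMixing M pol t w ≤ X.maxMixing M pol T w :=
  Finset.sup_mono (Finset.Icc_subset_Icc le_rfl htT)

/-! ### Moments of the estimates on an event of the past -/

section Moments

variable [Nonempty S] [Nonempty A] [IsFiniteMeasure μ]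
  {V : Type*} [NormedAddCommGroup V] [InnerProductSpace ℝ V] [CompleteSpace V]

lemma Iterates.IsRun.setIntegral_mlmc (hX : X.IsRun μ ℱ M pol φ Tmax Rω ν σ η₁) (hT : Tmax ≠ 0)
    {W : Type*} [NormedAddCommGroup W] [NormedSpace ℝ W] [CompleteSpace W]
    {t : ℕ} (ht : 1 ≤ t) {D : Set Ω} (hD : MeasurableSet[ℱ t] D) {s : S}
    {θ : EuclideanSpace ℝ (Fin d)} (hθ : ∀ w ∈ D, X.θ t w = θ) (hs : ∀ w ∈ D, X.st t 0 w = s)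
    (u : S × A × S → V) (F : V → W) :
    ∫ w in D, F (mlmc Tmax (X.lev t w) fun i => u (X.trans t w i)) ∂μ
      = μ.real D • roundMean M pol θ (Nat.log 2 Tmax) s
          (fun j ζ => F (mlmc Tmax j fun i => u (ζ i))) := by
  refine hX.setIntegral_round ht hD hθ hs (Nat.log 2 Tmax)
    (fun j ζ => F (mlmc Tmax j fun i => u (ζ i))) ?_ ?_ ?_
  · intro j ζ ζ' h
    exact congrArg F (mlmc_congr fun i hi => by rw [h i hi])
  · intro j hj
    ext1 ζ
    rcases Nat.eq_zero_or_pos j with rfl | h0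
    · rfl
    -- Beyond `log₂ Tmax` the estimate is its first sample, like the formal value at level 0; so the
    -- tail in `roundMean` starts at this level.
    · have : ¬ 2 ^ j ≤ Tmax := fun h => hj (Finset.mem_Icc.2 ⟨h0, (Nat.le_log_iff_pow_le one_lt_two hT).2 h⟩)
      rw [mlmc_eq_of_not_le this, mlmc_zero]
  · exact ((hX.finMeas_mlmc ht (finMeas_const ()) fun _ z => u z).comp F).integrable μ

end Moments

/-! ### Elementary bounds on the iterates -/

lemma norm_projBall_sub_le {R : ℝ} (x y : EuclideanSpace ℝ (Fin m)) (hy : ‖y‖ ≤ R) :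
    ‖projBall R x - y‖ ≤ ‖x - y‖ := by
  unfold projBall
  split_ifs with h
  · exact le_rfl
  · push Not at h
    have hR : 0 ≤ R := (norm_nonneg _).trans hy
    have hx : 0 < ‖x‖ := hR.trans_lt h
    set c := R / ‖x‖ with hc
    have hc0 : 0 ≤ c := by positivity
    have hc1 : c ≤ 1 := (div_le_one hx).2 h.le
    have hcx : c * ‖x‖ = R := div_mul_cancel₀ _ hx.ne'
    have hsq : ‖c • x - y‖ ^ 2 ≤ ‖x - y‖ ^ 2 := by
      rw [norm_sub_sq_real, norm_sub_sq_real, norm_smul, inner_smul_left, Real.norm_eq_abs,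
        abs_of_nonneg hc0, conj_trivial]
      have h1 : (inner ℝ x y : ℝ) ≤ ‖x‖ * R :=
        (real_inner_le_norm x y).trans (mul_le_mul_of_nonneg_left hy hx.le)
      have h2 : (1 - c) * inner ℝ x y ≤ (1 - c) * (‖x‖ * R) :=
        mul_le_mul_of_nonneg_left h1 (by linarith)
      rw [hcx]
      have h3 : (1 - c) * (‖x‖ * R) = ‖x‖ * R - R ^ 2 := by rw [sub_mul, one_mul, ← mul_assoc, hcx]; ring
      nlinarith [sq_nonneg (‖x‖ - R)]
    exact (sq_le_sq₀ (norm_nonneg _) (norm_nonneg _)).1 hsq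

lemma norm_projBall_le {R : ℝ} (hR : 0 ≤ R) (x : EuclideanSpace ℝ (Fin m)) :
    ‖projBall R x‖ ≤ R := by
  unfold projBall
  split_ifs with h
  · exact h
  · push Not at h
    have hx : 0 < ‖x‖ := hR.trans_lt h
    rw [norm_smul, Real.norm_eq_abs, abs_of_nonneg (by positivity), div_mul_cancel₀ _ hx.ne']

lemma Iterates.IsRun.norm_ω_le (hX : X.IsRun μ ℱ M pol φ Tmax Rω ν σ η₁) (hR : 0 ≤ Rω) {t : ℕ}
    (ht : 1 ≤ t) (w : Ω) : ‖X.ω t w‖ ≤ Rω := by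
  obtain ⟨t, rfl⟩ := Nat.exists_eq_add_of_le' ht
  rcases Nat.eq_zero_or_pos t with rfl | h0
  · obtain ⟨ω₁, h1, h2⟩ := hX.ω_init
    rw [h2]; exact h1
  · rw [hX.ω_step t h0]
    exact norm_projBall_le hR _

/-- The normalising root includes the current term `k = t`, hence is at least the norm of the
current estimate. The displacement is bounded deterministically, with no moment bound on the actor
estimate. -/
lemma Iterates.IsRun.norm_θ_sub_le (hX : X.IsRun μ ℱ M pol φ Tmax Rω ν σ η₁) {t : ℕ}
    (ht : 1 ≤ t) (w : Ω) : ‖X.θ (t + 1) w - X.θ t w‖ ≤ (1 + (t : ℝ)) ^ (-σ) := by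
  have hc : 0 ≤ (1 + (t : ℝ)) ^ (-σ) := Real.rpow_nonneg (by positivity) _
  have h1 : ‖X.hMLMC M pol φ Tmax t w‖ ^ 2
      ≤ ∑ k ∈ Finset.Icc 1 t, ‖X.hMLMC M pol φ Tmax k w‖ ^ 2 :=
    Finset.single_le_sum (f := fun k => ‖X.hMLMC M pol φ Tmax k w‖ ^ 2) (fun _ _ => sq_nonneg _)
      (Finset.mem_Icc.2 ⟨ht, le_rfl⟩)
  have h2 := Real.le_sqrt_of_sq_le h1
  rw [hX.θ_step t ht, add_sub_cancel_left, norm_smul, Real.norm_eq_abs, Iterates.actorStep]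
  generalize ∑ k ∈ Finset.Icc 1 t, ‖X.hMLMC M pol φ Tmax k w‖ ^ 2 = Q at h2
  rw [abs_of_nonneg (div_nonneg hc (Real.sqrt_nonneg _))]
  -- When all estimates so far vanish, division by zero gives step size zero, in accordance with the
  -- convention of the algorithm.
  rcases (Real.sqrt_nonneg Q).eq_or_lt with h0 | h0
  · rw [← h0, div_zero, zero_mul]; exact hc
  · rw [div_mul_eq_mul_div, div_le_iff₀ h0]
    exact mul_le_mul_of_nonneg_left h2 hc

end RunLemmas

/-! ### One round of the reward tracker. -/

noncomputable section OneStep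

variable {S A : Type*} [Fintype S] [DecidableEq S] [Fintype A] {rmax : ℝ} {d m : ℕ}
  {M : MDP S A rmax} {pol : PolicyClass S A d} {φ : S → EuclideanSpace ℝ (Fin m)}
  {B K L lam Rω ν σ η₁ : ℝ} {Tmax : ℕ}
  {Ω : Type*} [mΩ : MeasurableSpace Ω] {μ : Measure Ω} {ℱ : Filtration ℕ mΩ}
  {X : Iterates Ω S A d m} [Nonempty S] [Nonempty A]

lemma add_sq_le_young {a b ρ : ℝ} (hρ : 0 < ρ) :
    (a + b) ^ 2 ≤ (1 + ρ) * a ^ 2 + (1 + 1 / ρ) * b ^ 2 := by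
  have h : 0 ≤ (ρ * a - b) ^ 2 / ρ := by positivity
  have h2 : (ρ * a - b) ^ 2 / ρ = ρ * a ^ 2 - 2 * a * b + 1 / ρ * b ^ 2 := by
    field_simp
    ring
  nlinarith

lemma two_mul_mul_le_young (a b : ℝ) {ρ : ℝ} (hρ : 0 < ρ) : 2 * (a * b) ≤ ρ * a ^ 2 + b ^ 2 / ρ := by
  have h : 0 ≤ (ρ * a - b) ^ 2 / ρ := by positivity
  have h2 : (ρ * a - b) ^ 2 / ρ = ρ * a ^ 2 - 2 * (a * b) + b ^ 2 / ρ := by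
    field_simp
    ring
  linarith

lemma setIntegral_add_mul_add_mul {f g : Ω → ℝ} [IsFiniteMeasure μ] (hf : Integrable f μ)
    (hg : Integrable g μ) (D : Set Ω) (c₀ c₁ c₂ : ℝ) :
    ∫ w in D, (c₀ + c₁ * f w + c₂ * g w) ∂μ
      = μ.real D * c₀ + c₁ * ∫ w in D, f w ∂μ + c₂ * ∫ w in D, g w ∂μ := by
  have h0 : IntegrableOn (fun _ : Ω => c₀) D μ := (integrable_const c₀).integrableOn
  have h1 : IntegrableOn (fun w => c₁ * f w) D μ := (hf.const_mul c₁).integrableOn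
  have h2 : IntegrableOn (fun w => c₂ * g w) D μ := (hg.const_mul c₂).integrableOn
  have h01 : IntegrableOn (fun w => c₀ + c₁ * f w) D μ := h0.add h1
  rw [integral_add h01 h2, integral_add h0 h1, integral_const_mul, integral_const_mul,
    setIntegral_const, smul_eq_mul]

lemma sum_mul_le_mul_sum {k₁ k₂ k₃ x₁ x₂ x₃ : ℝ} (hk₁ : 0 ≤ k₁) (hk₂ : 0 ≤ k₂) (hk₃ : 0 ≤ k₃)
    (hx₁ : 0 ≤ x₁) (hx₂ : 0 ≤ x₂) (hx₃ : 0 ≤ x₃) :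
    k₁ * x₁ + k₂ * x₂ + k₃ * x₃ ≤ (k₁ + k₂ + k₃) * (x₁ + x₂ + x₃) := by
  nlinarith [mul_nonneg hk₁ hx₂, mul_nonneg hk₁ hx₃, mul_nonneg hk₂ hx₁, mul_nonneg hk₂ hx₃,
    mul_nonneg hk₃ hx₁, mul_nonneg hk₃ hx₂]

/-- The scalar form of the round `e ↦ (1 - γ) e + γ N`, with `b` and `V` in place of the mean and
second moment of `N`, followed by a drift of square `D`. Young's inequality is used once for the
bias and once, with parameter `ε γ`, for the drift; each use costs `ε γ` of the contraction. -/
lemma reward_step_le {γ ε e b V D : ℝ} (hγ : 0 < γ) (hγ1 : γ ≤ 1) (hε : 0 < ε) (hε1 : ε ≤ 1)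
    (hV : 0 ≤ V) (hD : 0 ≤ D) :
    (1 + ε * γ) * ((1 - γ) ^ 2 * e ^ 2 + 2 * γ * (1 - γ) * (e * b) + γ ^ 2 * V)
        + (1 + 1 / (ε * γ)) * D
      ≤ (1 - (1 - 2 * ε) * γ) * e ^ 2 + (2 * γ * b ^ 2 / ε + 2 * γ ^ 2 * V + 2 * D / (ε * γ)) := by
  have hεγ : 0 < ε * γ := mul_pos hε hγ
  have hεγ1 : ε * γ ≤ 1 := mul_le_one₀ hε1 hγ.le hγ1
  have h1 : 2 * γ * (1 - γ) * (e * b) ≤ γ * (ε * e ^ 2 + b ^ 2 / ε) := by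
    have h2 := two_mul_mul_le_young e b hε
    have h3 : 0 ≤ ε * e ^ 2 + b ^ 2 / ε := by positivity
    have h4 : 2 * γ * (1 - γ) * (e * b) = γ * ((1 - γ) * (2 * (e * b))) := by ring
    rw [h4]
    refine mul_le_mul_of_nonneg_left ?_ hγ.le
    calc (1 - γ) * (2 * (e * b)) ≤ (1 - γ) * (ε * e ^ 2 + b ^ 2 / ε) :=
          mul_le_mul_of_nonneg_left h2 (by linarith)
      _ ≤ 1 * (ε * e ^ 2 + b ^ 2 / ε) := mul_le_mul_of_nonneg_right (by linarith) h3
      _ = _ := one_mul _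
  have h5 : (1 - γ) ^ 2 ≤ 1 - γ := by nlinarith
  have h6 : (1 - γ) ^ 2 * e ^ 2 + 2 * γ * (1 - γ) * (e * b) + γ ^ 2 * V
      ≤ (1 - (1 - ε) * γ) * e ^ 2 + (γ * b ^ 2 / ε + γ ^ 2 * V) := by
    have h7 := mul_le_mul_of_nonneg_right h5 (sq_nonneg e)
    have h8 : γ * (ε * e ^ 2 + b ^ 2 / ε) = γ * ε * e ^ 2 + γ * b ^ 2 / ε := by ring
    nlinarith
  have h9 : (1 + ε * γ) * ((1 - γ) ^ 2 * e ^ 2 + 2 * γ * (1 - γ) * (e * b) + γ ^ 2 * V)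
      ≤ (1 + ε * γ) * ((1 - (1 - ε) * γ) * e ^ 2) + 2 * (γ * b ^ 2 / ε + γ ^ 2 * V) := by
    have h10 : 0 ≤ γ * b ^ 2 / ε + γ ^ 2 * V := by positivity
    have h11 := mul_le_mul_of_nonneg_left h6 (by positivity : 0 ≤ 1 + ε * γ)
    nlinarith
  have h12 : (1 + ε * γ) * ((1 - (1 - ε) * γ) * e ^ 2) ≤ (1 - (1 - 2 * ε) * γ) * e ^ 2 := by
    rw [← mul_assoc]
    refine mul_le_mul_of_nonneg_right ?_ (sq_nonneg e)
    nlinarith [mul_nonneg hεγ.le (mul_nonneg (sub_nonneg.2 hε1) hγ.le)]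
  have h13 : (1 + 1 / (ε * γ)) * D ≤ 2 * D / (ε * γ) := by
    have : (1 : ℝ) ≤ 1 / (ε * γ) := by rw [le_div_iff₀ hεγ]; linarith
    calc (1 + 1 / (ε * γ)) * D ≤ (2 * (1 / (ε * γ))) * D :=
          mul_le_mul_of_nonneg_right (by linarith) hD
      _ = _ := by ring
  have h14 : 2 * γ * b ^ 2 / ε = 2 * (γ * b ^ 2 / ε) := by ring
  rw [h14]
  linarith

/-- Coercivity contributes contraction `2 c β`. The coupling to the reward error, the bias and the
drift use up `c β / 2` each, leaving `c β / 2`. The factor `5 + nb` collects the mean direction (1),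
its product with the bias (4) and the second moment of the noise (`nb`). -/
lemma critic_step_le {β c x y gg vg nb b2 vb gb V D Gsq : ℝ} (hβ : 0 < β) (hβ1 : β ≤ 1) (hc : 0 < c)
    (hc1 : c ≤ 1) (hx : 0 ≤ x) (hD : 0 ≤ D) (hy : 0 ≤ y) (hb2 : 0 ≤ b2)
    (hvg : 2 * vg ≤ -(2 * c) * x + ((c / 2) * x + 2 * y / c))
    (hvb : 2 * vb ≤ (c / 2) * x + 2 * b2 / c) (hgb : 2 * gb ≤ 4 * Gsq) (hgg : gg ≤ Gsq)
    (hV : V ≤ nb * Gsq) (hG : 0 ≤ Gsq) (hnb : 0 ≤ nb) :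
    (1 + c * β / 2) * (x + 2 * β * vg + β ^ 2 * gg + 2 * β * (vb + β * gb) + β ^ 2 * V)
        + (1 + 1 / (c * β / 2)) * D
      ≤ (1 - c * β / 2) * x + (4 * β * y / c + 4 * β * b2 / c + 2 * β ^ 2 * (5 + nb) * Gsq
        + 3 * D / (c * β)) := by
  have hcβ : 0 < c * β := mul_pos hc hβ
  have hcβ1 : c * β ≤ 1 := mul_le_one₀ hc1 hβ.le hβ1
  have hβ2 : 0 ≤ β ^ 2 := sq_nonneg β
  have h1 : x + 2 * β * vg + β ^ 2 * gg + 2 * β * (vb + β * gb) + β ^ 2 * V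
      ≤ (1 - c * β) * x + (2 * β * y / c + 2 * β * b2 / c + β ^ 2 * (5 + nb) * Gsq) := by
    have e1 := mul_le_mul_of_nonneg_left hvg hβ.le
    have e2 := mul_le_mul_of_nonneg_left hvb hβ.le
    have e3 := mul_le_mul_of_nonneg_left hgb hβ2
    have e4 := mul_le_mul_of_nonneg_left hgg hβ2
    have e5 := mul_le_mul_of_nonneg_left hV hβ2
    have e6 : β * (-(2 * c) * x + ((c / 2) * x + 2 * y / c))
      = -(2 * c) * β * x + (c / 2) * β * x + 2 * β * y / c := by ring
    have e7 : β * ((c / 2) * x + 2 * b2 / c) = (c / 2) * β * x + 2 * β * b2 / c := by ring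
    nlinarith
  have h2 : 0 ≤ 2 * β * y / c + 2 * β * b2 / c + β ^ 2 * (5 + nb) * Gsq := by positivity
  have h3 := mul_le_mul_of_nonneg_left h1 (by positivity : 0 ≤ 1 + c * β / 2)
  have h4 : (1 + c * β / 2) * ((1 - c * β) * x) ≤ (1 - c * β / 2) * x := by
    rw [← mul_assoc]
    refine mul_le_mul_of_nonneg_right ?_ hx
    nlinarith [sq_nonneg (c * β)]
  have h5 : (1 + 1 / (c * β / 2)) * D ≤ 3 * D / (c * β) := by
    have e : 1 / (c * β / 2) = 2 * (1 / (c * β)) := by field_simp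
    have : (1 : ℝ) ≤ 1 / (c * β) := by rw [le_div_iff₀ hcβ]; linarith
    calc (1 + 1 / (c * β / 2)) * D ≤ (3 * (1 / (c * β))) * D :=
          mul_le_mul_of_nonneg_right (by linarith) hD
      _ = _ := by ring
  have h6 : (1 + c * β / 2) * (2 * β * y / c + 2 * β * b2 / c + β ^ 2 * (5 + nb) * Gsq)
      ≤ 2 * (2 * β * y / c + 2 * β * b2 / c + β ^ 2 * (5 + nb) * Gsq) :=
    mul_le_mul_of_nonneg_right (by linarith) h2
  have h7 : 2 * (2 * β * y / c + 2 * β * b2 / c + β ^ 2 * (5 + nb) * Gsq)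
      = 4 * β * y / c + 4 * β * b2 / c + 2 * β ^ 2 * (5 + nb) * Gsq := by ring
  linarith

lemma norm_roundMean_mlmc_le {V : Type*} [NormedAddCommGroup V] [NormedSpace ℝ V]
    {θ : EuclideanSpace ℝ (Fin d)} {u : S × A × S → V} {U : ℝ} (hu : ∀ z, ‖u z‖ ≤ U)
    (hT : Tmax ≠ 0) (s : S) :
    ‖roundMean M pol θ (Nat.log 2 Tmax) s (fun j ζ => mlmc Tmax j fun i => u (ζ i))‖ ≤ U := by
  rw [roundMean_mlmc hT, norm_smul, Real.norm_eq_abs, abs_of_pos (by positivity),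
    inv_mul_le_iff₀ (by positivity)]
  have := norm_sumMean_le' (M := M) (pol := pol) (θ := θ) hu (2 ^ Nat.log 2 Tmax) s
  push_cast at this
  exact this

lemma stepsize_pos (t : ℕ) (p : ℝ) : 0 < (1 + (t : ℝ)) ^ p := Real.rpow_pos_of_pos (by positivity) _

lemma stepsize_le_one (t : ℕ) {p : ℝ} (hp : 0 ≤ p) : (1 + (t : ℝ)) ^ (-p) ≤ 1 :=
  Real.rpow_le_one_of_one_le_of_nonpos (by linarith [Nat.cast_nonneg (α := ℝ) t]) (by linarith)

variable [IsProbabilityMeasure μ]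

namespace GoodRun

lemma σ_nonneg (h : GoodRun X μ ℱ M pol φ Tmax Rω ν σ η₁ B K L lam) : 0 ≤ σ :=
  (h.ν_pos.trans h.ν_lt_σ).le

lemma ν_lt_one (h : GoodRun X μ ℱ M pol φ Tmax Rω ν σ η₁ B K L lam) : ν < 1 :=
  h.ν_lt_σ.trans h.σ_lt_one

lemma rmax_nonneg (_ : GoodRun X μ ℱ M pol φ Tmax Rω ν σ η₁ B K L lam) : 0 ≤ rmax :=
  (M.r_nonneg (Classical.arbitrary S) (Classical.arbitrary A)).trans (M.r_le _ _)

lemma B_nonneg (h : GoodRun X μ ℱ M pol φ Tmax Rω ν σ η₁ B K L lam) : 0 ≤ B :=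
  (norm_nonneg _).trans (h.regular.score_bound 0 (Classical.arbitrary S) (Classical.arbitrary A))

lemma Rω_nonneg (h : GoodRun X μ ℱ M pol φ Tmax Rω ν σ η₁ B K L lam) : 0 ≤ Rω :=
  (norm_nonneg _).trans (h.target_le 0)

lemma Tmax_ne_zero (h : GoodRun X μ ℱ M pol φ Tmax Rω ν σ η₁ B K L lam) : Tmax ≠ 0 := by
  have := h.two_le; omega

lemma norm_θ_sub_le_one (h : GoodRun X μ ℱ M pol φ Tmax Rω ν σ η₁ B K L lam) {t : ℕ} (ht : 1 ≤ t)
    (w : Ω) : ‖X.θ (t + 1) w - X.θ t w‖ ≤ 1 :=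
  (h.run.norm_θ_sub_le ht w).trans (stepsize_le_one t h.σ_nonneg)

end GoodRun

lemma lawLip_nonneg (n : ℕ) {B : ℝ} (hB : 0 ≤ B) : 0 ≤ lawLip n B := by
  unfold lawLip; positivity

/-- The constant of the reward recursion. -/
def rewardConst (n : ℕ) (B rmax ν : ℝ) : ℝ :=
  8 * rmax ^ 2 / ((1 - ν) / 4) + 124 * rmax ^ 2 + 2 * (lawLip n B * rmax) ^ 2 / ((1 - ν) / 4)

/-- On an event fixing the parameter, the reward estimate and the initial state, only the mean and
second moment of the centred estimate enter, integrated exactly by `setIntegral_mlmc`. -/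
lemma GoodRun.setIntegral_rewardErr_le (h : GoodRun X μ ℱ M pol φ Tmax Rω ν σ η₁ B K L lam)
    {t : ℕ} (ht : 1 ≤ t) {D : Set Ω} (hD : MeasurableSet[ℱ t] D) {s : S}
    {θ : EuclideanSpace ℝ (Fin d)} {η : ℝ} (hθ : ∀ w ∈ D, X.θ t w = θ)
    (hη : ∀ w ∈ D, X.η t w = η) (hs : ∀ w ∈ D, X.st t 0 w = s) :
    ∫ w in D, X.rewardErr M pol (t + 1) w ∂μ
      ≤ μ.real D * ((1 - (1 + ν) / 2 * (1 + (t : ℝ)) ^ (-ν)) * (η - avgReward M pol θ) ^ 2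
        + rewardConst (Fintype.card S) B rmax ν *
          ((1 + (t : ℝ)) ^ (-ν) * (mixingTime (kernel M pol θ) / Tmax)
            + ((1 + (t : ℝ)) ^ (-ν)) ^ 2 * (mixingTime (kernel M pol θ) * Nat.log 2 Tmax)
            + ((1 + (t : ℝ)) ^ (-σ)) ^ 2 / (1 + (t : ℝ)) ^ (-ν))) := by
  have hr := h.rmax_nonneg
  have hD' : MeasurableSet D := ℱ.le t _ hD
  set γ : ℝ := (1 + (t : ℝ)) ^ (-ν) with hγdef
  set Δ : ℝ := (1 + (t : ℝ)) ^ (-σ) with hΔdef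
  have hγ : 0 < γ := stepsize_pos t _
  have hγ1 : γ ≤ 1 := stepsize_le_one t h.ν_pos.le
  have hΔ : 0 < Δ := stepsize_pos t _
  set J := avgReward M pol θ with hJ
  set ε := (1 - ν) / 4 with hε
  have hν1 := h.ν_lt_one
  -- The choice `ε = (1 - ν)/4` leaves the contraction rate `1 - 2 ε = (1 + ν)/2`, which exceeds
  -- `ν`; the summation by parts needs exactly this.
  have hε0 : 0 < ε := by rw [hε]; linarith
  have hε1 : ε ≤ 1 := by rw [hε]; linarith [h.ν_pos]
  set ℓ := lawLip (Fintype.card S) B * rmax with hℓ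
  have hℓ0 : 0 ≤ ℓ := mul_nonneg (lawLip_nonneg _ h.B_nonneg) hr
  let u : S × A × S → ℝ := fun z => M.r z.1 z.2.1 - J
  have hu : ∀ z, ‖u z‖ ≤ rmax := fun z => by
    rw [Real.norm_eq_abs, abs_le]
    constructor <;> simp only [u] <;> linarith [M.r_nonneg z.1 z.2.1, M.r_le z.1 z.2.1,
      avgReward_nonneg (M := M) (pol := pol) θ, avgReward_le (M := M) (pol := pol) θ]
  have hcent : statMean M pol θ u = 0 := by
    simp only [u]
    rw [statMean_sub, statMean_const, ← avgReward_eq_statMean, sub_self]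
  let N : Ω → ℝ := fun w => mlmc Tmax (X.lev t w) fun i => u (X.trans t w i)
  have hNfin : FinMeas mΩ N := h.run.finMeas_mlmc ht (finMeas_const ()) fun _ z => u z
  set b := roundMean M pol θ (Nat.log 2 Tmax) s (fun j ζ => mlmc Tmax j fun i => u (ζ i)) with hb
  set V := roundMean M pol θ (Nat.log 2 Tmax) s
    (fun j ζ => ‖mlmc Tmax j fun i => u (ζ i)‖ ^ 2) with hV
  have hIN : ∫ w in D, N w ∂μ = μ.real D * b :=
    h.run.setIntegral_mlmc h.Tmax_ne_zero ht hD hθ hs u id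
  have hIV : ∫ w in D, N w ^ 2 ∂μ = μ.real D * V := by
    have := h.run.setIntegral_mlmc h.Tmax_ne_zero ht hD hθ hs u fun v => ‖v‖ ^ 2
    rw [smul_eq_mul, ← hV] at this
    rw [← this]
    exact integral_congr_ae (ae_of_all _ fun w => by simp only [N, Real.norm_eq_abs, sq_abs])
  have hb2 : b ^ 2 ≤ 4 * rmax ^ 2 * (mixingTime (kernel M pol θ) / Tmax) := by
    have := norm_roundMean_mlmc_sq_le h.ergodic hu hcent h.Tmax_ne_zero s
    rwa [Real.norm_eq_abs, sq_abs] at this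
  have hV2 : V ≤ 62 * (mixingTime (kernel M pol θ) * Nat.log 2 Tmax) * rmax ^ 2 :=
    roundMean_norm_mlmc_sq_le h.ergodic hu hcent h.two_le s
  have hpt : ∀ w ∈ D, X.rewardErr M pol (t + 1) w
      ≤ (1 + ε * γ) * ((1 - γ) ^ 2 * (η - J) ^ 2) + (1 + 1 / (ε * γ)) * (ℓ * Δ) ^ 2
        + ((1 + ε * γ) * (2 * γ * (1 - γ) * (η - J))) * N w + ((1 + ε * γ) * γ ^ 2) * N w ^ 2 := by
    intro w hw
    -- A constant passes through the multi-level estimate unchanged, so the noise `N` is built from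
    -- samples bounded by `rmax` although `η` is not projected.
    have hf : X.fMLMC M Tmax t w = (η - J) + -N w := by
      have e : (fun i => X.η t w - M.r (X.st t i w) (X.act t i w))
          = fun i => (η - J) + -u (X.trans t w i) := by
        ext1 i
        simp only [u, Iterates.trans, hη w hw]; ring
      rw [Iterates.fMLMC, e, mlmc_const_add, mlmc_neg]
    have h1 : X.η (t + 1) w - J = (1 - γ) * (η - J) + γ * N w := by
      rw [h.run.η_step t ht, hη w hw, hf]; ring
    have h2 : |avgReward M pol (X.θ (t + 1) w) - J| ≤ ℓ * Δ := by
      have e1 := abs_avgReward_sub_le (M := M) h.regular h.ergodic h.B_nonneg hr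
        (h.norm_θ_sub_le_one ht w)
      rw [hθ w hw] at e1
      have e2 := h.run.norm_θ_sub_le ht w
      rw [hθ w hw] at e2
      refine e1.trans ?_
      rw [hℓ, mul_right_comm]
      exact mul_le_mul_of_nonneg_left e2 hℓ0
    have h3 : X.rewardErr M pol (t + 1) w
        ≤ (1 + ε * γ) * (X.η (t + 1) w - J) ^ 2
          + (1 + 1 / (ε * γ)) * (J - avgReward M pol (X.θ (t + 1) w)) ^ 2 := by
      rw [Iterates.rewardErr]
      have := add_sq_le_young (a := X.η (t + 1) w - J)
        (b := J - avgReward M pol (X.θ (t + 1) w)) (mul_pos hε0 hγ)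
      rwa [sub_add_sub_cancel] at this
    have h4 : (J - avgReward M pol (X.θ (t + 1) w)) ^ 2 ≤ (ℓ * Δ) ^ 2 := by
      rw [← sq_abs, abs_sub_comm]
      exact pow_le_pow_left₀ (abs_nonneg _) h2 2
    have h5 : 0 ≤ 1 + 1 / (ε * γ) := by positivity
    refine h3.trans ?_
    rw [h1]
    have h6 := mul_le_mul_of_nonneg_left h4 h5
    linarith
  have hfin : FinMeas mΩ (X.rewardErr M pol (t + 1)) :=
    (h.run.finMeas_rewardErr (by omega : 1 ≤ t + 1)).mono (ℱ.le _)
  have hN2fin : FinMeas mΩ fun w => N w ^ 2 := hNfin.comp fun v => v ^ 2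
  set c0 := (1 + ε * γ) * ((1 - γ) ^ 2 * (η - J) ^ 2) + (1 + 1 / (ε * γ)) * (ℓ * Δ) ^ 2
  set c1 := (1 + ε * γ) * (2 * γ * (1 - γ) * (η - J))
  set c2 := (1 + ε * γ) * γ ^ 2
  have hbound : FinMeas mΩ fun w => c0 + c1 * N w + c2 * N w ^ 2 :=
    hNfin.comp fun v => c0 + c1 * v + c2 * v ^ 2
  refine (setIntegral_mono_on (hfin.integrable μ).integrableOn
    (hbound.integrable μ).integrableOn hD' hpt).trans ?_
  rw [setIntegral_add_mul_add_mul (hNfin.integrable μ) (hN2fin.integrable μ), hIN, hIV,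
    mul_left_comm c1, mul_left_comm c2, ← mul_add, ← mul_add]
  refine mul_le_mul_of_nonneg_left ?_ measureReal_nonneg
  have hτ0 : 0 ≤ (mixingTime (kernel M pol θ) : ℝ) := Nat.cast_nonneg _
  set q : ℝ := mixingTime (kernel M pol θ) * Nat.log 2 Tmax with hq
  set e : ℝ := mixingTime (kernel M pol θ) / Tmax with he
  have hq0 : 0 ≤ q := by positivity
  have he0 : 0 ≤ e := by positivity
  have hVq : 0 ≤ 62 * q * rmax ^ 2 := by positivity
  have hstep := reward_step_le (e := η - J) (b := b) (V := 62 * q * rmax ^ 2) (D := (ℓ * Δ) ^ 2)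
    hγ hγ1 hε0 hε1 hVq (sq_nonneg _)
  have hc2 : 0 ≤ c2 := by positivity
  have h1 : c0 + c1 * b + c2 * V ≤ (1 + ε * γ) * ((1 - γ) ^ 2 * (η - J) ^ 2
      + 2 * γ * (1 - γ) * ((η - J) * b) + γ ^ 2 * (62 * q * rmax ^ 2))
      + (1 + 1 / (ε * γ)) * (ℓ * Δ) ^ 2 := by
    have := mul_le_mul_of_nonneg_left hV2 hc2
    simp only [c0, c1, c2] at this ⊢
    linarith
  refine h1.trans (hstep.trans ?_)
  have hκ : (1 + ν) / 2 = 1 - 2 * ε := by rw [hε]; ring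
  rw [hκ]
  refine add_le_add le_rfl ?_
  have h2 : 2 * γ * b ^ 2 / ε ≤ (8 * rmax ^ 2 / ε) * (γ * e) := by
    calc 2 * γ * b ^ 2 / ε ≤ 2 * γ * (4 * rmax ^ 2 * e) / ε := by gcongr
      _ = _ := by ring
  have h3 : 2 * (ℓ * Δ) ^ 2 / (ε * γ) = (2 * ℓ ^ 2 / ε) * (Δ ^ 2 / γ) := by
    field_simp
  rw [h3, rewardConst, ← hε, ← hℓ]
  refine le_trans ?_ (sum_mul_le_mul_sum (k₁ := 8 * rmax ^ 2 / ε) (k₂ := 124 * rmax ^ 2)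
    (k₃ := 2 * ℓ ^ 2 / ε) (x₁ := γ * e) (x₂ := γ ^ 2 * q) (x₃ := Δ ^ 2 / γ) (by positivity)
    (by positivity) (by positivity) (by positivity) (by positivity) (by positivity))
  refine add_le_add (add_le_add h2 (le_of_eq ?_)) le_rfl
  ring

end OneStep

/-! ### One round of the critic. -/

noncomputable section CriticStep

variable {S A : Type*} [Fintype S] [DecidableEq S] [Fintype A] {rmax : ℝ} {d m : ℕ}
  {M : MDP S A rmax} {pol : PolicyClass S A d} {φ : S → EuclideanSpace ℝ (Fin m)}
  {B K L lam Rω ν σ η₁ : ℝ} {Tmax : ℕ}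
  {Ω : Type*} [mΩ : MeasurableSpace Ω] {μ : Measure Ω} {ℱ : Filtration ℕ mΩ}
  {X : Iterates Ω S A d m} [Nonempty S] [Nonempty A] [IsProbabilityMeasure μ]

/-- The constant of the critic recursion. -/
def criticConst (n m : ℕ) (B lam rmax Rω : ℝ) : ℝ :=
  (132 / coercConst m lam + 1012)
    + (128 * (rmax + 2 * Rω) ^ 2 / coercConst m lam + 1012 * (rmax + 2 * Rω) ^ 2 + 1012)
    + 3 * criticLip n m B lam rmax Rω ^ 2 / coercConst m lam

/-- Since `A_θ ω* = b_θ`, the mean direction is `-A_θ (ω - ω*)` plus the reward perturbation: the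
former gives coercivity, the latter the cross term. -/
lemma inner_statMean_tdSample_le (hlam : 0 < lam) (hφ : ∀ s, ‖φ s‖ ≤ 1)
    (hA : CriticPosDef M pol φ lam) (θ : EuclideanSpace ℝ (Fin d)) (η : ℝ)
    (ω : EuclideanSpace ℝ (Fin m)) :
    inner ℝ (statMean M pol θ (tdSample M φ η ω)) (ω - criticTarget M pol φ θ)
      ≤ -(coercConst m lam) * ‖ω - criticTarget M pol φ θ‖ ^ 2
        + |η - avgReward M pol θ| * ‖ω - criticTarget M pol φ θ‖ := by
  set v := ω - criticTarget M pol φ θ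
  have h1 : statMean M pol θ (tdSample M φ η ω) = -tdMap M pol φ θ v
      + (avgReward M pol θ - η) • statMean M pol θ (fun z => φ z.1) := by
    rw [statMean_tdSample, ← tdMap_criticTarget hlam hA, ← tdMap_sub, ← neg_sub ω]
    congr 1
    simp only [tdMap, WithLp.ofLp_neg, Matrix.mulVec_neg, WithLp.toLp_neg, v]
  rw [h1, inner_add_left, inner_neg_left, inner_smul_left, conj_trivial]
  have h2 := coercConst_mul_le_inner hlam hφ hA θ v
  have h3 : ‖statMean M pol θ (fun z => φ z.1)‖ ≤ 1 := norm_statMean_le θ fun z => hφ _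
  have h4 : (avgReward M pol θ - η) * inner ℝ (statMean M pol θ (fun z => φ z.1)) v
      ≤ |η - avgReward M pol θ| * ‖v‖ := by
    refine (le_abs_self _).trans ?_
    rw [abs_mul, abs_sub_comm]
    refine mul_le_mul_of_nonneg_left ?_ (abs_nonneg _)
    exact (abs_real_inner_le_norm _ _).trans (mul_le_of_le_one_left (norm_nonneg _) h3)
  linarith

lemma GoodRun.setIntegral_criticErr_le_aux
    (h : GoodRun X μ ℱ M pol φ Tmax Rω ν σ η₁ B K L lam)
    {t : ℕ} (ht : 1 ≤ t) {D : Set Ω} (hD : MeasurableSet[ℱ t] D) {s : S}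
    {θ : EuclideanSpace ℝ (Fin d)} {η : ℝ} {ω : EuclideanSpace ℝ (Fin m)}
    (hθ : ∀ w ∈ D, X.θ t w = θ) (hη : ∀ w ∈ D, X.η t w = η) (hω : ∀ w ∈ D, X.ω t w = ω)
    (hs : ∀ w ∈ D, X.st t 0 w = s) (hωR : ‖ω‖ ≤ Rω) {c β y q e G Λ : ℝ}
    (hc : c = coercConst m lam) (hβ : β = (1 + (t : ℝ)) ^ (-ν))
    (hy : y = (η - avgReward M pol θ) ^ 2)
    (hq : q = mixingTime (kernel M pol θ) * Nat.log 2 Tmax)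
    (he : e = mixingTime (kernel M pol θ) / Tmax)
    (hG : G = rmax + |η - avgReward M pol θ| + 2 * Rω)
    (hΛ : Λ = criticLip (Fintype.card S) m B lam rmax Rω * (1 + (t : ℝ)) ^ (-σ)) :
    ∃ b2, 0 ≤ b2 ∧ b2 ≤ 16 * G ^ 2 * e ∧ b2 ≤ 4 * G ^ 2 ∧
    ∫ w in D, X.criticErr M pol φ (t + 1) w ∂μ
      ≤ μ.real D * ((1 - c * β / 2) * ‖ω - criticTarget M pol φ θ‖ ^ 2
        + (4 * β * y / c + 4 * β * b2 / c + 2 * β ^ 2 * (5 + 248 * q) * G ^ 2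
          + 3 * Λ ^ 2 / (c * β))) := by
  have hr := h.rmax_nonneg
  have hR := h.Rω_nonneg
  have hD' : MeasurableSet D := ℱ.le t _ hD
  have hβ0 : 0 < β := by rw [hβ]; exact stepsize_pos t _
  have hβ1 : β ≤ 1 := by rw [hβ]; exact stepsize_le_one t h.ν_pos.le
  have hc0 : 0 < c := by rw [hc]; exact coercConst_pos _ _
  have hc1 : c ≤ 1 := by rw [hc]; exact coercConst_le_one _ _
  have hq0 : 0 ≤ q := by rw [hq]; positivity
  set J := avgReward M pol θ with hJ
  set ωs := criticTarget M pol φ θ with hωs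
  have hG0 : 0 ≤ G := by rw [hG]; positivity
  set g := statMean M pol θ (tdSample M φ η ω) with hg
  -- Unlike the noise of the reward tracker, this noise is bounded only by `2 G`, where `G` contains
  -- the current reward error `|η - J|`.
  let u : S × A × S → EuclideanSpace ℝ (Fin m) := fun z => tdSample M φ η ω z - g
  have hsample : ∀ z, ‖tdSample M φ η ω z‖ ≤ G := fun z => by
    refine (norm_tdSample_le (D := rmax + |η - J|) h.feature_le η ω (fun s a => ?_) z).trans (by linarith)
    have e1 : M.r s a - η = (M.r s a - J) + (J - η) := by ring
    rw [e1, abs_sub_comm η J]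
    refine (abs_add_le _ _).trans (add_le_add ?_ le_rfl)
    rw [abs_le]
    constructor <;> linarith [M.r_nonneg s a, M.r_le s a,
      avgReward_nonneg (M := M) (pol := pol) θ, avgReward_le (M := M) (pol := pol) θ]
  have hgG : ‖g‖ ≤ G := norm_statMean_le θ hsample
  have hu : ∀ z, ‖u z‖ ≤ 2 * G := fun z => (norm_sub_le _ _).trans (by linarith [hsample z])
  have hcent : statMean M pol θ u = 0 := by
    simp only [u]
    rw [statMean_sub, statMean_const, sub_self]
  let N : Ω → EuclideanSpace ℝ (Fin m) := fun w =>
    mlmc Tmax (X.lev t w) fun i => u (X.trans t w i)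
  have hNfin : FinMeas mΩ N := h.run.finMeas_mlmc ht (finMeas_const ()) fun _ z => u z
  set b := roundMean M pol θ (Nat.log 2 Tmax) s (fun j ζ => mlmc Tmax j fun i => u (ζ i)) with hb
  set V := roundMean M pol θ (Nat.log 2 Tmax) s
    (fun j ζ => ‖mlmc Tmax j fun i => u (ζ i)‖ ^ 2) with hV
  have hIN : ∫ w in D, N w ∂μ = μ.real D • b :=
    h.run.setIntegral_mlmc h.Tmax_ne_zero ht hD hθ hs u id
  have hIV : ∫ w in D, ‖N w‖ ^ 2 ∂μ = μ.real D * V :=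
    h.run.setIntegral_mlmc h.Tmax_ne_zero ht hD hθ hs u fun v => ‖v‖ ^ 2
  have hb2 : ‖b‖ ^ 2 ≤ 16 * G ^ 2 * e := by
    have := norm_roundMean_mlmc_sq_le h.ergodic hu hcent h.Tmax_ne_zero s
    rw [he]
    linarith
  have hbG : ‖b‖ ≤ 2 * G := norm_roundMean_mlmc_le hu h.Tmax_ne_zero s
  have hV2 : V ≤ (248 * q) * G ^ 2 := by
    have := roundMean_norm_mlmc_sq_le h.ergodic hu hcent h.two_le s
    rw [hq]
    linarith
  set v := ω - ωs with hv
  set p := v + β • g with hp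
  have hcβ : 0 < c * β / 2 := by positivity
  have hpt : ∀ w ∈ D, X.criticErr M pol φ (t + 1) w
      ≤ ((1 + c * β / 2) * ‖p‖ ^ 2 + (1 + 1 / (c * β / 2)) * Λ ^ 2)
        + ((1 + c * β / 2) * (2 * β)) * inner ℝ p (N w)
        + ((1 + c * β / 2) * β ^ 2) * ‖N w‖ ^ 2 := by
    intro w hw
    have hgm : X.gMLMC M φ Tmax t w = g + N w := by
      have e1 : (fun i => X.td M φ t i w • φ (X.st t i w))
          = fun i => g + u (X.trans t w i) := by
        ext1 i
        simp only [u, Iterates.trans, Iterates.td, tdSample, hη w hw, hω w hw, add_sub_cancel]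
      rw [Iterates.gMLMC, e1, mlmc_const_add]
    -- The old target lies in the ball, so projecting does not increase the distance to it; the move
    -- to the new target is charged to `Λ`.
    have h1 : ‖X.ω (t + 1) w - ωs‖ ≤ ‖p + β • N w‖ := by
      rw [h.run.ω_step t ht, hω w hw, hgm, ← hβ]
      refine (norm_projBall_sub_le _ _ (h.target_le θ)).trans (le_of_eq ?_)
      congr 1
      rw [hp, hv, smul_add]; abel
    have h2 : ‖ωs - criticTarget M pol φ (X.θ (t + 1) w)‖ ≤ Λ := by
      have e1 := norm_criticTarget_sub_le h.lam_pos h.feature_le h.regular h.ergodic h.B_nonneg hr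
        h.posDef h.target_le (h.norm_θ_sub_le_one ht w)
      rw [hθ w hw] at e1
      have e2 := h.run.norm_θ_sub_le ht w
      rw [hθ w hw] at e2
      rw [norm_sub_rev]
      refine e1.trans ?_
      rw [hΛ]
      refine mul_le_mul_of_nonneg_left e2 ?_
      exact mul_nonneg (invBound_nonneg m h.lam_pos)
        (mul_nonneg (lawLip_nonneg _ h.B_nonneg) (by positivity))
    have h3 : X.criticErr M pol φ (t + 1) w ≤ (1 + c * β / 2) * ‖p + β • N w‖ ^ 2
        + (1 + 1 / (c * β / 2)) * Λ ^ 2 := by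
      have e1 : ‖X.ω (t + 1) w - criticTarget M pol φ (X.θ (t + 1) w)‖ ≤ ‖p + β • N w‖ + Λ := by
        rw [← sub_add_sub_cancel _ ωs]
        exact (norm_add_le _ _).trans (add_le_add h1 h2)
      rw [Iterates.criticErr]
      exact (pow_le_pow_left₀ (norm_nonneg _) e1 2).trans (add_sq_le_young hcβ)
    have h4 : ‖p + β • N w‖ ^ 2 = ‖p‖ ^ 2 + 2 * (β * inner ℝ p (N w)) + β ^ 2 * ‖N w‖ ^ 2 := by
      rw [norm_add_sq_real, inner_smul_right, norm_smul, mul_pow, Real.norm_eq_abs, sq_abs]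
    rw [h4] at h3
    refine h3.trans (le_of_eq ?_)
    ring
  have hfin : FinMeas mΩ (X.criticErr M pol φ (t + 1)) :=
    (h.run.finMeas_criticErr (by omega : 1 ≤ t + 1)).mono (ℱ.le _)
  have hN1fin : FinMeas mΩ fun w => (inner ℝ p (N w) : ℝ) := hNfin.comp fun x => inner ℝ p x
  have hN2fin : FinMeas mΩ fun w => ‖N w‖ ^ 2 := hNfin.comp fun x => ‖x‖ ^ 2
  have hINp : ∫ w in D, inner ℝ p (N w) ∂μ = μ.real D * inner ℝ p b := by
    rw [integral_inner ((hNfin.integrable μ).integrableOn) p, hIN, inner_smul_right]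
  refine ⟨‖b‖ ^ 2, sq_nonneg _, hb2, by nlinarith [norm_nonneg b], ?_⟩
  set c0 := (1 + c * β / 2) * ‖p‖ ^ 2 + (1 + 1 / (c * β / 2)) * Λ ^ 2 with hc0'
  set c1 := (1 + c * β / 2) * (2 * β) with hc1'
  set c2 := (1 + c * β / 2) * β ^ 2 with hc2'
  have hbound : FinMeas mΩ fun w => c0 + c1 * inner ℝ p (N w) + c2 * ‖N w‖ ^ 2 :=
    hNfin.comp fun x => c0 + c1 * inner ℝ p x + c2 * ‖x‖ ^ 2
  refine (setIntegral_mono_on (hfin.integrable μ).integrableOn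
    (hbound.integrable μ).integrableOn hD' hpt).trans ?_
  rw [setIntegral_add_mul_add_mul (hN1fin.integrable μ) (hN2fin.integrable μ), hINp, hIV,
    mul_left_comm c1, mul_left_comm c2, ← mul_add, ← mul_add]
  refine mul_le_mul_of_nonneg_left ?_ measureReal_nonneg
  have hy0 : 0 ≤ y := by rw [hy]; exact sq_nonneg _
  have hyabs : |η - J| ^ 2 = y := by rw [sq_abs, hy]
  have hvg : 2 * inner ℝ g v ≤ -(2 * c) * ‖v‖ ^ 2 + ((c / 2) * ‖v‖ ^ 2 + 2 * y / c) := by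
    have e1 := inner_statMean_tdSample_le h.lam_pos h.feature_le h.posDef θ η ω
    rw [← hg, ← hωs, ← hv, ← hJ, ← hc] at e1
    have e2 := two_mul_mul_le_young ‖v‖ |η - J| (half_pos hc0)
    rw [hyabs] at e2
    have e3 : y / (c / 2) = 2 * y / c := by field_simp
    rw [e3] at e2
    linarith
  have hvb : 2 * inner ℝ v b ≤ (c / 2) * ‖v‖ ^ 2 + 2 * ‖b‖ ^ 2 / c := by
    have e1 := real_inner_le_norm v b
    have e2 := two_mul_mul_le_young ‖v‖ ‖b‖ (half_pos hc0)
    have e3 : ‖b‖ ^ 2 / (c / 2) = 2 * ‖b‖ ^ 2 / c := by field_simp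
    rw [e3] at e2
    linarith
  have hgb : 2 * inner ℝ g b ≤ 4 * G ^ 2 := by
    have e1 := real_inner_le_norm g b
    have e2 := mul_le_mul hgG hbG (norm_nonneg _) hG0
    linarith
  have hgg : ‖g‖ ^ 2 ≤ G ^ 2 := pow_le_pow_left₀ (norm_nonneg _) hgG 2
  have hfinal := critic_step_le hβ0 hβ1 hc0 hc1 (sq_nonneg ‖v‖) (sq_nonneg Λ) hy0
    (sq_nonneg ‖b‖) hvg hvb hgb hgg hV2 (sq_nonneg G) (by positivity : 0 ≤ 248 * q)
  refine le_trans ?_ hfinal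
  have hp2 : ‖p‖ ^ 2 = ‖v‖ ^ 2 + 2 * β * inner ℝ g v + β ^ 2 * ‖g‖ ^ 2 := by
    rw [hp, norm_add_sq_real, inner_smul_right, norm_smul, mul_pow, Real.norm_eq_abs, sq_abs,
      real_inner_comm]
    ring
  have hpb : (inner ℝ p b : ℝ) = inner ℝ v b + β * inner ℝ g b := by
    rw [hp, inner_add_left, inner_smul_left, conj_trivial]
  have hc2n : 0 ≤ c2 := by positivity
  have := mul_le_mul_of_nonneg_left hV2 hc2n
  rw [hpb]
  rw [hc0', hp2]
  rw [hc2'] at this ⊢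
  rw [hc1']
  linarith

end CriticStep

/-! ### The recursions in expectation. -/

noncomputable section Recursions

variable {S A : Type*} [Fintype S] [DecidableEq S] [Fintype A] {rmax : ℝ} {d m : ℕ}
  {M : MDP S A rmax} {pol : PolicyClass S A d} {φ : S → EuclideanSpace ℝ (Fin m)}
  {B K L lam Rω ν σ η₁ : ℝ} {Tmax : ℕ}
  {Ω : Type*} [mΩ : MeasurableSpace Ω] {μ : Measure Ω} {ℱ : Filtration ℕ mΩ}
  {X : Iterates Ω S A d m} [Nonempty S] [Nonempty A] [IsProbabilityMeasure μ]

/-- The two bounds on the squared bias avoid a product `e * y`: the mixing bound is used for `e ≤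
1`, the trivial one for `e ≥ 1`, giving `32 (G₀² e + y)` in both cases. The product `q * y` in the
second moment remains and is left for the weights. -/
lemma critic_bound_le {β y c b2 q G G₀ Λ e ℓ Δ : ℝ} (hβ : 0 < β) (hc : 0 < c) (hy : 0 ≤ y)
    (he : 0 ≤ e) (hq : 1 ≤ q) (hG : G ^ 2 ≤ 2 * (G₀ ^ 2 + y)) (hb : b2 ≤ 16 * G ^ 2 * e)
    (hb' : b2 ≤ 4 * G ^ 2) (hΛ : Λ = ℓ * Δ) :
    4 * β * y / c + 4 * β * b2 / c + 2 * β ^ 2 * (5 + 248 * q) * G ^ 2 + 3 * Λ ^ 2 / (c * β)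
      ≤ ((132 / c + 1012) + (128 * G₀ ^ 2 / c + 1012 * G₀ ^ 2 + 1012) + 3 * ℓ ^ 2 / c)
        * ((β * y + β ^ 2 * q * y) + (β * e + β ^ 2 * q) + Δ ^ 2 / β) := by
  have hb2 : b2 ≤ 32 * (G₀ ^ 2 * e + y) := by
    rcases le_total e 1 with h1 | h1
    · have e1 : G ^ 2 * e ≤ 2 * (G₀ ^ 2 + y) * e := mul_le_mul_of_nonneg_right hG he
      nlinarith [mul_le_of_le_one_right hy h1]
    · nlinarith [le_mul_of_one_le_right (sq_nonneg G₀) h1]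
  have h1 : 4 * β * b2 / c ≤ 4 * β * (32 * (G₀ ^ 2 * e + y)) / c := by gcongr
  have h2 : 2 * β ^ 2 * (5 + 248 * q) * G ^ 2 ≤ 2 * β ^ 2 * (253 * q) * (2 * (G₀ ^ 2 + y)) := by
    have e1 : 5 + 248 * q ≤ 253 * q := by linarith
    gcongr
  have h3 : 3 * Λ ^ 2 / (c * β) = (3 * ℓ ^ 2 / c) * (Δ ^ 2 / β) := by
    rw [hΛ]; field_simp
  have x1 : 0 ≤ β * y := by positivity
  have x2 : 0 ≤ β ^ 2 * q * y := by positivity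
  have x3 : 0 ≤ β * e := by positivity
  have x4 : 0 ≤ β ^ 2 * q := by positivity
  have x5 : 0 ≤ Δ ^ 2 / β := by positivity
  have k1 : 0 ≤ 132 / c := by positivity
  have k2 : 0 ≤ 128 * G₀ ^ 2 / c := by positivity
  have k3 : 0 ≤ 1012 * G₀ ^ 2 := by positivity
  refine le_trans ?_ (sum_mul_le_mul_sum (k₁ := 132 / c + 1012)
    (k₂ := 128 * G₀ ^ 2 / c + 1012 * G₀ ^ 2 + 1012) (k₃ := 3 * ℓ ^ 2 / c)
    (by positivity) (by positivity) (by positivity) (add_nonneg x1 x2) (add_nonneg x3 x4) x5)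
  have h4 : 4 * β * y / c + 4 * β * (32 * (G₀ ^ 2 * e + y)) / c
      = (132 / c) * (β * y) + (128 * G₀ ^ 2 / c) * (β * e) := by ring
  have h5 : 2 * β ^ 2 * (253 * q) * (2 * (G₀ ^ 2 + y))
      = 1012 * G₀ ^ 2 * (β ^ 2 * q) + 1012 * (β ^ 2 * q * y) := by ring
  rw [h3]
  nlinarith [mul_nonneg k1 x2, mul_nonneg k2 x4, mul_nonneg k3 x3]

lemma GoodRun.setIntegral_criticErr_le (h : GoodRun X μ ℱ M pol φ Tmax Rω ν σ η₁ B K L lam)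
    {t : ℕ} (ht : 1 ≤ t) {D : Set Ω} (hD : MeasurableSet[ℱ t] D) {s : S}
    {θ : EuclideanSpace ℝ (Fin d)} {η : ℝ} {ω : EuclideanSpace ℝ (Fin m)}
    (hθ : ∀ w ∈ D, X.θ t w = θ) (hη : ∀ w ∈ D, X.η t w = η) (hω : ∀ w ∈ D, X.ω t w = ω)
    (hs : ∀ w ∈ D, X.st t 0 w = s) (hωR : ‖ω‖ ≤ Rω) {β y q e : ℝ}
    (hβ : β = (1 + (t : ℝ)) ^ (-ν)) (hy : y = (η - avgReward M pol θ) ^ 2)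
    (hq : q = mixingTime (kernel M pol θ) * Nat.log 2 Tmax)
    (he : e = mixingTime (kernel M pol θ) / Tmax) :
    ∫ w in D, X.criticErr M pol φ (t + 1) w ∂μ
      ≤ μ.real D * ((1 - coercConst m lam * β / 2) * ‖ω - criticTarget M pol φ θ‖ ^ 2
        + criticConst (Fintype.card S) m B lam rmax Rω * ((β * y + β ^ 2 * q * y)
          + (β * e + β ^ 2 * q) + ((1 + (t : ℝ)) ^ (-σ)) ^ 2 / β)) := by
  obtain ⟨b2, hb0, hb1, hb2, hint⟩ := h.setIntegral_criticErr_le_aux ht hD hθ hη hω hs hωR rfl hβ hy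
    hq he rfl rfl
  refine hint.trans (mul_le_mul_of_nonneg_left (add_le_add le_rfl ?_) measureReal_nonneg)
  have hτ : (1 : ℝ) ≤ mixingTime (kernel M pol θ) := by
    exact_mod_cast one_le_mixingTime h.ergodic θ
  have hJ : (1 : ℝ) ≤ Nat.log 2 Tmax := by exact_mod_cast Nat.log_pos one_lt_two h.two_le
  refine critic_bound_le (hβ ▸ stepsize_pos t _) (coercConst_pos _ _) (hy ▸ sq_nonneg _)
    (by rw [he]; positivity) (by rw [hq]; exact one_le_mul_of_one_le_of_one_le hτ hJ) ?_ hb1 hb2 rfl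
  rw [hy, ← sq_abs (η - _)]
  nlinarith [sq_nonneg ((rmax + 2 * Rω) - |η - avgReward M pol θ|)]

/-- The bound on a fibre is affine in the reward error and the mixing time separately, so summing
over fibres produces only their expectations. -/
lemma GoodRun.integral_rewardErr_succ_le (h : GoodRun X μ ℱ M pol φ Tmax Rω ν σ η₁ B K L lam)
    {t : ℕ} (ht : 1 ≤ t) :
    ∫ w, X.rewardErr M pol (t + 1) w ∂μ
      ≤ (1 - (1 + ν) / 2 * (1 + (t : ℝ)) ^ (-ν)) * ∫ w, X.rewardErr M pol t w ∂μ
        + rewardConst (Fintype.card S) B rmax ν *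
          ((1 + (t : ℝ)) ^ (-ν) * ((∫ w, (mixingTime (kernel M pol (X.θ t w)) : ℝ) ∂μ) / Tmax)
            + ((1 + (t : ℝ)) ^ (-ν)) ^ 2 *
              ((∫ w, (mixingTime (kernel M pol (X.θ t w)) : ℝ) ∂μ) * Nat.log 2 Tmax)
            + ((1 + (t : ℝ)) ^ (-σ)) ^ 2 / (1 + (t : ℝ)) ^ (-ν)) := by
  set β : ℝ := (1 + (t : ℝ)) ^ (-ν)
  set Δ : ℝ := (1 + (t : ℝ)) ^ (-σ)
  set C := rewardConst (Fintype.card S) B rmax ν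
  have hV : FinMeas (ℱ t) fun w => (X.θ t w, X.η t w, X.st t 0 w) :=
    (h.run.finMeas_θ ht).prodMk ((h.run.finMeas_η ht).prodMk (h.run.finMeas_start ht))
  let G : EuclideanSpace ℝ (Fin d) → ℝ → ℝ := fun θ η =>
    (1 - (1 + ν) / 2 * β) * (η - avgReward M pol θ) ^ 2
      + C * (β * (mixingTime (kernel M pol θ) / Tmax)
        + β ^ 2 * (mixingTime (kernel M pol θ) * Nat.log 2 Tmax) + Δ ^ 2 / β)
  have hG : FinMeas mΩ fun w => G (X.θ t w) (X.η t w) :=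
    ((h.run.finMeas_θ ht).comp₂ (h.run.finMeas_η ht) G).mono (ℱ.le _)
  have hR1 : FinMeas mΩ (X.rewardErr M pol (t + 1)) :=
    (h.run.finMeas_rewardErr (by omega : 1 ≤ t + 1)).mono (ℱ.le _)
  have hR0 : Integrable (X.rewardErr M pol t) μ :=
    ((h.run.finMeas_rewardErr ht).mono (ℱ.le _)).integrable μ
  have hτ : Integrable (fun w => (mixingTime (kernel M pol (X.θ t w)) : ℝ)) μ :=
    (((h.run.finMeas_mixingTime ht).mono (ℱ.le _)).comp fun n : ℕ => (n : ℝ)).integrable μ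
  have key : ∫ w, X.rewardErr M pol (t + 1) w ∂μ ≤ ∫ w, G (X.θ t w) (X.η t w) ∂μ := by
    refine (hV.mono (ℱ.le _)).integral_le (hR1.integrable μ) (hG.integrable μ) ?_
    rintro ⟨θ, η, s⟩
    have hD := hV.fiber (θ, η, s)
    have hDθ : ∀ w ∈ (fun w => (X.θ t w, X.η t w, X.st t 0 w)) ⁻¹' {(θ, η, s)},
        X.θ t w = θ ∧ X.η t w = η ∧ X.st t 0 w = s := by
      intro w hw
      simpa only [Set.mem_preimage, Set.mem_singleton_iff, Prod.mk.injEq] using hw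
    refine (h.setIntegral_rewardErr_le ht hD (fun w hw => (hDθ w hw).1)
      (fun w hw => (hDθ w hw).2.1) (fun w hw => (hDθ w hw).2.2)).trans (le_of_eq ?_)
    rw [setIntegral_congr_fun (g := fun _ => G θ η) (ℱ.le _ _ hD) (fun w hw => by
      simp only [(hDθ w hw).1, (hDθ w hw).2.1]), setIntegral_const, smul_eq_mul]
  refine key.trans (le_of_eq ?_)
  have e1 : (fun w => G (X.θ t w) (X.η t w)) = fun w =>
      C * (Δ ^ 2 / β) + (1 - (1 + ν) / 2 * β) * X.rewardErr M pol t w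
        + C * (β / Tmax + β ^ 2 * Nat.log 2 Tmax) * mixingTime (kernel M pol (X.θ t w)) := by
    ext1 w
    simp only [G, Iterates.rewardErr]; ring
  have e2 := setIntegral_add_mul_add_mul (μ := μ) hR0 hτ Set.univ (C * (Δ ^ 2 / β))
    (1 - (1 + ν) / 2 * β) (C * (β / Tmax + β ^ 2 * Nat.log 2 Tmax))
  rw [setIntegral_univ, setIntegral_univ, setIntegral_univ, probReal_univ] at e2
  rw [e1, e2]
  ring

/-- A weight known at the start of the round is constant on the fibres and passes through the
conditional bound. It must enter before taking expectations, since the mixing time and the reward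
error are correlated. -/
lemma GoodRun.integral_mul_criticErr_succ_le
    (h : GoodRun X μ ℱ M pol φ Tmax Rω ν σ η₁ B K L lam) {t : ℕ} (ht : 1 ≤ t) {W : Ω → ℝ}
    (hW : FinMeas (ℱ t) W) (hW0 : ∀ w, 0 ≤ W w) {β : ℝ} (hβ : β = (1 + (t : ℝ)) ^ (-ν))
    {q e : Ω → ℝ} (hq : ∀ w, q w = (mixingTime (kernel M pol (X.θ t w)) : ℝ) * Nat.log 2 Tmax)
    (he : ∀ w, e w = (mixingTime (kernel M pol (X.θ t w)) : ℝ) / Tmax) :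
    ∫ w, W w * X.criticErr M pol φ (t + 1) w ∂μ
      ≤ ∫ w, W w * ((1 - coercConst m lam * β / 2) * X.criticErr M pol φ t w
        + criticConst (Fintype.card S) m B lam rmax Rω *
          ((β * X.rewardErr M pol t w + β ^ 2 * q w * X.rewardErr M pol t w)
            + (β * e w + β ^ 2 * q w) + ((1 + (t : ℝ)) ^ (-σ)) ^ 2 / β)) ∂μ := by
  set Δ : ℝ := (1 + (t : ℝ)) ^ (-σ)
  set C := criticConst (Fintype.card S) m B lam rmax Rω
  let V : Ω → EuclideanSpace ℝ (Fin d) × ℝ × EuclideanSpace ℝ (Fin m) × S × ℝ := fun w =>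
    (X.θ t w, X.η t w, X.ω t w, X.st t 0 w, W w)
  have hV : FinMeas (ℱ t) V :=
    (h.run.finMeas_θ ht).prodMk ((h.run.finMeas_η ht).prodMk ((h.run.finMeas_ω ht).prodMk
      ((h.run.finMeas_start ht).prodMk hW)))
  let G : EuclideanSpace ℝ (Fin d) × ℝ × EuclideanSpace ℝ (Fin m) × S × ℝ → ℝ :=
    fun ⟨θ, η, ω, _, W⟩ =>
    W * ((1 - coercConst m lam * β / 2) * ‖ω - criticTarget M pol φ θ‖ ^ 2
        + C * ((β * (η - avgReward M pol θ) ^ 2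
            + β ^ 2 * (mixingTime (kernel M pol θ) * Nat.log 2 Tmax) * (η - avgReward M pol θ) ^ 2)
          + (β * (mixingTime (kernel M pol θ) / Tmax)
            + β ^ 2 * (mixingTime (kernel M pol θ) * Nat.log 2 Tmax)) + Δ ^ 2 / β))
  have hG : FinMeas mΩ fun w => G (V w) := (hV.comp G).mono (ℱ.le _)
  have hR1 : FinMeas mΩ fun w => W w * X.criticErr M pol φ (t + 1) w :=
    (hW.mono (ℱ.le _)).comp₂ ((h.run.finMeas_criticErr (by omega : 1 ≤ t + 1)).mono (ℱ.le _))
      fun a b => a * b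
  have e1 : ∀ w, W w * ((1 - coercConst m lam * β / 2) * X.criticErr M pol φ t w
      + C * ((β * X.rewardErr M pol t w + β ^ 2 * q w * X.rewardErr M pol t w)
        + (β * e w + β ^ 2 * q w) + Δ ^ 2 / β)) = G (V w) := by
    intro w
    rw [hq w, he w]
    rfl
  simp_rw [e1]
  refine (hV.mono (ℱ.le _)).integral_le (hR1.integrable μ) (hG.integrable μ) ?_
  rintro ⟨θ, η, ω, s, c⟩
  have hD := hV.fiber (θ, η, ω, s, c)
  have hDv : ∀ w ∈ V ⁻¹' {(θ, η, ω, s, c)},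
      X.θ t w = θ ∧ X.η t w = η ∧ X.ω t w = ω ∧ X.st t 0 w = s ∧ W w = c := by
    intro w hw
    simpa only [V, Set.mem_preimage, Set.mem_singleton_iff, Prod.mk.injEq] using hw
  -- The sign of the weight and the bound on `ω` are available only for values that are attained.
  rcases (V ⁻¹' {(θ, η, ω, s, c)}).eq_empty_or_nonempty with h0 | ⟨w₀, hw₀⟩
  · rw [h0]; simp
  have hc0 : 0 ≤ c := (hDv w₀ hw₀).2.2.2.2 ▸ hW0 w₀
  have hωR : ‖ω‖ ≤ Rω := (hDv w₀ hw₀).2.2.1 ▸ h.run.norm_ω_le h.Rω_nonneg ht w₀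
  have hmain := h.setIntegral_criticErr_le ht hD (fun w hw => (hDv w hw).1)
    (fun w hw => (hDv w hw).2.1) (fun w hw => (hDv w hw).2.2.1)
    (fun w hw => (hDv w hw).2.2.2.1) hωR hβ rfl rfl rfl
  have hL : ∫ w in V ⁻¹' {(θ, η, ω, s, c)}, W w * X.criticErr M pol φ (t + 1) w ∂μ
      = c * ∫ w in V ⁻¹' {(θ, η, ω, s, c)}, X.criticErr M pol φ (t + 1) w ∂μ := by
    rw [← integral_const_mul]
    exact setIntegral_congr_fun (ℱ.le _ _ hD) fun w hw => by simp only [(hDv w hw).2.2.2.2]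
  have hRr : ∫ w in V ⁻¹' {(θ, η, ω, s, c)}, G (V w) ∂μ
      = μ.real (V ⁻¹' {(θ, η, ω, s, c)}) * G (θ, η, ω, s, c) := by
    rw [← smul_eq_mul, ← setIntegral_const]
    exact setIntegral_congr_fun (ℱ.le _ _ hD) fun w hw => congrArg G hw
  rw [hL, hRr]
  refine (mul_le_mul_of_nonneg_left hmain hc0).trans (le_of_eq ?_)
  simp only [G, Δ, C]
  ring

end Recursions

/-! ### Sums over the rounds -/

/-- Bernoulli's inequality: the inverse step size grows by at most `ν` per round. -/
lemma rpow_succ_le_add {ν : ℝ} (hν : 0 ≤ ν) (hν1 : ν ≤ 1) (t : ℕ) :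
    (1 + ((t + 1 : ℕ) : ℝ)) ^ ν ≤ (1 + (t : ℝ)) ^ ν + ν := by
  have h0 : (0 : ℝ) < 1 + t := by positivity
  have h1 : (1 + ((t + 1 : ℕ) : ℝ)) = (1 + t) * (1 + 1 / (1 + t)) := by
    push_cast; field_simp; ring
  have h2 : (1 + 1 / (1 + (t : ℝ))) ^ ν ≤ 1 + ν * (1 / (1 + t)) :=
    rpow_one_add_le_one_add_mul_self (by linarith [one_div_pos.2 h0]) hν hν1
  have h3 : (1 + (t : ℝ)) ^ ν * (1 / (1 + t)) ≤ 1 := by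
    rw [mul_one_div, div_le_one h0]
    exact Real.rpow_le_self_of_one_le (by linarith [Nat.cast_nonneg (α := ℝ) t]) hν1
  rw [h1, Real.mul_rpow h0.le (by positivity)]
  have h4 := mul_le_mul_of_nonneg_left h2 (Real.rpow_nonneg h0.le ν)
  have h5 := mul_le_mul_of_nonneg_left h3 hν
  linarith

lemma sum_rpow_neg_le {p : ℝ} (hp : 0 ≤ p) (hp1 : p < 1) (T : ℕ) :
    ∑ t ∈ Finset.Icc 1 T, (1 + (t : ℝ)) ^ (-p) ≤ (T : ℝ) ^ (1 - p) / (1 - p) := by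
  have hq : 0 < 1 - p := by linarith
  induction T with
  | zero => simp [Real.zero_rpow hq.ne']
  | succ T ih =>
    rw [Finset.sum_Icc_succ_top (by omega)]
    have h0 : (0 : ℝ) < (T : ℝ) + 1 := by positivity
    have h1 : (1 + -(1 / ((T : ℝ) + 1))) ^ (1 - p) ≤ 1 + (1 - p) * -(1 / (T + 1)) := by
      refine rpow_one_add_le_one_add_mul_self ?_ hq.le (by linarith)
      have : 1 / ((T : ℝ) + 1) ≤ 1 := by
        rw [div_le_one h0]; linarith [Nat.cast_nonneg (α := ℝ) T]
      linarith
    have h2 : (T : ℝ) = (T + 1) * (1 + -(1 / (T + 1))) := by field_simp; ring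
    have h3 : (0 : ℝ) ≤ 1 + -(1 / (T + 1)) := by
      have : 1 / ((T : ℝ) + 1) ≤ 1 := by
        rw [div_le_one h0]; linarith [Nat.cast_nonneg (α := ℝ) T]
      linarith
    have h4 : (T : ℝ) ^ (1 - p) ≤ ((T : ℝ) + 1) ^ (1 - p) - (1 - p) * ((T : ℝ) + 1) ^ (-p) := by
      conv_lhs => rw [h2, Real.mul_rpow h0.le h3]
      refine (mul_le_mul_of_nonneg_left h1 (Real.rpow_nonneg h0.le _)).trans (le_of_eq ?_)
      have h5 : ((T : ℝ) + 1) ^ (-p) = ((T : ℝ) + 1) ^ (1 - p) * (1 / (T + 1)) := by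
        rw [show -p = (1 - p) - 1 by ring, Real.rpow_sub_one h0.ne', mul_one_div]
      rw [h5]; ring
    have h6 : (1 + ((T + 1 : ℕ) : ℝ)) ^ (-p) ≤ ((T : ℝ) + 1) ^ (-p) :=
      Real.rpow_le_rpow_of_nonpos h0 (by push_cast; linarith) (by linarith)
    push_cast at h6 ⊢
    rw [le_div_iff₀ hq] at ih ⊢
    nlinarith

/-- The constant `1/(1 - s)` degenerates at `s = 1`. For `s ≥ 1 - ν` the sum is compared with
exponent `1 - ν`, which yields `T^ν`, a term present in the final bound anyway. -/
lemma sum_rpow_neg_le_add {s ν : ℝ} (hs : 0 ≤ s) (hν : 0 < ν) (hν1 : ν < 1) {T : ℕ} :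
    ∑ t ∈ Finset.Icc 1 T, (1 + (t : ℝ)) ^ (-s)
      ≤ 1 / ν * ((T : ℝ) ^ (1 - s) + (T : ℝ) ^ ν) := by
  have hT1 : 0 ≤ (T : ℝ) ^ (1 - s) := by positivity
  have hT2 : 0 ≤ (T : ℝ) ^ ν := by positivity
  rcases le_total s (1 - ν) with h | h
  · refine (sum_rpow_neg_le hs (by linarith) T).trans ?_
    calc (T : ℝ) ^ (1 - s) / (1 - s) ≤ (T : ℝ) ^ (1 - s) / ν := by gcongr; linarith
      _ = 1 / ν * (T : ℝ) ^ (1 - s) := by ring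
      _ ≤ _ := by gcongr; linarith
  · have h1 : ∑ t ∈ Finset.Icc 1 T, (1 + (t : ℝ)) ^ (-s)
        ≤ ∑ t ∈ Finset.Icc 1 T, (1 + (t : ℝ)) ^ (-(1 - ν)) :=
      Finset.sum_le_sum fun t _ => Real.rpow_le_rpow_of_exponent_le
        (by linarith [Nat.cast_nonneg (α := ℝ) t]) (by linarith)
    refine (h1.trans (sum_rpow_neg_le (by linarith) (by linarith) T)).trans ?_
    rw [sub_sub_cancel]
    calc (T : ℝ) ^ ν / ν = 1 / ν * (T : ℝ) ^ ν := by ring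
      _ ≤ _ := by gcongr; linarith

/-- Summation by parts: the growth of the weights costs at most `ν` of the rate `κ` per round. No
upper bound on `Y` is needed, which suits the unprojected reward estimate. -/
lemma sum_le_of_recursion {Y R a : ℕ → ℝ} {κ ν : ℝ} (hY : ∀ t, 0 ≤ Y t)
    (ha : ∀ t, a (t + 1) ≤ a t + ν) {T : ℕ}
    (hrec : ∀ t ∈ Finset.Icc 1 T, a t * Y (t + 1) + κ * Y t ≤ a t * Y t + R t) :
    (κ - ν) * ∑ t ∈ Finset.Icc 1 T, Y t + a T * Y (T + 1)
      ≤ a 0 * Y 1 + ∑ t ∈ Finset.Icc 1 T, R t := by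
  induction T with
  | zero => simp
  | succ T ih =>
    have h1 := ih fun t ht => hrec t (Finset.Icc_subset_Icc le_rfl (Nat.le_succ T) ht)
    have h2 := hrec (T + 1) (Finset.mem_Icc.2 ⟨by omega, le_rfl⟩)
    have h3 := mul_le_mul_of_nonneg_right (ha T) (hY (T + 1))
    rw [Finset.sum_Icc_succ_top (by omega), Finset.sum_Icc_succ_top (by omega)]
    linarith

/-- Here the growth of the weights is charged to the bound `x₀` instead of the contraction, whose
rate may be small. Only upper bounds on the increments of `v` are used; the weights may decrease. -/
lemma sum_mul_sub_le {x v a : ℕ → ℝ} {x₀ : ℝ} (hx : ∀ t, 1 ≤ t → 0 ≤ x t)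
    (hx₀ : ∀ t, 1 ≤ t → x t ≤ x₀) (hv : ∀ t, v (t + 1) - v t ≤ a (t + 1) - a t) (ha : Monotone a)
    (hv0 : v 0 ≤ a 0) (ha0 : 0 ≤ a 0) (T : ℕ) :
    ∑ t ∈ Finset.Icc 1 T, v t * (x t - x (t + 1)) + v T * x (T + 1) ≤ x₀ * a T := by
  induction T with
  | zero =>
    have h1 := mul_le_mul_of_nonneg_right hv0 (hx 1 le_rfl)
    have h2 := mul_le_mul_of_nonneg_right (hx₀ 1 le_rfl) ha0
    simp only [zero_add, Finset.Icc_eq_empty_of_lt one_pos, Finset.sum_empty]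
    linarith
  | succ T ih =>
    rw [Finset.sum_Icc_succ_top (by omega)]
    have h1 := mul_le_mul_of_nonneg_right (hv T) (hx (T + 1) (by omega))
    have h2 := mul_le_mul_of_nonneg_right (hx₀ (T + 1) (by omega))
      (sub_nonneg.2 (ha (Nat.le_succ T)))
    simp only [Nat.succ_eq_add_one] at h2
    linarith

/-- The weight that damps the critic recursion while the mixing time exceeds the inverse step
size `a`. -/
noncomputable def criticWeight (a q : ℝ) : ℝ := a ^ 2 / (a + q)

lemma criticWeight_nonneg {a q : ℝ} (ha : 0 ≤ a) (hq : 0 ≤ q) : 0 ≤ criticWeight a q := by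
  unfold criticWeight; positivity

lemma criticWeight_le {a q : ℝ} (ha : 0 < a) (hq : 0 ≤ q) : criticWeight a q ≤ a := by
  rw [criticWeight, div_le_iff₀ (by positivity)]
  nlinarith

/-- The defect `a - a²/(a+q)` equals `a q / (a + q)`, which increases in both variables. -/
lemma criticWeight_sub_le {a a' q q' : ℝ} (ha : 0 < a) (ha' : a ≤ a') (hq : 0 ≤ q) (hq' : q ≤ q') :
    criticWeight a' q' - criticWeight a q ≤ a' - a := by
  have e : ∀ b r : ℝ, 0 < b → 0 ≤ r → b - criticWeight b r = b * r / (b + r) := by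
    intro b r hb hr
    rw [criticWeight, eq_div_iff (by positivity), sub_mul, div_mul_cancel₀ _ (by positivity)]
    ring
  have h0 : 0 < a' := ha.trans_le ha'
  have h1 : 0 ≤ q' := hq.trans hq'
  have h2 : a * q / (a + q) ≤ a' * q' / (a' + q') := by
    rw [div_le_div_iff₀ (by positivity) (by positivity)]
    have h3 : 0 ≤ a * a' * (q' - q) := mul_nonneg (by positivity) (sub_nonneg.2 hq')
    have h4 : 0 ≤ q * q' * (a' - a) := mul_nonneg (by positivity) (sub_nonneg.2 ha')
    nlinarith
  rw [← e a q ha hq, ← e a' q' h0 h1] at h2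
  linarith

/-- Write the weight as `a w` with `w = a/(a+Q)`. Then `w β Q = 1 - w ≤ 1` reduces the product `β q
y` to `y`. The contraction is reduced to `w x`, and the loss `(1 - w) x ≤ β Q x₀` has the size of a
variance term. -/
lemma criticWeight_mul_le {a β q Q x x₀ y e c C D : ℝ} (ha : 0 < a) (hβ : β = a⁻¹) (hq : 0 ≤ q)
    (hqQ : q ≤ Q) (hx : 0 ≤ x) (hx₀ : x ≤ x₀) (hy : 0 ≤ y) (he : 0 ≤ e) (hc : 0 ≤ c) (hC : 0 ≤ C)
    (hD : 0 ≤ D) :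
    criticWeight a Q
        * ((1 - c * β / 2) * x + C * ((β * y + β ^ 2 * q * y) + (β * e + β ^ 2 * q) + D / β))
      ≤ criticWeight a Q * x - c / 2 * x + c / 2 * x₀ * (β * Q)
        + C * (2 * y + e + β * q + a ^ 2 * D) := by
  have hQ : 0 ≤ Q := hq.trans hqQ
  have hβ0 : 0 < β := by rw [hβ]; positivity
  have haβ : a * β = 1 := by rw [hβ, mul_inv_cancel₀ ha.ne']
  obtain ⟨w, hw⟩ : ∃ w, w = a / (a + Q) := ⟨_, rfl⟩
  have hv : criticWeight a Q = a * w := by rw [hw, criticWeight]; ring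
  have hw0 : 0 ≤ w := by rw [hw]; positivity
  have hw1 : w ≤ 1 := by rw [hw, div_le_one (by positivity)]; linarith
  have hwQ : w * (β * Q) = 1 - w := by
    rw [hw, hβ]; field_simp; ring
  have hwq : w * (β * q) ≤ 1 := by
    have := mul_le_mul_of_nonneg_left (mul_le_mul_of_nonneg_left hqQ hβ0.le) hw0
    linarith
  have h1w : 1 - w ≤ β * Q := by
    rw [← hwQ]; exact mul_le_of_le_one_left (by positivity) hw1
  have hDβ : D / β = a * D := by rw [hβ, div_inv_eq_mul]; ring
  have e1 : a * w * ((1 - c * β / 2) * x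
        + C * ((β * y + β ^ 2 * q * y) + (β * e + β ^ 2 * q) + D / β))
      = a * w * x - c / 2 * (w * x) + C * ((w * y + w * (β * q) * y) + (w * e + w * (β * q))
        + w * (a ^ 2 * D)) := by
    rw [hDβ]
    linear_combination (-(c / 2) * w * x + C * (w * y + w * β * q * y + w * e + w * β * q)) * haβ
  rw [hv, e1]
  have h2 : C * ((w * y + w * (β * q) * y) + (w * e + w * (β * q)) + w * (a ^ 2 * D))
      ≤ C * (2 * y + e + β * q + a ^ 2 * D) := by
    refine mul_le_mul_of_nonneg_left ?_ hC
    have i1 := mul_le_of_le_one_left hy hw1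
    have i2 := mul_le_of_le_one_left hy hwq
    have i3 := mul_le_of_le_one_left he hw1
    have i4 := mul_le_of_le_one_left (mul_nonneg hβ0.le hq) hw1
    have i5 := mul_le_of_le_one_left (mul_nonneg (sq_nonneg a) hD) hw1
    linarith
  have h3 : x - w * x ≤ x₀ * (β * Q) := by
    calc x - w * x = x * (1 - w) := by ring
      _ ≤ x₀ * (β * Q) := mul_le_mul hx₀ h1w (by linarith) (hx.trans hx₀)
  have h4 := mul_le_mul_of_nonneg_left h3 (by positivity : 0 ≤ c / 2)
  linarith

/-! ### Accumulated errors of the reward tracker and the critic. -/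

noncomputable section Summation

lemma inv_stepsize (t : ℕ) (ν : ℝ) : (1 + (t : ℝ)) ^ (-ν) = ((1 + (t : ℝ)) ^ ν)⁻¹ :=
  Real.rpow_neg (by positivity) ν

lemma sq_stepsize_mul_sq (t : ℕ) (ν σ : ℝ) :
    ((1 + (t : ℝ)) ^ ν) ^ 2 * ((1 + (t : ℝ)) ^ (-σ)) ^ 2 = (1 + (t : ℝ)) ^ (-(2 * (σ - ν))) := by
  have h : (0 : ℝ) < 1 + t := by positivity
  rw [← mul_pow, ← Real.rpow_add h, ← Real.rpow_natCast, ← Real.rpow_mul h.le]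
  congr 1
  push_cast; ring

variable {S A : Type*} [Fintype S] [DecidableEq S] [Fintype A] {rmax : ℝ} {d m : ℕ}
  {M : MDP S A rmax} {pol : PolicyClass S A d} {φ : S → EuclideanSpace ℝ (Fin m)}
  {B K L lam Rω ν σ η₁ : ℝ} {Tmax : ℕ}
  {Ω : Type*} [mΩ : MeasurableSpace Ω] {μ : Measure Ω} {ℱ : Filtration ℕ mΩ}
  {X : Iterates Ω S A d m} [Nonempty S] [Nonempty A] [IsProbabilityMeasure μ]

/-- The error injected into the recursions in the first `T` rounds: bias of the estimates, their
variance, and drift of the targets. -/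
def injectedErr (τ : ℝ) (Tmax : ℕ) (ν σ : ℝ) (T : ℕ) : ℝ :=
  ∑ t ∈ Finset.Icc 1 T, (τ / Tmax + (1 + (t : ℝ)) ^ (-ν) * (τ * Nat.log 2 Tmax)
    + (1 + (t : ℝ)) ^ (-(2 * (σ - ν))))

lemma rewardConst_nonneg (n : ℕ) (B rmax : ℝ) {ν : ℝ} (hν : ν < 1) :
    0 ≤ rewardConst n B rmax ν := by
  have : 0 < (1 - ν) / 4 := by linarith
  unfold rewardConst; positivity

lemma criticConst_nonneg (n m : ℕ) (B lam rmax Rω : ℝ) : 0 ≤ criticConst n m B lam rmax Rω := by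
  have := coercConst_pos m lam
  unfold criticConst; positivity

lemma GoodRun.integrable_maxMixing (h : GoodRun X μ ℱ M pol φ Tmax Rω ν σ η₁ B K L lam) (T : ℕ) :
    Integrable (fun w => (X.maxMixing M pol T w : ℝ)) μ :=
  (((h.run.finMeas_maxMixing T).mono (ℱ.le _)).comp fun n : ℕ => (n : ℝ)).integrable μ

lemma GoodRun.integrable_mixingTime (h : GoodRun X μ ℱ M pol φ Tmax Rω ν σ η₁ B K L lam) {t : ℕ}
    (ht : 1 ≤ t) : Integrable (fun w => (mixingTime (kernel M pol (X.θ t w)) : ℝ)) μ :=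
  (((h.run.finMeas_mixingTime ht).mono (ℱ.le _)).comp fun n : ℕ => (n : ℝ)).integrable μ

lemma GoodRun.integrable_rewardErr (h : GoodRun X μ ℱ M pol φ Tmax Rω ν σ η₁ B K L lam) {t : ℕ}
    (ht : 1 ≤ t) : Integrable (X.rewardErr M pol t) μ :=
  ((h.run.finMeas_rewardErr ht).mono (ℱ.le _)).integrable μ

lemma GoodRun.integrable_criticErr (h : GoodRun X μ ℱ M pol φ Tmax Rω ν σ η₁ B K L lam) {t : ℕ}
    (ht : 1 ≤ t) : Integrable (X.criticErr M pol φ t) μ :=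
  ((h.run.finMeas_criticErr ht).mono (ℱ.le _)).integrable μ

lemma GoodRun.integral_mixingTime_le (h : GoodRun X μ ℱ M pol φ Tmax Rω ν σ η₁ B K L lam)
    {t T : ℕ} (ht : 1 ≤ t) (htT : t ≤ T) :
    ∫ w, (mixingTime (kernel M pol (X.θ t w)) : ℝ) ∂μ ≤ ∫ w, (X.maxMixing M pol T w : ℝ) ∂μ :=
  integral_mono (h.integrable_mixingTime ht) (h.integrable_maxMixing T) fun w =>
    Nat.cast_le.2 <| X.mixingTime_le_maxMixing M pol ht htT w

/-- The recursion is divided by the step size and summed by parts; the surviving rate is `(1 + ν)/2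
- ν = (1 - ν)/2`. -/
lemma GoodRun.sum_rewardErr_le (h : GoodRun X μ ℱ M pol φ Tmax Rω ν σ η₁ B K L lam) (T : ℕ) :
    (1 - ν) / 2 * ∑ t ∈ Finset.Icc 1 T, ∫ w, X.rewardErr M pol t w ∂μ
      ≤ (|η₁| + rmax) ^ 2 + rewardConst (Fintype.card S) B rmax ν
        * injectedErr (∫ w, (X.maxMixing M pol T w : ℝ) ∂μ) Tmax ν σ T := by
  set τ := ∫ w, (X.maxMixing M pol T w : ℝ) ∂μ
  set C := rewardConst (Fintype.card S) B rmax ν with hC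
  have hC0 : 0 ≤ C := rewardConst_nonneg _ _ _ h.ν_lt_one
  have hY0 : ∀ t, 0 ≤ ∫ w, X.rewardErr M pol t w ∂μ := fun t =>
    integral_nonneg fun w => sq_nonneg _
  have hrec : ∀ t ∈ Finset.Icc 1 T,
      (1 + (t : ℝ)) ^ ν * ∫ w, X.rewardErr M pol (t + 1) w ∂μ
          + (1 + ν) / 2 * ∫ w, X.rewardErr M pol t w ∂μ
        ≤ (1 + (t : ℝ)) ^ ν * ∫ w, X.rewardErr M pol t w ∂μ
          + C * (τ / Tmax + (1 + (t : ℝ)) ^ (-ν) * (τ * Nat.log 2 Tmax)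
            + (1 + (t : ℝ)) ^ (-(2 * (σ - ν)))) := by
    intro t ht
    obtain ⟨ht1, htT⟩ := Finset.mem_Icc.1 ht
    have h1 := h.integral_rewardErr_succ_le ht1
    have h2 := h.integral_mixingTime_le ht1 htT
    have ha : 0 < (1 + (t : ℝ)) ^ ν := stepsize_pos t ν
    have hτ' : 0 ≤ ∫ w, (mixingTime (kernel M pol (X.θ t w)) : ℝ) ∂μ :=
      integral_nonneg fun w => Nat.cast_nonneg _
    rw [← sq_stepsize_mul_sq]
    rw [← hC] at h1
    have hβ := inv_stepsize t ν
    have hβ0 := stepsize_pos t (-ν)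
    generalize (1 + (t : ℝ)) ^ (-ν) = β at *
    generalize (1 + (t : ℝ)) ^ ν = a at *
    generalize (1 + (t : ℝ)) ^ (-σ) = Δ at *
    generalize ∫ w, (mixingTime (kernel M pol (X.θ t w)) : ℝ) ∂μ = τ' at *
    have haβ : a * β = 1 := by rw [hβ, mul_inv_cancel₀ ha.ne']
    have h3 : Δ ^ 2 / β = a * Δ ^ 2 := by rw [hβ, div_inv_eq_mul]; ring
    rw [h3] at h1
    have h4 := mul_le_mul_of_nonneg_left h1 ha.le
    have h5 : C * (τ' / Tmax + β * (τ' * Nat.log 2 Tmax) + a ^ 2 * Δ ^ 2)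
        ≤ C * (τ / Tmax + β * (τ * Nat.log 2 Tmax) + a ^ 2 * Δ ^ 2) := by gcongr
    generalize ∫ w, X.rewardErr M pol (t + 1) w ∂μ = y' at *
    generalize ∫ w, X.rewardErr M pol t w ∂μ = y at *
    have h6 : a * ((1 - (1 + ν) / 2 * β) * y
        + C * (β * (τ' / Tmax) + β ^ 2 * (τ' * Nat.log 2 Tmax) + a * Δ ^ 2))
        = a * y - (1 + ν) / 2 * y
          + C * (τ' / Tmax + β * (τ' * Nat.log 2 Tmax) + a ^ 2 * Δ ^ 2) := by
      linear_combination (-((1 + ν) / 2 * y) + C * (τ' / Tmax + β * (τ' * Nat.log 2 Tmax))) * haβ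
    linarith
  have hsum := sum_le_of_recursion (Y := fun t => ∫ w, X.rewardErr M pol t w ∂μ)
    (a := fun t : ℕ => (1 + (t : ℝ)) ^ ν) hY0 (rpow_succ_le_add h.ν_pos.le h.ν_lt_one.le) hrec
  have hY1 : ∫ w, X.rewardErr M pol 1 w ∂μ ≤ (|η₁| + rmax) ^ 2 := by
    have : ∫ w, X.rewardErr M pol 1 w ∂μ ≤ ∫ _, (|η₁| + rmax) ^ 2 ∂μ := by
      refine integral_mono (h.integrable_rewardErr le_rfl) (integrable_const _) fun w => ?_
      rw [Iterates.rewardErr, h.run.η_init, ← sq_abs]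
      refine pow_le_pow_left₀ (abs_nonneg _) ((abs_sub _ _).trans (add_le_add le_rfl ?_)) 2
      rw [abs_of_nonneg (avgReward_nonneg _)]
      exact avgReward_le _
    simpa using this
  have hT : 0 ≤ (1 + (T : ℝ)) ^ ν * ∫ w, X.rewardErr M pol (T + 1) w ∂μ :=
    mul_nonneg (stepsize_pos T ν).le (hY0 _)
  rw [injectedErr]
  rw [← Finset.mul_sum] at hsum
  simp only [Nat.cast_zero, add_zero, Real.one_rpow, one_mul] at hsum
  have e : (1 + ν) / 2 - ν = (1 - ν) / 2 := by ring
  rw [e] at hsum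
  linarith

lemma GoodRun.criticErr_le (h : GoodRun X μ ℱ M pol φ Tmax Rω ν σ η₁ B K L lam) {t : ℕ}
    (ht : 1 ≤ t) (w : Ω) : X.criticErr M pol φ t w ≤ 4 * Rω ^ 2 := by
  have h1 : ‖X.ω t w - criticTarget M pol φ (X.θ t w)‖ ≤ 2 * Rω :=
    (norm_sub_le _ _).trans (by linarith [h.run.norm_ω_le h.Rω_nonneg ht w, h.target_le (X.θ t w)])
  calc X.criticErr M pol φ t w ≤ (2 * Rω) ^ 2 := pow_le_pow_left₀ (norm_nonneg _) h1 2
    _ = _ := by ring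

/-- The random weight of round `t` in the critic recursion. -/
def runWeight (X : Iterates Ω S A d m) (M : MDP S A rmax) (pol : PolicyClass S A d) (Tmax : ℕ)
    (ν : ℝ) (t : ℕ) (w : Ω) : ℝ :=
  criticWeight ((1 + (t : ℝ)) ^ ν) (X.maxMixing M pol t w * Nat.log 2 Tmax)

lemma GoodRun.finMeas_runWeight (h : GoodRun X μ ℱ M pol φ Tmax Rω ν σ η₁ B K L lam) (t : ℕ) :
    FinMeas (ℱ t) (runWeight X M pol Tmax ν t) :=
  (h.run.finMeas_maxMixing t).comp fun n : ℕ =>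
    criticWeight ((1 + (t : ℝ)) ^ ν) (n * Nat.log 2 Tmax)

lemma GoodRun.integrable_runWeight_mul (h : GoodRun X μ ℱ M pol φ Tmax Rω ν σ η₁ B K L lam)
    (t : ℕ) {f : Ω → ℝ} (hf : FinMeas mΩ f) :
    Integrable (fun w => runWeight X M pol Tmax ν t w * f w) μ :=
  (((h.finMeas_runWeight t).mono (ℱ.le _)).comp₂ hf fun a b => a * b).integrable μ

/-- The weights are random, so summation by parts is done for each outcome before integrating. It
needs the maximal mixing time so far, which is nondecreasing, rather than the current one. -/
lemma GoodRun.sum_runWeight_mul_le (h : GoodRun X μ ℱ M pol φ Tmax Rω ν σ η₁ B K L lam) (T : ℕ) :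
    ∑ t ∈ Finset.Icc 1 T, ((∫ w, runWeight X M pol Tmax ν t w * X.criticErr M pol φ t w ∂μ)
        - ∫ w, runWeight X M pol Tmax ν t w * X.criticErr M pol φ (t + 1) w ∂μ)
      ≤ 4 * Rω ^ 2 * (1 + (T : ℝ)) ^ ν := by
  have hpt : ∀ w, ∑ t ∈ Finset.Icc 1 T, runWeight X M pol Tmax ν t w
      * (X.criticErr M pol φ t w - X.criticErr M pol φ (t + 1) w) ≤ 4 * Rω ^ 2 * (1 + (T : ℝ)) ^ ν := by
    intro w
    have hmono : Monotone fun t : ℕ => (1 + (t : ℝ)) ^ ν := fun s t hst =>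
      Real.rpow_le_rpow (by positivity) (by gcongr) h.ν_pos.le
    have hq : ∀ t, 0 ≤ (X.maxMixing M pol t w : ℝ) * Nat.log 2 Tmax := fun t => by positivity
    have := sum_mul_sub_le (x := fun t => X.criticErr M pol φ t w)
      (v := fun t => runWeight X M pol Tmax ν t w) (fun t _ => sq_nonneg _)
      (fun t ht => h.criticErr_le ht w)
      (fun t => criticWeight_sub_le (stepsize_pos t ν) (hmono (Nat.le_succ t)) (hq t)
        (mul_le_mul_of_nonneg_right
          (by exact_mod_cast X.maxMixing_mono M pol (Nat.le_succ t) w) (Nat.cast_nonneg _)))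
      hmono (criticWeight_le (stepsize_pos 0 ν) (hq 0)) (stepsize_pos 0 ν).le T
    have h0 : 0 ≤ runWeight X M pol Tmax ν T w * X.criticErr M pol φ (T + 1) w :=
      mul_nonneg (criticWeight_nonneg (stepsize_pos T ν).le (hq T)) (sq_nonneg _)
    linarith
  have hx : ∀ t, 1 ≤ t → FinMeas mΩ (X.criticErr M pol φ t) := fun t ht =>
    (h.run.finMeas_criticErr ht).mono (ℱ.le _)
  have hdiff : ∀ t, 1 ≤ t → FinMeas mΩ fun w =>
      X.criticErr M pol φ t w - X.criticErr M pol φ (t + 1) w := fun t ht =>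
    (hx t ht).comp₂ (hx (t + 1) (by omega)) fun a b => a - b
  have e : ∑ t ∈ Finset.Icc 1 T, ((∫ w, runWeight X M pol Tmax ν t w * X.criticErr M pol φ t w ∂μ)
        - ∫ w, runWeight X M pol Tmax ν t w * X.criticErr M pol φ (t + 1) w ∂μ)
      = ∫ w, ∑ t ∈ Finset.Icc 1 T, runWeight X M pol Tmax ν t w
        * (X.criticErr M pol φ t w - X.criticErr M pol φ (t + 1) w) ∂μ := by
    rw [integral_finsetSum _ fun t ht =>
      h.integrable_runWeight_mul t (hdiff t (Finset.mem_Icc.1 ht).1)]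
    refine Finset.sum_congr rfl fun t ht => ?_
    have ht1 := (Finset.mem_Icc.1 ht).1
    rw [← integral_sub (h.integrable_runWeight_mul t (hx t ht1))
      (h.integrable_runWeight_mul t (hx (t + 1) (by omega)))]
    simp only [mul_sub]
  rw [e]
  have := integral_mono (integrable_finsetSum _ fun t ht =>
    h.integrable_runWeight_mul t (hdiff t (Finset.mem_Icc.1 ht).1))
    (integrable_const (μ := μ) (4 * Rω ^ 2 * (1 + (T : ℝ)) ^ ν)) hpt
  simpa using this

lemma GoodRun.integral_criticErr_le (h : GoodRun X μ ℱ M pol φ Tmax Rω ν σ η₁ B K L lam)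
    {t T : ℕ} (ht : 1 ≤ t) (htT : t ≤ T) :
    coercConst m lam / 2 * ∫ w, X.criticErr M pol φ t w ∂μ
      ≤ ((∫ w, runWeight X M pol Tmax ν t w * X.criticErr M pol φ t w ∂μ)
          - ∫ w, runWeight X M pol Tmax ν t w * X.criticErr M pol φ (t + 1) w ∂μ)
        + 2 * Rω ^ 2 * ((1 + (t : ℝ)) ^ (-ν)
            * ((∫ w, (X.maxMixing M pol T w : ℝ) ∂μ) * Nat.log 2 Tmax))
        + criticConst (Fintype.card S) m B lam rmax Rω * (2 * (∫ w, X.rewardErr M pol t w ∂μ)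
          + ((∫ w, (X.maxMixing M pol T w : ℝ) ∂μ) / Tmax + (1 + (t : ℝ)) ^ (-ν)
              * ((∫ w, (X.maxMixing M pol T w : ℝ) ∂μ) * Nat.log 2 Tmax)
            + (1 + (t : ℝ)) ^ (-(2 * (σ - ν))))) := by
  set c := coercConst m lam
  have hc0 : 0 < c := coercConst_pos _ _
  have hc1 : c ≤ 1 := coercConst_le_one _ _
  set C := criticConst (Fintype.card S) m B lam rmax Rω
  have hC0 : 0 ≤ C := criticConst_nonneg _ _ _ _ _ _
  set J : ℝ := ((Nat.log 2 Tmax : ℕ) : ℝ)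
  have hJ0 : 0 ≤ J := Nat.cast_nonneg _
  set β := (1 + (t : ℝ)) ^ (-ν) with hβ
  set D := ((1 + (t : ℝ)) ^ (-σ)) ^ 2 with hD
  have hβ0 : 0 < β := stepsize_pos t _
  have hq0 : ∀ w, 0 ≤ (X.maxMixing M pol t w : ℝ) * J := fun w => by positivity
  have h1 := h.integral_mul_criticErr_succ_le ht (h.finMeas_runWeight t)
    (fun w => criticWeight_nonneg (stepsize_pos t ν).le (hq0 w)) hβ
    (q := fun w => (mixingTime (kernel M pol (X.θ t w)) : ℝ) * J)
    (e := fun w => (mixingTime (kernel M pol (X.θ t w)) : ℝ) / Tmax) (fun _ => rfl) (fun _ => rfl)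
  have hx := (h.run.finMeas_criticErr ht).mono (ℱ.le _)
  have hy := (h.run.finMeas_rewardErr ht).mono (ℱ.le _)
  have hτ := (h.run.finMeas_mixingTime ht).mono (ℱ.le _)
  have i0 := h.integrable_runWeight_mul t hx
  have i1 := h.integrable_criticErr ht
  have i2 := h.integrable_rewardErr ht
  have i3 := h.integrable_maxMixing T
  -- The weight uses the maximum up to `t`, as measurability at round `t` requires. Once the
  -- products are gone, it is replaced by the maximum up to `T`, which enters linearly.
  have hpt : ∀ w, runWeight X M pol Tmax ν t w * ((1 - c * β / 2) * X.criticErr M pol φ t w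
      + C * ((β * X.rewardErr M pol t w
        + β ^ 2 * ((mixingTime (kernel M pol (X.θ t w)) : ℝ) * J) * X.rewardErr M pol t w)
      + (β * ((mixingTime (kernel M pol (X.θ t w)) : ℝ) / Tmax)
        + β ^ 2 * ((mixingTime (kernel M pol (X.θ t w)) : ℝ) * J)) + D / β))
      ≤ (runWeight X M pol Tmax ν t w * X.criticErr M pol φ t w
        + -(c / 2) * X.criticErr M pol φ t w) + (2 * C * X.rewardErr M pol t w
        + ((2 * Rω ^ 2 * β * J + C / Tmax + C * β * J) * X.maxMixing M pol T w
          + C * (1 + (t : ℝ)) ^ (-(2 * (σ - ν))))) := by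
    intro w
    have hm : (mixingTime (kernel M pol (X.θ t w)) : ℝ) ≤ X.maxMixing M pol t w := by
      exact_mod_cast X.mixingTime_le_maxMixing M pol ht le_rfl w
    have hmT : (X.maxMixing M pol t w : ℝ) ≤ X.maxMixing M pol T w := by
      exact_mod_cast X.maxMixing_mono M pol htT w
    have hx0 : 0 ≤ X.criticErr M pol φ t w := sq_nonneg _
    have hy0 : 0 ≤ X.rewardErr M pol t w := sq_nonneg _
    have key := criticWeight_mul_le (C := C) (D := D)
      (e := (mixingTime (kernel M pol (X.θ t w)) : ℝ) / Tmax) (stepsize_pos t ν)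
      (inv_stepsize t ν) (by positivity) (mul_le_mul_of_nonneg_right hm hJ0) hx0
      (h.criticErr_le ht w) hy0 (by positivity) hc0.le hC0 (sq_nonneg _)
    refine key.trans ?_
    rw [hD, sq_stepsize_mul_sq, ← hβ]
    have k1 : c / 2 * (4 * Rω ^ 2) * (β * (X.maxMixing M pol t w * J))
        ≤ 1 / 2 * (4 * Rω ^ 2) * (β * (X.maxMixing M pol T w * J)) := by gcongr
    have k2 : C * (2 * X.rewardErr M pol t w + (mixingTime (kernel M pol (X.θ t w)) : ℝ) / Tmax
        + β * ((mixingTime (kernel M pol (X.θ t w)) : ℝ) * J) + (1 + (t : ℝ)) ^ (-(2 * (σ - ν))))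
        ≤ C * (2 * X.rewardErr M pol t w + (X.maxMixing M pol T w : ℝ) / Tmax
        + β * ((X.maxMixing M pol T w : ℝ) * J) + (1 + (t : ℝ)) ^ (-(2 * (σ - ν)))) := by
      have := hm.trans hmT
      gcongr
    refine (add_le_add (add_le_add le_rfl k1) k2).trans (le_of_eq ?_)
    change runWeight X M pol Tmax ν t w * _ - _ + _ + _ = _
    ring
  have hbig : FinMeas mΩ fun w => runWeight X M pol Tmax ν t w
      * ((1 - c * β / 2) * X.criticErr M pol φ t w
      + C * ((β * X.rewardErr M pol t w
        + β ^ 2 * ((mixingTime (kernel M pol (X.θ t w)) : ℝ) * J) * X.rewardErr M pol t w)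
      + (β * ((mixingTime (kernel M pol (X.θ t w)) : ℝ) / Tmax)
        + β ^ 2 * ((mixingTime (kernel M pol (X.θ t w)) : ℝ) * J)) + D / β)) :=
    (((h.finMeas_runWeight t).mono (ℱ.le _)).prodMk (hx.prodMk (hy.prodMk hτ))).comp
      fun ⟨v, x, y, n⟩ => v * ((1 - c * β / 2) * x
        + C * ((β * y + β ^ 2 * ((n : ℝ) * J) * y) + (β * ((n : ℝ) / Tmax) + β ^ 2 * ((n : ℝ) * J))
          + D / β))
  have j1 : Integrable (fun w => runWeight X M pol Tmax ν t w * X.criticErr M pol φ t w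
      + -(c / 2) * X.criticErr M pol φ t w) μ := i0.add (i1.const_mul _)
  have j3 : Integrable (fun w => (2 * Rω ^ 2 * β * J + C / Tmax + C * β * J)
      * X.maxMixing M pol T w + C * (1 + (t : ℝ)) ^ (-(2 * (σ - ν)))) μ :=
    (i3.const_mul _).add (integrable_const _)
  have j2 : Integrable (fun w => 2 * C * X.rewardErr M pol t w
      + ((2 * Rω ^ 2 * β * J + C / Tmax + C * β * J) * X.maxMixing M pol T w
        + C * (1 + (t : ℝ)) ^ (-(2 * (σ - ν))))) μ := (i2.const_mul _).add j3
  have h2 := h1.trans (integral_mono (hbig.integrable μ) (j1.add j2) hpt)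
  have h3 : ∫ w, ((runWeight X M pol Tmax ν t w * X.criticErr M pol φ t w
        + -(c / 2) * X.criticErr M pol φ t w) + (2 * C * X.rewardErr M pol t w
        + ((2 * Rω ^ 2 * β * J + C / Tmax + C * β * J) * X.maxMixing M pol T w
          + C * (1 + (t : ℝ)) ^ (-(2 * (σ - ν)))))) ∂μ
      = ((∫ w, runWeight X M pol Tmax ν t w * X.criticErr M pol φ t w ∂μ)
          + -(c / 2) * ∫ w, X.criticErr M pol φ t w ∂μ)
        + (2 * C * (∫ w, X.rewardErr M pol t w ∂μ)
          + ((2 * Rω ^ 2 * β * J + C / Tmax + C * β * J) * (∫ w, (X.maxMixing M pol T w : ℝ) ∂μ)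
            + C * (1 + (t : ℝ)) ^ (-(2 * (σ - ν))))) := by
    rw [integral_add j1 j2, integral_add i0 (i1.const_mul _), integral_add (i2.const_mul _) j3,
      integral_add (i3.const_mul _) (integrable_const _), integral_const_mul, integral_const_mul,
      integral_const_mul, integral_const, probReal_univ, one_smul]
  have h4 := h2.trans (le_of_eq h3)
  generalize ∫ w, (X.maxMixing M pol T w : ℝ) ∂μ = τ at *
  have h5 : C / Tmax * τ = C * (τ / Tmax) := by ring
  linarith

lemma GoodRun.sum_criticErr_le (h : GoodRun X μ ℱ M pol φ Tmax Rω ν σ η₁ B K L lam) (T : ℕ) :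
    coercConst m lam / 2 * ∑ t ∈ Finset.Icc 1 T, ∫ w, X.criticErr M pol φ t w ∂μ
      ≤ 4 * Rω ^ 2 * (1 + (T : ℝ)) ^ ν
        + 2 * Rω ^ 2 * injectedErr (∫ w, (X.maxMixing M pol T w : ℝ) ∂μ) Tmax ν σ T
        + criticConst (Fintype.card S) m B lam rmax Rω
          * (2 * (∑ t ∈ Finset.Icc 1 T, ∫ w, X.rewardErr M pol t w ∂μ)
            + injectedErr (∫ w, (X.maxMixing M pol T w : ℝ) ∂μ) Tmax ν σ T) := by
  have h1 := h.sum_runWeight_mul_le T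
  have h2 := Finset.sum_le_sum fun t ht =>
    h.integral_criticErr_le (Finset.mem_Icc.1 ht).1 (Finset.mem_Icc.1 ht).2 (T := T)
  have hτ : 0 ≤ ∫ w, (X.maxMixing M pol T w : ℝ) ∂μ := integral_nonneg fun w => Nat.cast_nonneg _
  rw [← Finset.mul_sum, Finset.sum_add_distrib, Finset.sum_add_distrib, ← Finset.mul_sum,
    ← Finset.mul_sum, Finset.sum_add_distrib, ← Finset.mul_sum] at h2
  have h3 : ∑ t ∈ Finset.Icc 1 T, (1 + (t : ℝ)) ^ (-ν)
      * ((∫ w, (X.maxMixing M pol T w : ℝ) ∂μ) * Nat.log 2 Tmax)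
      ≤ injectedErr (∫ w, (X.maxMixing M pol T w : ℝ) ∂μ) Tmax ν σ T := by
    refine Finset.sum_le_sum fun t _ => ?_
    have k1 : 0 ≤ (∫ w, (X.maxMixing M pol T w : ℝ) ∂μ) / Tmax := by positivity
    have k2 := (stepsize_pos t (-(2 * (σ - ν)))).le
    linarith
  have h4 := mul_le_mul_of_nonneg_left h3 (by positivity : 0 ≤ 2 * Rω ^ 2)
  rw [injectedErr] at h4 ⊢
  linarith

/-- The binary logarithm is at most `log Tmax / log 2`, and `Tmax ≥ 2` lets the bias `τ / Tmax`,
which lacks a logarithm, be absorbed into `τ log Tmax / Tmax`. -/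
lemma injectedErr_le {τ ν σ : ℝ} {Tmax T : ℕ} (hτ : 0 ≤ τ) (hTmax : 2 ≤ Tmax) (hT : 1 ≤ T)
    (hν : 0 < ν) (hν1 : ν < 1) (hνσ : ν < σ) :
    injectedErr τ Tmax ν σ T ≤ (1 / Real.log 2 + 1 / (Real.log 2 * (1 - ν)) + 1 / ν)
      * (T * ((T : ℝ) ^ (ν - 1) + (T : ℝ) ^ (-2 * (σ - ν)) + τ * Real.log Tmax * (T : ℝ) ^ (-ν)
        + τ * Real.log Tmax / Tmax)) := by
  have hT0 : (0 : ℝ) < T := by exact_mod_cast hT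
  have hl2 : 0 < Real.log 2 := Real.log_pos one_lt_two
  have hM0 : (0 : ℝ) < Tmax := by exact_mod_cast (by omega : 0 < Tmax)
  have hlM : Real.log 2 ≤ Real.log Tmax :=
    Real.log_le_log two_pos (by exact_mod_cast hTmax)
  have hlM0 : 0 < Real.log Tmax := hl2.trans_le hlM
  have hJ : (Nat.log 2 Tmax : ℝ) ≤ Real.log Tmax / Real.log 2 := by
    have := Real.natLog_le_logb Tmax 2
    simpa [Real.logb] using this
  have e1 : (T : ℝ) * (T : ℝ) ^ (ν - 1) = (T : ℝ) ^ ν := by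
    rw [Real.rpow_sub_one hT0.ne']; field_simp
  have e2 : (T : ℝ) * (T : ℝ) ^ (-2 * (σ - ν)) = (T : ℝ) ^ (1 - 2 * (σ - ν)) := by
    rw [show 1 - 2 * (σ - ν) = 1 + -2 * (σ - ν) by ring, Real.rpow_add hT0, Real.rpow_one]
  have e3 : (T : ℝ) * (T : ℝ) ^ (-ν) = (T : ℝ) ^ (1 - ν) := by
    rw [sub_eq_add_neg, Real.rpow_add hT0, Real.rpow_one]
  have e4 : (T : ℝ) * ((T : ℝ) ^ (ν - 1) + (T : ℝ) ^ (-2 * (σ - ν))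
      + τ * Real.log Tmax * (T : ℝ) ^ (-ν) + τ * Real.log Tmax / Tmax)
      = ((T : ℝ) ^ ν + (T : ℝ) ^ (1 - 2 * (σ - ν))) + τ * Real.log Tmax * (T : ℝ) ^ (1 - ν)
        + T * (τ * Real.log Tmax / Tmax) := by
    rw [← e1, ← e2, ← e3]; ring
  rw [e4]
  set D1 := (T : ℝ) ^ ν + (T : ℝ) ^ (1 - 2 * (σ - ν)) with hD1
  set D2 := τ * Real.log Tmax * (T : ℝ) ^ (1 - ν) with hD2
  set D3 := (T : ℝ) * (τ * Real.log Tmax / Tmax) with hD3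
  have p1 : 0 ≤ D1 := by positivity
  have p2 : 0 ≤ D2 := by positivity
  have p3 : 0 ≤ D3 := by positivity
  have hν1' : 0 < 1 - ν := by linarith
  have s1 : (T : ℝ) * (τ / Tmax) ≤ 1 / Real.log 2 * D3 := by
    have : τ / Tmax ≤ 1 / Real.log 2 * (τ * Real.log Tmax / Tmax) := by
      calc τ / Tmax = 1 / Real.log 2 * (τ * Real.log 2 / Tmax) := by field_simp
        _ ≤ _ := by gcongr
    calc (T : ℝ) * (τ / Tmax) ≤ T * (1 / Real.log 2 * (τ * Real.log Tmax / Tmax)) := by gcongr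
      _ = _ := by rw [hD3]; ring
  have s2 : (∑ t ∈ Finset.Icc 1 T, (1 + (t : ℝ)) ^ (-ν)) * (τ * Nat.log 2 Tmax)
      ≤ 1 / (Real.log 2 * (1 - ν)) * D2 := by
    calc (∑ t ∈ Finset.Icc 1 T, (1 + (t : ℝ)) ^ (-ν)) * (τ * Nat.log 2 Tmax)
        ≤ ((T : ℝ) ^ (1 - ν) / (1 - ν)) * (τ * (Real.log Tmax / Real.log 2)) := by
          gcongr
          exact sum_rpow_neg_le hν.le hν1 T
      _ = _ := by rw [hD2]; field_simp
  have s3 : ∑ t ∈ Finset.Icc 1 T, (1 + (t : ℝ)) ^ (-(2 * (σ - ν))) ≤ 1 / ν * D1 := by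
    have := sum_rpow_neg_le_add (s := 2 * (σ - ν)) (by linarith) hν hν1 (T := T)
    rw [hD1]; linarith
  have e5 : injectedErr τ Tmax ν σ T = (T : ℝ) * (τ / Tmax)
      + (∑ t ∈ Finset.Icc 1 T, (1 + (t : ℝ)) ^ (-ν)) * (τ * Nat.log 2 Tmax)
      + ∑ t ∈ Finset.Icc 1 T, (1 + (t : ℝ)) ^ (-(2 * (σ - ν))) := by
    rw [injectedErr, Finset.sum_add_distrib, Finset.sum_add_distrib, Finset.sum_const,
      Nat.card_Icc, Finset.sum_mul, nsmul_eq_mul, add_tsub_cancel_right]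
  have s4 := sum_mul_le_mul_sum (by positivity : 0 ≤ 1 / Real.log 2)
    (by positivity : 0 ≤ 1 / (Real.log 2 * (1 - ν))) (by positivity : 0 ≤ 1 / ν) p3 p2 p1
  rw [e5]
  have e6 : D1 + D2 + D3 = D3 + D2 + D1 := by ring
  rw [e6]
  linarith

/-- The constant of the bound on the accumulated reward errors. -/
def rewardSumConst (n : ℕ) (B rmax η₁ ν : ℝ) : ℝ :=
  2 / (1 - ν) * ((|η₁| + rmax) ^ 2 + rewardConst n B rmax ν
    * (1 / Real.log 2 + 1 / (Real.log 2 * (1 - ν)) + 1 / ν))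

/-- The constant of the bound on the accumulated critic errors. -/
def criticSumConst (n m : ℕ) (B lam rmax Rω η₁ ν : ℝ) : ℝ :=
  2 / coercConst m lam * (8 * Rω ^ 2
    + 2 * Rω ^ 2 * (1 / Real.log 2 + 1 / (Real.log 2 * (1 - ν)) + 1 / ν)
    + criticConst n m B lam rmax Rω * (2 * rewardSumConst n B rmax η₁ ν
      + (1 / Real.log 2 + 1 / (Real.log 2 * (1 - ν)) + 1 / ν)))

lemma GoodRun.sum_trackingErr_le (h : GoodRun X μ ℱ M pol φ Tmax Rω ν σ η₁ B K L lam) {T : ℕ}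
    (hT : 1 ≤ T) :
    ∑ t ∈ Finset.Icc 1 T, X.trackingErr μ M pol φ t
      ≤ (rewardSumConst (Fintype.card S) B rmax η₁ ν
          + criticSumConst (Fintype.card S) m B lam rmax Rω η₁ ν)
        * (T * ((T : ℝ) ^ (ν - 1) + (T : ℝ) ^ (-2 * (σ - ν))
          + (∫ w, (X.maxMixing M pol T w : ℝ) ∂μ) * Real.log Tmax * (T : ℝ) ^ (-ν)
          + (∫ w, (X.maxMixing M pol T w : ℝ) ∂μ) * Real.log Tmax / Tmax)) := by
  have hτ : 0 ≤ ∫ w, (X.maxMixing M pol T w : ℝ) ∂μ := integral_nonneg fun w => Nat.cast_nonneg _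
  have hF := injectedErr_le hτ h.two_le hT h.ν_pos h.ν_lt_one h.ν_lt_σ
  have hY := h.sum_rewardErr_le T
  have hX := h.sum_criticErr_le T
  generalize ∫ w, (X.maxMixing M pol T w : ℝ) ∂μ = τ at *
  have hT0 : (0 : ℝ) < T := by exact_mod_cast hT
  have hT1 : (1 : ℝ) ≤ T := by exact_mod_cast hT
  have hlM : 0 ≤ Real.log Tmax := Real.log_natCast_nonneg _
  -- The first term of the bound, multiplied by `T`, is `T^ν`. It carries the initial reward error
  -- and the boundary term of the weighted critic sum.
  have hD : (T : ℝ) ^ ν ≤ T * ((T : ℝ) ^ (ν - 1) + (T : ℝ) ^ (-2 * (σ - ν))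
      + τ * Real.log Tmax * (T : ℝ) ^ (-ν) + τ * Real.log Tmax / Tmax) := by
    have e : (T : ℝ) ^ ν = (T : ℝ) * (T : ℝ) ^ (ν - 1) := by
      rw [Real.rpow_sub_one hT0.ne']; field_simp
    rw [e]
    refine mul_le_mul_of_nonneg_left ?_ hT0.le
    rw [add_assoc, add_assoc]
    exact le_add_of_nonneg_right (by positivity)
  have hD1 : 1 ≤ (T : ℝ) ^ ν := Real.one_le_rpow hT1 h.ν_pos.le
  have ha : (1 + (T : ℝ)) ^ ν ≤ 2 * (T : ℝ) ^ ν := by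
    have h2 : (2 : ℝ) ^ ν ≤ 2 := by
      have := Real.rpow_le_rpow_of_exponent_le one_le_two h.ν_lt_one.le
      rwa [Real.rpow_one] at this
    calc (1 + (T : ℝ)) ^ ν ≤ (2 * T) ^ ν :=
          Real.rpow_le_rpow (by positivity) (by linarith) h.ν_pos.le
      _ = 2 ^ ν * (T : ℝ) ^ ν := Real.mul_rpow two_pos.le hT0.le
      _ ≤ _ := by gcongr
  generalize (T : ℝ) * ((T : ℝ) ^ (ν - 1) + (T : ℝ) ^ (-2 * (σ - ν))
      + τ * Real.log Tmax * (T : ℝ) ^ (-ν) + τ * Real.log Tmax / Tmax) = D at *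
  generalize injectedErr τ Tmax ν σ T = F at *
  have e : ∑ t ∈ Finset.Icc 1 T, X.trackingErr μ M pol φ t
      = ∑ t ∈ Finset.Icc 1 T, ∫ w, X.rewardErr M pol t w ∂μ
        + ∑ t ∈ Finset.Icc 1 T, ∫ w, X.criticErr M pol φ t w ∂μ := by
    simp only [Iterates.trackingErr]
    rw [Finset.sum_add_distrib]
  rw [e]
  generalize ∑ t ∈ Finset.Icc 1 T, ∫ w, X.rewardErr M pol t w ∂μ = sY at *
  generalize ∑ t ∈ Finset.Icc 1 T, ∫ w, X.criticErr M pol φ t w ∂μ = sX at *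
  have hν1 : 0 < 1 - ν := by linarith [h.ν_lt_one]
  have hc := coercConst_pos m lam
  have hC0 := rewardConst_nonneg (Fintype.card S) B rmax h.ν_lt_one
  have hC1 := criticConst_nonneg (Fintype.card S) m B lam rmax Rω
  have hY' : sY ≤ rewardSumConst (Fintype.card S) B rmax η₁ ν * D := by
    rw [rewardSumConst]
    generalize 1 / Real.log 2 + 1 / (Real.log 2 * (1 - ν)) + 1 / ν = E at *
    have k1 := mul_le_mul_of_nonneg_left hF hC0
    have k2 := mul_le_mul_of_nonneg_left (hD1.trans hD) (sq_nonneg (|η₁| + rmax))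
    have k3 : (1 - ν) / 2 * sY ≤ ((|η₁| + rmax) ^ 2 + rewardConst (Fintype.card S) B rmax ν * E) * D := by
      linarith
    calc sY = 2 / (1 - ν) * ((1 - ν) / 2 * sY) := by field_simp
      _ ≤ 2 / (1 - ν) * (((|η₁| + rmax) ^ 2 + rewardConst (Fintype.card S) B rmax ν * E) * D) := by
        gcongr
      _ = _ := by ring
  have hX' : sX ≤ criticSumConst (Fintype.card S) m B lam rmax Rω η₁ ν * D := by
    rw [criticSumConst]
    generalize 1 / Real.log 2 + 1 / (Real.log 2 * (1 - ν)) + 1 / ν = E at *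
    generalize rewardSumConst (Fintype.card S) B rmax η₁ ν = CY at *
    generalize criticConst (Fintype.card S) m B lam rmax Rω = C at *
    generalize coercConst m lam = c at *
    have k0 : 4 * Rω ^ 2 * (1 + (T : ℝ)) ^ ν ≤ 4 * Rω ^ 2 * (2 * D) :=
      mul_le_mul_of_nonneg_left (by linarith) (by positivity)
    have k1 := mul_le_mul_of_nonneg_left hF (by positivity : 0 ≤ 2 * Rω ^ 2)
    have k2 : C * (2 * sY + F) ≤ C * (2 * (CY * D) + E * D) :=
      mul_le_mul_of_nonneg_left (by linarith) hC1
    have k3 : c / 2 * sX ≤ (8 * Rω ^ 2 + 2 * Rω ^ 2 * E + C * (2 * CY + E)) * D := by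
      linarith
    calc sX = 2 / c * (c / 2 * sX) := by field_simp
      _ ≤ 2 / c * ((8 * Rω ^ 2 + 2 * Rω ^ 2 * E + C * (2 * CY + E)) * D) := by gcongr
      _ = _ := by ring
  linarith

end Summation

end MAC

theorem mainTheorem4 (n m : ℕ) (rmax lam B K L Rω η₁ ν σ : ℝ)
    (hlam : 0 < lam) (hν : 0 < ν) (hνσ : ν < σ) (hσ : σ < 1) :
    ∃ C : ℝ, ∀ (S A Ω : Type*) [Fintype S] [DecidableEq S] [Fintype A] [mΩ : MeasurableSpace Ω]
      (μ : Measure Ω) [IsProbabilityMeasure μ]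
      (ℱ : Filtration ℕ mΩ)
      (d Tmax : ℕ) (M : MAC.MDP S A rmax) (pol : MAC.PolicyClass S A d)
      (φ : S → EuclideanSpace ℝ (Fin m)) (X : MAC.Iterates Ω S A d m),
      Fintype.card S = n →
      2 ≤ Tmax →
      (∀ s, ‖φ s‖ ≤ 1) →
      pol.Regular B K L →
      MAC.Ergodic M pol →
      MAC.CriticPosDef M pol φ lam →
      (∀ θ, ‖MAC.criticTarget M pol φ θ‖ ≤ Rω) →
      X.IsRun μ ℱ M pol φ Tmax Rω ν σ η₁ →
      ∀ T : ℕ, 1 ≤ T →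
        (∀ t ∈ Finset.Icc 1 T,
          Integrable (X.rewardErr M pol t) μ ∧ Integrable (X.criticErr M pol φ t) μ) ∧
        Integrable (fun w => (X.maxMixing M pol T w : ℝ)) μ ∧
        (1 / (T : ℝ)) * ∑ t ∈ Finset.Icc 1 T, X.trackingErr μ M pol φ t ≤
          C * ((T : ℝ) ^ (ν - 1) + (T : ℝ) ^ (-2 * (σ - ν))
            + (∫ w, (X.maxMixing M pol T w : ℝ) ∂μ) * Real.log Tmax * (T : ℝ) ^ (-ν)
            + (∫ w, (X.maxMixing M pol T w : ℝ) ∂μ) * Real.log Tmax / Tmax) := by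
  refine ⟨MAC.rewardSumConst n B rmax η₁ ν + MAC.criticSumConst n m B lam rmax Rω η₁ ν, ?_⟩
  intro S A Ω _ _ _ mΩ μ _ ℱ d Tmax M pol φ X hn hT hφ hreg herg hA hR hX T hT1
  -- A probability space is nonempty, and the values of `X`, even the unused ones at round 0, then
  -- show that states and actions exist.
  obtain ⟨w₀⟩ : Nonempty Ω := μ.nonempty_of_neZero
  have : Nonempty S := ⟨X.st 0 0 w₀⟩
  have : Nonempty A := ⟨X.act 0 0 w₀⟩
  have h : MAC.GoodRun X μ ℱ M pol φ Tmax Rω ν σ η₁ B K L lam :=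
    ⟨hX, hT, hφ, hreg, herg, hA, hR, hlam, hν, hνσ, hσ⟩
  refine ⟨fun t ht => ⟨h.integrable_rewardErr (Finset.mem_Icc.1 ht).1,
    h.integrable_criticErr (Finset.mem_Icc.1 ht).1⟩, h.integrable_maxMixing T, ?_⟩
  have hT0 : (0 : ℝ) < T := by exact_mod_cast hT1
  have key := h.sum_trackingErr_le hT1
  rw [hn] at key
  rw [one_div_mul_eq_div, div_le_iff₀ hT0]
  exact key.trans (le_of_eq (by ring))
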